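/- **Theorem.** Let $S\in\{\mathrm{SCMP},\mathrm{CMV},\mathrm{CMV}^+\}$ and $T\in\{\mathrm{LCMV},\mathrm{LCMV}^+,\mathrm{MCBS},\mathrm{SCBS},\mathrm{BS},\mathrm{DMP},\mathrm{SMP},\mathrm{MP}\}$. There is no good encoding from $S$ into $T$. The notions used are the following. Values $v$ are variables, numbers $1,2,\dots$ or booleans $\mathtt{tt},\mathtt{ff}$. All calculi contain an inert constant $\checkmark$, typed like $\mathbf 0$. Terms are taken up to renaming of bound variables, and summands and branches are unordered. *Multiparty calculi.* Processes are $P::=\mathbf 0\mid\checkmark\mid X\mid\mu X.P\mid\sum_{i\in I}\pi_i.P_i\mid \mathsf{if}\ v\ \mathsf{then}\ P\ \mathsf{else}\ P$, with $I\neq\emptyset$ finite, recursion guarded, and prefixes $\pi::=p!\ell\langle v\rangle\mid p?\ell(x)$. Sessions are $M::=p{:}P\mid M|M$ with pairwise different participants $p$. Structural congruence $\equiv$ is the least congruence for which $|$ is commutative and associative, $p{:}\mathbf 0|M\equiv M$ and $\mu X.P\equiv P\{\mu X.P/X\}$. Reduction is closed under $\equiv$ and given by $p{:}(q?\ell(x).P+R_1)\,|\,q{:}(p!\ell\langle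 v\rangle.Q+R_2)\,|\,M\to p{:}P\{v/x\}\,|\,q{:}Q\,|\,M$ and by $p{:}\mathsf{if}\ \mathtt{tt}\ \mathsf{then}\ P_1\ \mathsf{else}\ P_2\,|\,M\to p{:}P_1|M$, and likewise for $\mathtt{ff}$ and $P_2$. Local types are $T::=\mathsf{end}\mid t\mid\mu t.T\mid\sum_{i\in I}p_i\dagger_i\ell_i(U_i).T_i$ with $\dagger_i\in\{!,?\}$, $U_i\in\{\mathsf{nat},\mathsf{bool}\}$, $I\ne\emptyset$ finite, recursion guarded, and the triples $(p_i,\dagger_i,\ell_i)$ pairwise different. Subtyping $\leqslant$ is coinductive, up to unfolding of recursion: $\mathsf{end}\leqslant\mathsf{end}$, and for sums $A\leqslant B$ iff every output summand of $A$ has a counterpart in $B$ and every input summand of $B$ has a counterpart in $A$ (same participant, label and payload, and related continuations), $B$ has outputs only to participants to which $A$ has outputs, and $A$ has inputs only from participants from which $B$ has inputs. Process typing $\Gamma\vdash P\triangleright T$ is standard: $\mathbf 0,\checkmark$ have type $\mathsf{end}$; a process variable has its declared type; a conditional on a boolean has the common type of its branches; $\mu X.P$ has type $T$ if $P$ has under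 $X{:}T$; subsumption along $\leqslant$; and a choice has type $\sum_{i\in I}p_i\dagger_i\ell_i(U_i).T_i$ if its branches can be grouped into non-empty families indexed by $I$, such that the branches of the $i$-th family have a common prefix of the form $p_i\dagger_i\ell_i$ with payload of type $U_i$ and continuations of type $T_i$. A local context $\Delta=\{p_i{:}T_i\}$ reduces when one participant can send to another one (with type $p!\ell(U)$) what the latter can receive with the same label and payload type. $\Delta$ is *safe* if in every context reachable from it, whenever $p$ can send to $q$ and $q$ can receive from $p$, then every such send of $p$ can be received by $q$. It is *deadlock-free* if every reachable context without further reductions assigns $\mathsf{end}$ only. A session $\prod_i p_i{:}P_i$ is *typed* by $\Delta=\{p_i{:}T_i\}$ if $\vdash P_i\triangleright T_i$ for all $i$ and $\Delta$ is safe. Each multiparty calculus consists of those sessions in the respective syntactic fragment that are typed by some deadlock-free $\Delta$. The fragments are: - SCMP: each choice consists of inputs only or of outputs only. - DMP: all prefixes of a choice address the same participant. - SMP: both of these. - MP: each choice is a sum of inputs from one participant, or a single output. - MCBS, SCBS, BS: two-party sessions (at most two participants, addressing only each other) whose choices are arbitrary, as in SCMP, and as in MP, respectively. *Mixed sessions.*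 Processes of $\mathrm{CMV}^+$ are $P::=q\,y\sum_{i\in I}\ell_i{*_i}v_i.P_i\mid P|P\mid(\nu yz)P\mid\mathsf{if}\ v\ \mathsf{then}\ P\ \mathsf{else}\ P\mid\mathbf 0\mid\checkmark$ with $q\in\{\mathsf{lin},\mathsf{un}\}$ and $*_i\in\{!,?\}$. An input binds its variable, and $(\nu yz)$ binds the two endpoints of a channel. CMV has, instead of choices, the constructs $y!v.P$, $q\,y?x.P$, $x\triangleleft\ell.P$ and $x\triangleright\{\ell_i{:}P_i\}_{i\in I}$. Structural congruence is the least congruence with the commutative monoid laws of $(|,\mathbf 0)$, $(\nu yz)\mathbf 0\equiv\mathbf 0$, $(\nu yz)P\equiv(\nu zy)P$, exchange of restrictions, and scope extrusion. Reduction is closed under $\equiv$, $|$ and $\nu$, resolves conditionals on $\mathtt{tt}$ and $\mathtt{ff}$, and lets matching outputs and inputs (or selections and branchings) on the two endpoints of a restricted channel communicate, where $\mathsf{un}$ choices and $\mathsf{un}$ inputs persist and $\mathsf{lin}$ ones are consumed. Types are $\mathsf{end},\mathsf{nat},\mathsf{bool},t,\mu t.T$ and, for $\mathrm{CMV}^+$,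 $q\#\{\ell_i{*_i}T_i.U_i\}_{i\in I}$ with $\#\in\{\oplus,\&\}$; for CMV, $q{*}T.U$ and $q\#\{\ell_i{:}T_i\}_{i\in I}$. Index sets are non-empty, labels (with polarities) are distinct, and recursion is contractive. Terms are typed by the standard linear/unrestricted type systems of Casal, Mordido and Vasconcelos for these calculi, with context splitting, coinductive duality for $(\nu yz)$, and coinductive subtyping. $\mathrm{CMV}^+$ and CMV consist of the terms that are typed in some context. $\mathrm{LCMV}^+$ and LCMV consist of the terms of the respective calculus that have at most one restriction and are typed without using $\mathsf{un}$ in types and with only $\mathsf{nat}$ and $\mathsf{bool}$ as payload types. *Success, steps.* Write $\to^*=(\equiv\cup\to)^*$, and $M\to^\omega$ if $M$ has an infinite sequence of steps. $M{\Downarrow}$ means that some $M'$ with $M\to^*M'$ has an occurrence of $\checkmark$ that is not under a prefix (choice, selection, branching) or a conditional. $M$ is *distributable* into $M_1,\dots,M_n$ ($n\ge1$) if $M\equiv M_1|\dots|M_n$ without unfolding recursion. *Good encodings.* Let $\asymp$ be an equivalence on target terms that is a success respecting weak reduction bisimulation: $N_1\asymp N_2$ implies $N_1{\Downarrow}\Leftrightarrow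 N_2{\Downarrow}$, and every $N_1\to^*N_1'$ is matched by some $N_2\to^*N_2'$ with $N_1'\asymp N_2'$. Let $\varphi$ be a renaming policy, which maps source names to vectors of target names such that the vectors of different names do not overlap. Names are participants and variables in the multiparty calculi, and variables and channel endpoints in the calculi of mixed sessions. A function $[\![\cdot]\!]$ that maps terms of $S$ to terms of $T$, and is defined on all phrases of which they are composed, is a *good encoding* if, for some such $\asymp$ and $\varphi$: 1. (compositionality) for every $n$-ary operator $\mathsf{op}$ of $S$ and every set $\mathcal P$ of participants (for mixed sessions: of free names) there is a context $C$ of $T$ with $n$ holes, each occurring once, such that $[\![\mathsf{op}(M_1,\dots,M_n)]\!]=C[[\![M_1]\!],\dots,[\![M_n]\!]]$ whenever $M_1,\dots,M_n$ and $\mathsf{op}(M_1,\dots,M_n)$ are typed phrases and $\mathcal P$ is the set of all participants (free names) of $M_1,\dots,M_n$; 2. (name invariance) for every term $M$ and every substitution $\sigma$ of names such that $M\sigma$ is a term of $S$, there is a $\sigma'$ with $\varphi(\sigma(a))=\sigma'(\varphi(a))$ for all names $a$ and $[\![M\sigma]\!]=[\![M]\!]\sigma'$ if $\sigma$ is injective,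 $[\![M\sigma]\!]\asymp[\![M]\!]\sigma'$ otherwise; 3. (operational correspondence) $M\to^*M'$ implies $[\![M]\!]\to^*\asymp[\![M']\!]$; and $[\![M]\!]\to^*N$ implies that there is an $M'$ with $M\to^*M'$ and $N\to^*\asymp[\![M']\!]$; 4. (divergence reflection) $[\![M]\!]\to^\omega$ implies $M\to^\omega$; 5. (success sensitiveness) $M{\Downarrow}$ iff $[\![M]\!]{\Downarrow}$; 6. (distributability preservation) if $M$ is distributable into terms $M_1,\dots,M_n$ of $S$, then $[\![M]\!]$ is distributable into some $N_1,\dots,N_n$ with $N_i\asymp[\![M_i]\!]$ for all $i$. -/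

import Mathlib

namespace SessionCalculi

/-! ### Variables, values and simultaneous substitutions

Binders are represented in the locally nameless style: a variable is either free and has a name, or
bound and is a de Bruijn index.  Hence equality of terms is equality up to renaming of bound variables,
and the binding operators of the calculi (which bind a *named* variable) are functions that turn a free
name into an index. -/

/-- Variables: named free ones and indices of bound ones. -/
inductive Var where
  | fr (x : ℕ)
  | bd (k : ℕ)
deriving DecidableEq

/-- Values: variables, numbers `1, 2, …` and booleans. -/
inductive Val where
  | var (x : Var)
  | num (n : ℕ+)
  | tt
  | ff

/-- Simultaneous substitutions of values for variables. -/
abbrev Sub := Var → Val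

def Val.sub (σ : Sub) : Val → Val
  | .var x => σ x
  | .num n => .num n
  | .tt => .tt
  | .ff => .ff

def Sub.shift : Sub
  | .fr x => .var (.fr x)
  | .bd k => .var (.bd (k + 1))

/-- Passing a substitution under one binder. -/
def Sub.lift (σ : Sub) : Sub
  | .fr x => (σ (.fr x)).sub Sub.shift
  | .bd 0 => .var (.bd 0)
  | .bd (k + 1) => (σ (.bd k)).sub Sub.shift

def Sub.liftN : ℕ → Sub → Sub
  | 0, σ => σ
  | n + 1, σ => (Sub.liftN n σ).lift

/-- Replace the outermost bound variable by `v`. -/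
def Sub.inst (v : Val) : Sub
  | .fr x => .var (.fr x)
  | .bd 0 => v
  | .bd (k + 1) => .var (.bd k)

/-- Bind the free variable `x`. -/
def Sub.bind (x : ℕ) : Sub
  | .fr y => if y = x then .var (.bd 0) else .var (.fr y)
  | .bd k => .var (.bd (k + 1))

/-- Bind the free variables `x` and `y` simultaneously. -/
def Sub.bind₂ (x y : ℕ) : Sub
  | .fr z => if z = x then .var (.bd 0) else if z = y then .var (.bd 1) else .var (.fr z)
  | .bd k => .var (.bd (k + 2))

/-- Rename free variables. -/
def Sub.ofNames (f : ℕ → ℕ) : Sub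
  | .fr x => .var (.fr (f x))
  | .bd k => .var (.bd k)

/-- Rename bound variables. -/
def Sub.ofIndices (f : ℕ → ℕ) : Sub
  | .fr x => .var (.fr x)
  | .bd k => .var (.bd (f k))

/-- The names of the free variables of a value. -/
def Val.names : Val → Set ℕ
  | .var (.fr x) => {x}
  | _ => ∅

/-- Finite or infinite typing contexts: partial maps from variables to types. -/
abbrev Ctxt (α : Type) := Var → Option α

/-- Extend a context by a type for a new outermost bound variable. -/
def Ctxt.ext {α : Type} (Γ : Ctxt α) (a : α) : Ctxt α
  | .fr x => Γ (.fr x)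
  | .bd 0 => some a
  | .bd (k + 1) => Γ (.bd k)

/-- The context has no entries for indices, i.e. it types named variables only. -/
def Ctxt.Named {α : Type} (Γ : Ctxt α) : Prop := ∀ k, Γ (.bd k) = none

/-- Polarities: `!` and `?`. -/
inductive Pol where
  | snd
  | rcv
deriving DecidableEq

/-! ### Process calculi and good encodings -/

/-- What the encodability criteria need to know about a calculus. -/
structure Calculus where
  /-- all terms, typed or not (processes as well as sessions) -/
  Term : Type
  /-- the terms that make up the calculus: those of its typed (and deadlock-free) fragment -/
  IsTerm : Term → Prop
  /-- the typable phrases from which such terms are composed -/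
  IsPhrase : Term → Prop
  /-- structural congruence -/
  Cong : Term → Term → Prop
  /-- structural congruence without unfolding of recursion -/
  Cong₀ : Term → Term → Prop
  /-- one reduction step -/
  Step : Term → Term → Prop
  par : Term → Term → Term
  /-- there is an unguarded occurrence of `✓` -/
  HasSuccess : Term → Prop
  /-- the operators of the syntax -/
  Op : Type
  arity : Op → ℕ
  build : (o : Op) → (Fin (arity o) → Term) → Term
  /-- names, the subjects of renaming -/
  Name : Type
  /-- the names that the translation of an operator may depend on -/
  names : Term → Set Name
  /-- substitutions of names for names -/
  Ren : Type
  app : Ren → Name → Name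
  ren : Ren → Term → Term

namespace Calculus

variable (L : Calculus)

/-- `→* = (≡ ∪ →)*` -/
def Steps : L.Term → L.Term → Prop :=
  Relation.ReflTransGen fun M N => L.Cong M N ∨ L.Step M N

/-- `M →^ω` -/
def Diverges (M : L.Term) : Prop :=
  ∃ s : ℕ → L.Term, s 0 = M ∧ ∀ n, L.Step (s n) (s (n + 1))

/-- `M` may reach success. -/
def MaySucceed (M : L.Term) : Prop := ∃ M', L.Steps M M' ∧ L.HasSuccess M'

/-- `M₁ | (M₂ | (… | Mₙ))` -/
def parAll : L.Term → List L.Term → L.Term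
  | M, [] => M
  | M, N :: l => L.par M (parAll N l)

/-- `M` is distributable into the terms `M₁, Ms` -/
def Distributable (M M₁ : L.Term) (Ms : List L.Term) : Prop := L.Cong₀ M (L.parAll M₁ Ms)

/-- Success respecting weak reduction bisimulation. -/
structure IsBisimulation (R : L.Term → L.Term → Prop) : Prop where
  forth : ∀ M N M', R M N → L.Steps M M' → ∃ N', L.Steps N N' ∧ R M' N'
  back : ∀ M N N', R M N → L.Steps N N' → ∃ M', L.Steps M M' ∧ R M' N'
  success : ∀ M N, R M N → (L.MaySucceed M ↔ L.MaySucceed N)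

/-- Contexts with `n` holes. -/
inductive Cxt (n : ℕ) where
  | hole (i : Fin n)
  | node (o : L.Op) (args : Fin (L.arity o) → Cxt n)

variable {L}

def Cxt.fill {n : ℕ} (Ms : Fin n → L.Term) : L.Cxt n → L.Term
  | .hole i => Ms i
  | .node o args => L.build o fun k => (args k).fill Ms

def Cxt.count {n : ℕ} (i : Fin n) : L.Cxt n → ℕ
  | .hole j => if j = i then 1 else 0
  | .node _ args => ∑ k, (args k).count i

/-- Each of the `n` holes occurs exactly once. -/
def Cxt.Linear {n : ℕ} (C : L.Cxt n) : Prop := ∀ i, C.count i = 1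

end Calculus

/-- `enc` is a good encoding of `S` into `T` with respect to the equivalence `eqv` on target terms and
the renaming policy `φ`. -/
structure IsGoodEncodingWith (S T : Calculus) (enc : S.Term → T.Term)
    (eqv : T.Term → T.Term → Prop) (φ : S.Name → List T.Name) : Prop where
  /-- terms of the source calculus are mapped to terms of the target calculus -/
  maps : ∀ M, S.IsTerm M → T.IsTerm (enc M)
  equivalence : Equivalence eqv
  bisimulation : T.IsBisimulation eqv
  /-- different names are translated into non-overlapping vectors of names -/
  policy : ∀ a b, a ≠ b → List.Disjoint (φ a) (φ b)
  compositional : ∀ (o : S.Op) (A : Set S.Name), ∃ C : T.Cxt (S.arity o), C.Linear ∧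
    ∀ Ms : Fin (S.arity o) → S.Term, (∀ i, S.IsPhrase (Ms i)) → S.IsPhrase (S.build o Ms) →
      (⋃ i, S.names (Ms i)) = A → enc (S.build o Ms) = C.fill fun i => enc (Ms i)
  nameInvariant : ∀ (M : S.Term) (σ : S.Ren), S.IsTerm M → S.IsTerm (S.ren σ M) →
    ∃ σ' : T.Ren, (∀ a, φ (S.app σ a) = (φ a).map (T.app σ')) ∧
      (Function.Injective (S.app σ) → enc (S.ren σ M) = T.ren σ' (enc M)) ∧
      (¬ Function.Injective (S.app σ) → eqv (enc (S.ren σ M)) (T.ren σ' (enc M)))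
  complete : ∀ M M', S.IsTerm M → S.IsTerm M' → S.Steps M M' →
    ∃ N, T.Steps (enc M) N ∧ eqv N (enc M')
  sound : ∀ M N, S.IsTerm M → T.Steps (enc M) N →
    ∃ M', S.IsTerm M' ∧ S.Steps M M' ∧ ∃ N', T.Steps N N' ∧ eqv N' (enc M')
  divergenceReflecting : ∀ M, S.IsTerm M → T.Diverges (enc M) → S.Diverges M
  successSensitive : ∀ M, S.IsTerm M → (S.MaySucceed M ↔ T.MaySucceed (enc M))
  distributabilityPreserving : ∀ (M M₁ : S.Term) (Ms : List S.Term),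
    S.IsTerm M → (∀ M' ∈ M₁ :: Ms, S.IsTerm M') → S.Distributable M M₁ Ms →
      ∃ (N₁ : T.Term) (Ns : List T.Term), T.Distributable (enc M) N₁ Ns ∧
        List.Forall₂ (fun N M' => eqv N (enc M')) (N₁ :: Ns) (M₁ :: Ms)

/-- `enc` is a good encoding: all criteria hold for some choice of the behavioural equivalence and of the
renaming policy. -/
def IsGoodEncoding (S T : Calculus) (enc : S.Term → T.Term) : Prop :=
  ∃ eqv φ, IsGoodEncodingWith S T enc eqv φ

/-! ### The multiparty calculi: syntax and reduction -/

namespace MC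

/-- Prefixes `p!ℓ⟨v⟩` and `p?ℓ(·)`.  The variable of an input is bound in the continuation. -/
inductive Pre where
  | out (p ℓ : ℕ) (v : Val)
  | inp (p ℓ : ℕ)

def Pre.peer : Pre → ℕ
  | .out p _ _ => p
  | .inp p _ => p

def Pre.IsOut : Pre → Prop
  | .out _ _ _ => True
  | .inp _ _ => False

/-- The number of variables that a prefix binds in its continuation. -/
def Pre.binds : Pre → ℕ
  | .out _ _ _ => 0
  | .inp _ _ => 1

def Pre.vsub (σ : Sub) : Pre → Pre
  | .out p ℓ v => .out p ℓ (v.sub σ)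
  | .inp p ℓ => .inp p ℓ

def Pre.renRoles (f : ℕ → ℕ) : Pre → Pre
  | .out p ℓ v => .out (f p) ℓ v
  | .inp p ℓ => .inp (f p) ℓ

/-- Processes and sessions: `0`, `✓`, process variables, recursion, choices `Σ_{i<n} π_i.P_i`,
conditionals; and located processes `p:P` and parallel composition.  Which phrases are processes and
which are sessions is determined by the typing rules. -/
inductive Tm where
  | nil
  | ok
  | pvar (X : Var)
  | mu (P : Tm)
  | sum (n : ℕ) (π : Fin n → Pre) (P : Fin n → Tm)
  | cnd (v : Val) (P Q : Tm)
  | loc (p : ℕ) (P : Tm)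
  | par (M N : Tm)

namespace Tm

/-- Substitution of values for variables. -/
def vsub : Sub → Tm → Tm
  | _, nil => nil
  | _, ok => ok
  | _, pvar X => pvar X
  | σ, mu P => mu (vsub σ P)
  | σ, sum n π P => sum n (fun i => (π i).vsub σ) fun i => vsub (σ.liftN (π i).binds) (P i)
  | σ, cnd v P Q => cnd (v.sub σ) (vsub σ P) (vsub σ Q)
  | σ, loc p P => loc p (vsub σ P)
  | σ, par M N => par (vsub σ M) (vsub σ N)

def shiftP : Var → Var
  | .fr X => .fr X
  | .bd k => .bd (k + 1)

def liftP (ρ : Var → Var) : Var → Var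
  | .fr X => shiftP (ρ (.fr X))
  | .bd 0 => .bd 0
  | .bd (k + 1) => shiftP (ρ (.bd k))

/-- Renaming of process variables. -/
def pren : (Var → Var) → Tm → Tm
  | _, nil => nil
  | _, ok => ok
  | ρ, pvar X => pvar (ρ X)
  | ρ, mu P => mu (pren (liftP ρ) P)
  | ρ, sum n π P => sum n π fun i => pren ρ (P i)
  | ρ, cnd v P Q => cnd v (pren ρ P) (pren ρ Q)
  | ρ, loc p P => loc p (pren ρ P)
  | ρ, par M N => par (pren ρ M) (pren ρ N)

def liftT (τ : Var → Tm) : Var → Tm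
  | .fr X => pren shiftP (τ (.fr X))
  | .bd 0 => pvar (.bd 0)
  | .bd (k + 1) => pren shiftP (τ (.bd k))

/-- Capture-avoiding substitution of processes for process variables. -/
def psub : (Var → Tm) → Tm → Tm
  | _, nil => nil
  | _, ok => ok
  | τ, pvar X => τ X
  | τ, mu P => mu (psub (liftT τ) P)
  | τ, sum n π P => sum n π fun i =>
      psub (fun X => vsub (Sub.ofIndices (· + (π i).binds)) (τ X)) (P i)
  | τ, cnd v P Q => cnd v (psub τ P) (psub τ Q)
  | τ, loc p P => loc p (psub τ P)
  | τ, par M N => par (psub τ M) (psub τ N)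

/-- `P{Q/X}` for the outermost bound process variable `X` of `P` -/
def unfold (P Q : Tm) : Tm :=
  psub (fun X => match X with
    | .fr X => pvar (.fr X)
    | .bd 0 => Q
    | .bd (k + 1) => pvar (.bd k)) P

/-- `μX.P` for a named process variable `X` -/
def bindRec (X : ℕ) (P : Tm) : Tm :=
  mu (pren (fun Y => match Y with
    | .fr Y => if Y = X then .bd 0 else .fr Y
    | .bd k => .bd (k + 1)) P)

/-- Renaming of participants. -/
def renRoles (f : ℕ → ℕ) : Tm → Tm
  | nil => nil
  | ok => ok
  | pvar X => pvar X
  | mu P => mu (renRoles f P)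
  | sum n π P => sum n (fun i => (π i).renRoles f) fun i => renRoles f (P i)
  | cnd v P Q => cnd v (renRoles f P) (renRoles f Q)
  | loc p P => loc (f p) (renRoles f P)
  | par M N => par (renRoles f M) (renRoles f N)

/-- All participants that occur in a term. -/
def parts : Tm → Set ℕ
  | nil => ∅
  | ok => ∅
  | pvar _ => ∅
  | mu P => parts P
  | sum _ π P => ⋃ i, insert (π i).peer (parts (P i))
  | cnd _ P Q => parts P ∪ parts Q
  | loc p P => insert p (parts P)
  | par M N => parts M ∪ parts N

/-- The participants that are implemented in a session. -/
def locs : Tm → Set ℕ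
  | loc p _ => {p}
  | par M N => locs M ∪ locs N
  | _ => ∅

/-- The bound process variable `k` does not occur unguarded. -/
def GuardsVar : ℕ → Tm → Prop
  | k, pvar X => X ≠ .bd k
  | k, mu P => GuardsVar (k + 1) P
  | k, cnd _ P Q => GuardsVar k P ∧ GuardsVar k Q
  | _, _ => True

/-- All recursions are guarded. -/
def Guarded : Tm → Prop
  | nil => True
  | ok => True
  | pvar _ => True
  | mu P => GuardsVar 0 P ∧ Guarded P
  | sum _ _ P => ∀ i, Guarded (P i)
  | cnd _ P Q => Guarded P ∧ Guarded Q
  | loc _ P => Guarded P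
  | par M N => Guarded M ∧ Guarded N

/-- There is a top-level occurrence of `✓` that is not under a prefix or conditional. -/
def HasSuccess : Tm → Prop
  | ok => True
  | mu P => HasSuccess P
  | loc _ P => HasSuccess P
  | par M N => HasSuccess M ∨ HasSuccess N
  | _ => False

end Tm

open Tm

/-- Structural congruence; recursion may be unfolded if `u` is true.  Choices are sums over finite index
families, identified up to the order of the summands.  The participants of a session are always pairwise
different, so an inactive participant can be added only under a new name. -/
inductive Cong (u : Bool) : Tm → Tm → Prop where
  | refl (M) : Cong u M M
  | symm {M N} : Cong u M N → Cong u N M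
  | trans {M N K} : Cong u M N → Cong u N K → Cong u M K
  | unfold (P) : u = true → Cong u (mu P) (P.unfold (mu P))
  | perm (n) (π : Fin n → Pre) (P : Fin n → Tm) (e : Equiv.Perm (Fin n)) :
      Cong u (sum n π P) (sum n (π ∘ e) (P ∘ e))
  | inactive (p M) : p ∉ M.locs → Cong u (par (loc p nil) M) M
  | comm (M N) : Cong u (par M N) (par N M)
  | assoc (M N K) : Cong u (par (par M N) K) (par M (par N K))
  | mu {P P'} : Cong u P P' → Cong u (mu P) (mu P')
  | sum {n} (π : Fin n → Pre) {P P' : Fin n → Tm} :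
      (∀ i, Cong u (P i) (P' i)) → Cong u (sum n π P) (sum n π P')
  | cnd (v) {P P' Q Q'} : Cong u P P' → Cong u Q Q' → Cong u (cnd v P Q) (cnd v P' Q')
  | loc (p) {P P'} : Cong u P P' → Cong u (loc p P) (loc p P')
  | par {M M' N N'} : Cong u M M' → Cong u N N' → Cong u (par M N) (par M' N')

/-- Reduction. -/
inductive Step : Tm → Tm → Prop where
  | com (p q ℓ : ℕ) (v : Val) {n m : ℕ} (π : Fin n → Pre) (P : Fin n → Tm) (π' : Fin m → Pre)
      (Q : Fin m → Tm) (i : Fin n) (j : Fin m) (M : Tm) :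
      π i = .inp q ℓ → π' j = .out p ℓ v →
      Step (par (loc p (sum n π P)) (par (loc q (sum m π' Q)) M))
        (par (loc p ((P i).vsub (Sub.inst v))) (par (loc q (Q j)) M))
  | ifT (p P Q M) : Step (par (loc p (cnd .tt P Q)) M) (par (loc p P) M)
  | ifF (p P Q M) : Step (par (loc p (cnd .ff P Q)) M) (par (loc p Q) M)
  | cong {M M₁ M₂ M'} : Cong true M M₁ → Step M₁ M₂ → Cong true M₂ M' → Step M M'

/-! ### The multiparty calculi: types -/

/-- Types of values. -/
inductive Base where
  | nat
  | bool

/-- Actions `p†ℓ(U)` of local types. -/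
structure Act where
  peer : ℕ
  pol : Pol
  lab : ℕ
  base : Base

/-- Local types `end`, `t`, `μt.T` and `Σ_{i<n} p_i†_iℓ_i(U_i).T_i` -/
inductive LTy where
  | fin
  | var (k : ℕ)
  | mu (T : LTy)
  | sum (n : ℕ) (a : Fin n → Act) (T : Fin n → LTy)

namespace LTy

/-- Substitute the closed type `U` for the type variable `k`. -/
def subst (U : LTy) : ℕ → LTy → LTy
  | _, fin => fin
  | k, var j => if j = k then U else var j
  | k, mu T => mu (subst U (k + 1) T)
  | k, sum n a T => sum n a fun i => subst U k (T i)

/-- `T{μt.T/t}` -/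
def unfold (T : LTy) : LTy := subst (mu T) 0 T

/-- All type variables are below `k`. -/
def ClosedBelow : ℕ → LTy → Prop
  | _, fin => True
  | k, var j => j < k
  | k, mu T => ClosedBelow (k + 1) T
  | k, sum _ _ T => ∀ i, ClosedBelow k (T i)

def GuardsVar : ℕ → LTy → Prop
  | _, fin => True
  | k, var j => j ≠ k
  | k, mu T => GuardsVar (k + 1) T
  | _, sum _ _ _ => True

/-- Recursion is guarded, sums are non-empty and their summands differ in participant, polarity or
label. -/
def WellFormed : LTy → Prop
  | fin => True
  | var _ => True
  | mu T => GuardsVar 0 T ∧ WellFormed T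
  | sum n a T => 0 < n ∧ (Function.Injective fun i => ((a i).peer, (a i).pol, (a i).lab)) ∧
      ∀ i, WellFormed (T i)

def WF (T : LTy) : Prop := T.ClosedBelow 0 ∧ T.WellFormed

/-- One unfolding of the coinductive definition of subtyping.  A larger type has more outputs to, and
fewer inputs from, each participant, but neither all outputs to a participant nor all inputs from a
participant may be added or removed. -/
inductive SubF (R : LTy → LTy → Prop) : LTy → LTy → Prop where
  | fin : SubF R fin fin
  | recL {T U} : R T.unfold U → SubF R (mu T) U
  | recR {T U} : R T U.unfold → SubF R T (mu U)
  | sum {n m : ℕ} {a : Fin n → Act} {b : Fin m → Act} {T : Fin n → LTy} {U : Fin m → LTy} :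
      (∀ i, (a i).pol = .snd → ∃ j, b j = a i ∧ R (T i) (U j)) →
      (∀ j, (b j).pol = .rcv → ∃ i, a i = b j ∧ R (T i) (U j)) →
      (∀ j, (b j).pol = .snd → ∃ i, (a i).pol = .snd ∧ (a i).peer = (b j).peer) →
      (∀ i, (a i).pol = .rcv → ∃ j, (b j).pol = .rcv ∧ (b j).peer = (a i).peer) →
      SubF R (sum n a T) (sum m b U)

/-- Subtyping, the greatest relation that is closed backwards under its rules. -/
def Subtype (T U : LTy) : Prop := ∃ R : LTy → LTy → Prop, (∀ T U, R T U → SubF R T U) ∧ R T U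

/-- Transitions of local types. -/
inductive Trans : LTy → Act → LTy → Prop where
  | sum {n} (a : Fin n → Act) (T : Fin n → LTy) (i : Fin n) : Trans (sum n a T) (a i) (T i)
  | mu {T a T'} : Trans T.unfold a T' → Trans (mu T) a T'

end LTy

/-- Local contexts `{p_i:T_i}` -/
abbrev LCtx := ℕ → Option LTy

namespace LCtx

/-- A communication from `p` to `q` with label `ℓ` and payload of type `U` -/
def Com (Δ : LCtx) (p q ℓ : ℕ) (U : Base) (Δ' : LCtx) : Prop :=
  p ≠ q ∧ ∃ T T₁ T' T₁', Δ p = some T ∧ Δ q = some T' ∧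
    T.Trans ⟨q, .snd, ℓ, U⟩ T₁ ∧ T'.Trans ⟨p, .rcv, ℓ, U⟩ T₁' ∧
    Δ' = Function.update (Function.update Δ p (some T₁)) q (some T₁')

def Step (Δ Δ' : LCtx) : Prop := ∃ p q ℓ U, Com Δ p q ℓ U Δ'

/-- Whenever `p` can send to `q` and `q` can receive from `p`, then whatever `p` can send to `q` can be
received; and this remains so. -/
def Safe (Δ : LCtx) : Prop :=
  ∀ Δ', Relation.ReflTransGen Step Δ Δ' →
    ∀ p q ℓ ℓ' U U' T T' T₁ T₁', p ≠ q → Δ' p = some T → Δ' q = some T' →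
      T.Trans ⟨q, .snd, ℓ, U⟩ T₁ → T'.Trans ⟨p, .rcv, ℓ', U'⟩ T₁' →
      ∃ Δ'', Com Δ' p q ℓ U Δ''

/-- Whenever no step is possible, all types are `end` -/
def DeadlockFree (Δ : LCtx) : Prop :=
  ∀ Δ', Relation.ReflTransGen Step Δ Δ' → (¬ ∃ Δ'', Step Δ' Δ'') →
    ∀ p T, Δ' p = some T → T = .fin

end LCtx

/-- Typing of values. -/
inductive ValTy (Γ : Ctxt Base) : Val → Base → Prop where
  | var {x U} : Γ x = some U → ValTy Γ (.var x) U
  | num (n) : ValTy Γ (.num n) .nat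
  | tt : ValTy Γ .tt .bool
  | ff : ValTy Γ .ff .bool

/-- `PreTy Γ π a Γ'`: the prefix `π` has the action `a` under `Γ`, and its continuation is to be typed
under `Γ'`. -/
inductive PreTy (Γ : Ctxt Base) : Pre → Act → Ctxt Base → Prop where
  | out {p ℓ v U} : ValTy Γ v U → PreTy Γ (.out p ℓ v) ⟨p, .snd, ℓ, U⟩ Γ
  | inp (p ℓ U) : PreTy Γ (.inp p ℓ) ⟨p, .rcv, ℓ, U⟩ (Γ.ext U)

/-- Typing of processes; `Θ` contains the types of the process variables.  In the rule for choices, the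
branches are grouped: `f` assigns to each branch the summand of the type to which it belongs, and the
branches that belong to the same summand have the same prefix. -/
inductive ProcTy : Ctxt Base → Ctxt LTy → Tm → LTy → Prop where
  | nil (Γ Θ) : ProcTy Γ Θ nil .fin
  | ok (Γ Θ) : ProcTy Γ Θ ok .fin
  | pvar {Γ Θ X T} : Θ X = some T → ProcTy Γ Θ (pvar X) T
  | cnd {Γ Θ v P Q T} : ValTy Γ v .bool → ProcTy Γ Θ P T → ProcTy Γ Θ Q T →
      ProcTy Γ Θ (cnd v P Q) T
  | sum {Γ Θ} {n m : ℕ} {π : Fin n → Pre} {P : Fin n → Tm} {a : Fin m → Act} {T : Fin m → LTy}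
      (f : Fin n → Fin m) (Γ' : Fin n → Ctxt Base) :
      (LTy.sum m a T).WF → Function.Surjective f → (∀ i j, f i = f j → π i = π j) →
      (∀ i, PreTy Γ (π i) (a (f i)) (Γ' i)) → (∀ i, ProcTy (Γ' i) Θ (P i) (T (f i))) →
      ProcTy Γ Θ (sum n π P) (.sum m a T)
  | mu {Γ Θ P T} : T.WF → ProcTy Γ (Θ.ext T) P T → ProcTy Γ Θ (mu P) T
  | sub {Γ Θ P T T'} : ProcTy Γ Θ P T → T.Subtype T' → T'.WF → ProcTy Γ Θ P T'

/-- Typing of the located processes of a session, whose participants are pairwise different. -/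
inductive LocTy : Tm → LCtx → Prop where
  | loc {p P T} : ProcTy (fun _ => none) (fun _ => none) P T →
      LocTy (loc p P) (fun q => if q = p then some T else none)
  | par {M N Δ₁ Δ₂} : LocTy M Δ₁ → LocTy N Δ₂ → (∀ p, Δ₁ p = none ∨ Δ₂ p = none) →
      LocTy (par M N) (fun p => (Δ₁ p).or (Δ₂ p))

/-- Typing of sessions: `⊢ M ▷ Δ` -/
def SessTy (M : Tm) (Δ : LCtx) : Prop := LocTy M Δ ∧ Δ.Safe

/-! ### The multiparty calculi: subcalculi -/

/-- A condition on all choices of a term. -/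
def Tm.AllSums (s : (n : ℕ) → (Fin n → Pre) → Prop) : Tm → Prop
  | nil => True
  | ok => True
  | pvar _ => True
  | mu P => AllSums s P
  | sum n π P => s n π ∧ ∀ i, AllSums s (P i)
  | cnd _ P Q => AllSums s P ∧ AllSums s Q
  | loc _ P => AllSums s P
  | par M N => AllSums s M ∧ AllSums s N

/-- only outputs or only inputs -/
def Separate (n : ℕ) (π : Fin n → Pre) : Prop := (∀ i, (π i).IsOut) ∨ (∀ i, ¬ (π i).IsOut)

/-- all prefixes address the same participant -/
def Directed (n : ℕ) (π : Fin n → Pre) : Prop := ∀ i j, (π i).peer = (π j).peer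

/-- inputs from one participant, or a single output -/
def Classic (n : ℕ) (π : Fin n → Pre) : Prop :=
  (Directed n π ∧ ∀ i, ¬ (π i).IsOut) ∨ (n = 1 ∧ ∀ i, (π i).IsOut)

/-- The located processes are those of the two parties `p` and `q`, which address only each other. -/
def Tm.TwoParty (p q : ℕ) : Tm → Prop
  | loc r P => (r = p ∧ P.AllSums fun _ π => ∀ i, (π i).peer = q) ∨
      (r = q ∧ P.AllSums fun _ π => ∀ i, (π i).peer = p)
  | par M N => TwoParty p q M ∧ TwoParty p q N
  | _ => True

def Tm.Binary (M : Tm) : Prop := ∃ p q, p ≠ q ∧ M.TwoParty p q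

/-- Operators. -/
inductive NPre where
  | out (p ℓ : ℕ) (v : Val)
  | inp (p ℓ x : ℕ)

def NPre.pre : NPre → Pre
  | .out p ℓ v => .out p ℓ v
  | .inp p ℓ _ => .inp p ℓ

def NPre.close : NPre → Tm → Tm
  | .out _ _ _, P => P
  | .inp _ _ x, P => P.vsub (Sub.bind x)

inductive Op where
  | nil
  | ok
  | pvar (X : ℕ)
  | mu (X : ℕ)
  | sum (n : ℕ) (π : Fin n → NPre)
  | cnd (v : Val)
  | loc (p : ℕ)
  | par

def Op.arity : Op → ℕ
  | nil => 0
  | ok => 0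
  | pvar _ => 0
  | mu _ => 1
  | sum n _ => n
  | cnd _ => 2
  | loc _ => 1
  | par => 2

def Op.build : (o : Op) → (Fin o.arity → Tm) → Tm
  | nil, _ => .nil
  | ok, _ => .ok
  | pvar X, _ => .pvar (.fr X)
  | mu X, P => .bindRec X (P (0 : Fin 1))
  | sum n π, P => .sum n (fun i => (π i).pre) fun i => (π i).close (P i)
  | cnd v, P => .cnd v (P (0 : Fin 2)) (P (1 : Fin 2))
  | loc p, P => .loc p (P (0 : Fin 1))
  | par, P => .par (P (0 : Fin 2)) (P (1 : Fin 2))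

/-- The calculus of typed and deadlock-free sessions that satisfy `frag`.  Names are participants
(`inl`) and variables (`inr`). -/
def calculus (frag : Tm → Prop) : Calculus where
  Term := Tm
  IsTerm M := frag M ∧ M.Guarded ∧ ∃ Δ, SessTy M Δ ∧ Δ.DeadlockFree
  IsPhrase M := frag M ∧ M.Guarded ∧ ((∃ Δ, SessTy M Δ) ∨
    ∃ (Γ : Ctxt Base) (Θ : Ctxt LTy) (T : LTy), Γ.Named ∧ Θ.Named ∧
      (∀ X T, Θ X = some T → T.WF) ∧ ProcTy Γ Θ M T)
  Cong := Cong true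
  Cong₀ := Cong false
  Step := Step
  par := par
  HasSuccess := HasSuccess
  Op := Op
  arity := Op.arity
  build := Op.build
  Name := ℕ ⊕ ℕ
  names M := Sum.inl '' M.parts
  Ren := (ℕ → ℕ) × (ℕ → ℕ)
  app σ := Sum.map σ.1 σ.2
  ren σ M := (M.renRoles σ.1).vsub (Sub.ofNames σ.2)

end MC

/-- separate choice multiparty sessions -/
def SCMP : Calculus := MC.calculus fun M => M.AllSums MC.Separate

/-- directed mixed choice multiparty sessions -/
def DMP : Calculus := MC.calculus fun M => M.AllSums MC.Directed

/-- separate and directed choice multiparty sessions -/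
def SMP : Calculus := MC.calculus fun M =>
  M.AllSums fun n π => MC.Separate n π ∧ MC.Directed n π

/-- multiparty sessions -/
def MP : Calculus := MC.calculus fun M => M.AllSums MC.Classic

/-- mixed choice binary sessions -/
def MCBS : Calculus := MC.calculus fun M => M.Binary

/-- separate choice binary sessions -/
def SCBS : Calculus := MC.calculus fun M => M.Binary ∧ M.AllSums MC.Separate

/-- binary sessions -/
def BS : Calculus := MC.calculus fun M => M.Binary ∧ M.AllSums MC.Classic

/-! ### Mixed sessions: syntax and reduction

The calculi with and without mixed choice share all constructs but those for communication.  Both are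
obtained as fragments of one syntax that has the communication constructs of both. -/

namespace MS

/-- Qualifiers. -/
inductive Qual where
  | lin
  | un

/-- Heads `ℓ!v` and `ℓ?(·)` of the branches of a mixed choice.  The variable of an input is bound in the
continuation. -/
inductive Br where
  | out (ℓ : ℕ) (v : Val)
  | inp (ℓ : ℕ)

def Br.key : Br → ℕ × Pol
  | .out ℓ _ => (ℓ, .snd)
  | .inp ℓ => (ℓ, .rcv)

def Br.binds : Br → ℕ
  | .out _ _ => 0
  | .inp _ => 1

def Br.vsub (σ : Sub) : Br → Br
  | .out ℓ v => .out ℓ (v.sub σ)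
  | .inp ℓ => .inp ℓ

def Br.names : Br → Set ℕ
  | .out _ v => v.names
  | .inp _ => ∅

/-- Processes.  `res` binds two channel endpoints, the indices `0` and `1`; the subjects of
communications are values because substitutions apply to them. -/
inductive Tm where
  | nil
  | ok
  | par (P Q : Tm)
  | res (P : Tm)
  | cnd (v : Val) (P Q : Tm)
  /-- the mixed choice `q y Σ_{i<n} ℓ_i*_iv_i.P_i` -/
  | choice (q : Qual) (y : Val) (n : ℕ) (B : Fin n → Br) (P : Fin n → Tm)
  /-- the output `y!v.P` -/
  | out (y v : Val) (P : Tm)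
  /-- the input `q y?x.P` -/
  | inp (q : Qual) (y : Val) (P : Tm)
  /-- the selection `y ◁ ℓ.P` -/
  | sel (y : Val) (ℓ : ℕ) (P : Tm)
  /-- the branching `y ▷ {ℓ_i:P_i}_{i<n}` -/
  | branch (y : Val) (n : ℕ) (ℓ : Fin n → ℕ) (P : Fin n → Tm)

namespace Tm

/-- Substitution of values for variables. -/
def vsub : Sub → Tm → Tm
  | _, nil => nil
  | _, ok => ok
  | σ, par P Q => par (vsub σ P) (vsub σ Q)
  | σ, res P => res (vsub (σ.liftN 2) P)
  | σ, cnd v P Q => cnd (v.sub σ) (vsub σ P) (vsub σ Q)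
  | σ, choice q y n B P => choice q (y.sub σ) n (fun i => (B i).vsub σ) fun i =>
      vsub (σ.liftN (B i).binds) (P i)
  | σ, out y v P => out (y.sub σ) (v.sub σ) (vsub σ P)
  | σ, inp q y P => inp q (y.sub σ) (vsub (σ.liftN 1) P)
  | σ, sel y ℓ P => sel (y.sub σ) ℓ (vsub σ P)
  | σ, branch y n ℓ P => branch (y.sub σ) n ℓ fun i => vsub σ (P i)

/-- The names of the free variables and channel endpoints. -/
def fv : Tm → Set ℕ
  | nil => ∅
  | ok => ∅
  | par P Q => fv P ∪ fv Q
  | res P => fv P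
  | cnd v P Q => v.names ∪ fv P ∪ fv Q
  | choice _ y _ B P => y.names ∪ ⋃ i, (B i).names ∪ fv (P i)
  | out y v P => y.names ∪ v.names ∪ fv P
  | inp _ y P => y.names ∪ fv P
  | sel y _ P => y.names ∪ fv P
  | branch y _ _ P => y.names ∪ ⋃ i, fv (P i)

/-- There is an occurrence of `✓` that is not under a communication or conditional. -/
def HasSuccess : Tm → Prop
  | ok => True
  | par P Q => HasSuccess P ∨ HasSuccess Q
  | res P => HasSuccess P
  | _ => False

/-- The number of restrictions. -/
def resCount : Tm → ℕ
  | nil => 0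
  | ok => 0
  | par P Q => resCount P + resCount Q
  | res P => resCount P + 1
  | cnd _ P Q => resCount P + resCount Q
  | choice _ _ _ _ P => ∑ i, resCount (P i)
  | out _ _ P => resCount P
  | inp _ _ P => resCount P
  | sel _ _ P => resCount P
  | branch _ _ _ P => ∑ i, resCount (P i)

/-- Communication is by mixed choices only. -/
def OnlyMixed : Tm → Prop
  | nil => True
  | ok => True
  | par P Q => OnlyMixed P ∧ OnlyMixed Q
  | res P => OnlyMixed P
  | cnd _ P Q => OnlyMixed P ∧ OnlyMixed Q
  | choice _ _ _ _ P => ∀ i, OnlyMixed (P i)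
  | _ => False

/-- There are no mixed choices. -/
def NoMixed : Tm → Prop
  | nil => True
  | ok => True
  | par P Q => NoMixed P ∧ NoMixed Q
  | res P => NoMixed P
  | cnd _ P Q => NoMixed P ∧ NoMixed Q
  | choice _ _ _ _ _ => False
  | out _ _ P => NoMixed P
  | inp _ _ P => NoMixed P
  | sel _ _ P => NoMixed P
  | branch _ _ _ P => ∀ i, NoMixed (P i)

end Tm

open Tm

/-- Exchange the endpoints of the innermost restriction. -/
def swapEnds : ℕ → ℕ
  | 0 => 1
  | 1 => 0
  | k + 2 => k + 2

/-- Exchange the endpoints of the two innermost restrictions. -/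
def swapRes : ℕ → ℕ
  | 0 => 2
  | 1 => 3
  | 2 => 0
  | 3 => 1
  | k + 4 => k + 4

/-- Structural congruence.  Summands and branches are not ordered. -/
inductive Cong : Tm → Tm → Prop where
  | refl (P) : Cong P P
  | symm {P Q} : Cong P Q → Cong Q P
  | trans {P Q R} : Cong P Q → Cong Q R → Cong P R
  | comm (P Q) : Cong (par P Q) (par Q P)
  | assoc (P Q R) : Cong (par (par P Q) R) (par P (par Q R))
  | parNil (P) : Cong (par P nil) P
  | resNil : Cong (res nil) nil
  | resEnds (P) : Cong (res P) (res (P.vsub (Sub.ofIndices swapEnds)))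
  | extrude (P Q) : Cong (par P (res Q)) (res (par (P.vsub (Sub.ofIndices (· + 2))) Q))
  | resRes (P) : Cong (res (res P)) (res (res (P.vsub (Sub.ofIndices swapRes))))
  | permChoice (q y n) (B : Fin n → Br) (P : Fin n → Tm) (e : Equiv.Perm (Fin n)) :
      Cong (choice q y n B P) (choice q y n (B ∘ e) (P ∘ e))
  | permBranch (y n) (ℓ : Fin n → ℕ) (P : Fin n → Tm) (e : Equiv.Perm (Fin n)) :
      Cong (branch y n ℓ P) (branch y n (ℓ ∘ e) (P ∘ e))
  | par {P P' Q Q'} : Cong P P' → Cong Q Q' → Cong (par P Q) (par P' Q')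
  | res {P P'} : Cong P P' → Cong (res P) (res P')
  | cnd (v) {P P' Q Q'} : Cong P P' → Cong Q Q' → Cong (cnd v P Q) (cnd v P' Q')
  | choice (q y) {n} (B : Fin n → Br) {P P' : Fin n → Tm} :
      (∀ i, Cong (P i) (P' i)) → Cong (choice q y n B P) (choice q y n B P')
  | out (y v) {P P'} : Cong P P' → Cong (out y v P) (out y v P')
  | inp (q y) {P P'} : Cong P P' → Cong (inp q y P) (inp q y P')
  | sel (y ℓ) {P P'} : Cong P P' → Cong (sel y ℓ P) (sel y ℓ P')
  | branch (y) {n} (ℓ : Fin n → ℕ) {P P' : Fin n → Tm} :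
      (∀ i, Cong (P i) (P' i)) → Cong (branch y n ℓ P) (branch y n ℓ P')

/-- the first endpoint of the innermost restriction -/
def end₀ : Val := .var (.bd 0)

/-- the second endpoint of the innermost restriction -/
def end₁ : Val := .var (.bd 1)

/-- Reduction. -/
inductive Step : Tm → Tm → Prop where
  | ifT (P Q) : Step (cnd .tt P Q) P
  | ifF (P Q) : Step (cnd .ff P Q) Q
  | linLin {n m : ℕ} (B : Fin n → Br) (P : Fin n → Tm) (C : Fin m → Br) (Q : Fin m → Tm)
      (i : Fin n) (j : Fin m) (ℓ : ℕ) (v : Val) (R : Tm) : B i = .out ℓ v → C j = .inp ℓ →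
      Step (res (par (choice .lin end₀ n B P) (par (choice .lin end₁ m C Q) R)))
        (res (par (P i) (par ((Q j).vsub (Sub.inst v)) R)))
  | linUn {n m : ℕ} (B : Fin n → Br) (P : Fin n → Tm) (C : Fin m → Br) (Q : Fin m → Tm)
      (i : Fin n) (j : Fin m) (ℓ : ℕ) (v : Val) (R : Tm) : B i = .out ℓ v → C j = .inp ℓ →
      Step (res (par (choice .lin end₀ n B P) (par (choice .un end₁ m C Q) R)))
        (res (par (P i) (par ((Q j).vsub (Sub.inst v)) (par (choice .un end₁ m C Q) R))))
  | unLin {n m : ℕ} (B : Fin n → Br) (P : Fin n → Tm) (C : Fin m → Br) (Q : Fin m → Tm)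
      (i : Fin n) (j : Fin m) (ℓ : ℕ) (v : Val) (R : Tm) : B i = .out ℓ v → C j = .inp ℓ →
      Step (res (par (choice .un end₀ n B P) (par (choice .lin end₁ m C Q) R)))
        (res (par (P i) (par ((Q j).vsub (Sub.inst v)) (par (choice .un end₀ n B P) R))))
  | unUn {n m : ℕ} (B : Fin n → Br) (P : Fin n → Tm) (C : Fin m → Br) (Q : Fin m → Tm)
      (i : Fin n) (j : Fin m) (ℓ : ℕ) (v : Val) (R : Tm) : B i = .out ℓ v → C j = .inp ℓ →
      Step (res (par (choice .un end₀ n B P) (par (choice .un end₁ m C Q) R)))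
        (res (par (P i) (par ((Q j).vsub (Sub.inst v))
          (par (choice .un end₀ n B P) (par (choice .un end₁ m C Q) R)))))
  | linCom (v : Val) (P Q R : Tm) :
      Step (res (par (out end₀ v P) (par (inp .lin end₁ Q) R)))
        (res (par P (par (Q.vsub (Sub.inst v)) R)))
  | unCom (v : Val) (P Q R : Tm) :
      Step (res (par (out end₀ v P) (par (inp .un end₁ Q) R)))
        (res (par P (par (Q.vsub (Sub.inst v)) (par (inp .un end₁ Q) R))))
  | case {n : ℕ} (ℓ : Fin n → ℕ) (j : Fin n) (P : Tm) (Q : Fin n → Tm) (R : Tm) :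
      Step (res (par (sel end₀ (ℓ j) P) (par (branch end₁ n ℓ Q) R)))
        (res (par P (par (Q j) R)))
  | par {P P'} (Q) : Step P P' → Step (par P Q) (par P' Q)
  | res {P P'} : Step P P' → Step (res P) (res P')
  | struct {P Q Q' P'} : Cong P Q → Step Q Q' → Cong Q' P' → Step P P'

/-! ### Mixed sessions: types -/

/-- Views: internal and external choice. -/
inductive View where
  | int
  | ext

def View.dual : View → View
  | .int => .ext
  | .ext => .int

def dualPol : Pol → Pol
  | .snd => .rcv
  | .rcv => .snd

inductive Ty where
  | fin
  | nat
  | bool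
  | var (k : ℕ)
  | mu (T : Ty)
  /-- `q # {ℓ_i*_iT_i.U_i}_{i<n}`, with the labels and polarities given by `b` -/
  | choice (q : Qual) (w : View) (n : ℕ) (b : Fin n → ℕ × Pol) (T U : Fin n → Ty)
  /-- `q * T.U` -/
  | com (q : Qual) (pol : Pol) (T U : Ty)
  /-- `q # {ℓ_i:T_i}_{i<n}` -/
  | sel (q : Qual) (w : View) (n : ℕ) (ℓ : Fin n → ℕ) (T : Fin n → Ty)

namespace Ty

/-- Substitute the closed type `V` for the type variable `k`. -/
def subst (V : Ty) : ℕ → Ty → Ty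
  | _, fin => fin
  | _, nat => nat
  | _, bool => bool
  | k, var j => if j = k then V else var j
  | k, mu T => mu (subst V (k + 1) T)
  | k, choice q w n b T U => choice q w n b (fun i => subst V k (T i)) fun i => subst V k (U i)
  | k, com q p T U => com q p (subst V k T) (subst V k U)
  | k, sel q w n ℓ T => sel q w n ℓ fun i => subst V k (T i)

/-- `T{μt.T/t}` -/
def unfold (T : Ty) : Ty := subst (mu T) 0 T

/-- All type variables are below `k`. -/
def ClosedBelow : ℕ → Ty → Prop
  | k, var j => j < k
  | k, mu T => ClosedBelow (k + 1) T
  | k, choice _ _ _ _ T U => (∀ i, ClosedBelow k (T i)) ∧ ∀ i, ClosedBelow k (U i)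
  | k, com _ _ T U => ClosedBelow k T ∧ ClosedBelow k U
  | k, sel _ _ _ _ T => ∀ i, ClosedBelow k (T i)
  | _, _ => True

def GuardsVar : ℕ → Ty → Prop
  | k, var j => j ≠ k
  | k, mu T => GuardsVar (k + 1) T
  | _, _ => True

/-- Recursion is contractive, index sets are non-empty and labels (with polarities) are distinct. -/
def WellFormed : Ty → Prop
  | mu T => GuardsVar 0 T ∧ WellFormed T
  | choice _ _ n b T U => 0 < n ∧ Function.Injective b ∧
      (∀ i, WellFormed (T i)) ∧ ∀ i, WellFormed (U i)
  | com _ _ T U => WellFormed T ∧ WellFormed U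
  | sel _ _ n ℓ T => 0 < n ∧ Function.Injective ℓ ∧ ∀ i, WellFormed (T i)
  | _ => True

def WF (T : Ty) : Prop := T.ClosedBelow 0 ∧ T.WellFormed

/-- types of mixed choices do not occur -/
def NoMixed : Ty → Prop
  | mu T => NoMixed T
  | choice _ _ _ _ _ _ => False
  | com _ _ T U => NoMixed T ∧ NoMixed U
  | sel _ _ _ _ T => ∀ i, NoMixed (T i)
  | _ => True

/-- all channel types are types of mixed choices -/
def OnlyMixed : Ty → Prop
  | mu T => OnlyMixed T
  | choice _ _ _ _ T U => (∀ i, OnlyMixed (T i)) ∧ ∀ i, OnlyMixed (U i)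
  | com _ _ _ _ => False
  | sel _ _ _ _ _ => False
  | _ => True

/-- `un` does not occur, and only numbers and booleans are transmitted -/
def Linear : Ty → Prop
  | mu T => Linear T
  | choice q _ _ _ T U => q = .lin ∧ (∀ i, T i = nat ∨ T i = bool) ∧ ∀ i, Linear (U i)
  | com q _ T U => q = .lin ∧ (T = nat ∨ T = bool) ∧ Linear U
  | sel q _ _ _ T => q = .lin ∧ ∀ i, Linear (T i)
  | _ => True

/-- One unfolding of the coinductive definition of type equivalence. -/
inductive EqvF (R : Ty → Ty → Prop) : Ty → Ty → Prop where
  | fin : EqvF R fin fin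
  | nat : EqvF R nat nat
  | bool : EqvF R bool bool
  | recL {T U} : R T.unfold U → EqvF R (mu T) U
  | recR {T U} : R T U.unfold → EqvF R T (mu U)
  | choice (q w) {n} {b b' : Fin n → ℕ × Pol} {T U T' U' : Fin n → Ty} (e : Equiv.Perm (Fin n)) :
      (∀ i, b' (e i) = b i ∧ R (T i) (T' (e i)) ∧ R (U i) (U' (e i))) →
      EqvF R (choice q w n b T U) (choice q w n b' T' U')
  | com (q p) {T U T' U'} : R T T' → R U U' → EqvF R (com q p T U) (com q p T' U')
  | sel (q w) {n} {ℓ ℓ' : Fin n → ℕ} {T T' : Fin n → Ty} (e : Equiv.Perm (Fin n)) :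
      (∀ i, ℓ' (e i) = ℓ i ∧ R (T i) (T' (e i))) →
      EqvF R (sel q w n ℓ T) (sel q w n ℓ' T')

/-- Type equivalence. -/
def Eqv (T U : Ty) : Prop := ∃ R : Ty → Ty → Prop, (∀ T U, R T U → EqvF R T U) ∧ R T U

/-- One unfolding of the coinductive definition of duality. -/
inductive DualF (R : Ty → Ty → Prop) : Ty → Ty → Prop where
  | fin : DualF R fin fin
  | recL {T U} : R T.unfold U → DualF R (mu T) U
  | recR {T U} : R T U.unfold → DualF R T (mu U)
  | choice (q w) {n} {b b' : Fin n → ℕ × Pol} {T U T' U' : Fin n → Ty} (e : Equiv.Perm (Fin n)) :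
      (∀ i, b' (e i) = ((b i).1, dualPol (b i).2) ∧ Eqv (T i) (T' (e i)) ∧ R (U i) (U' (e i))) →
      DualF R (choice q w n b T U) (choice q w.dual n b' T' U')
  | com (q p) {T U T' U'} : Eqv T T' → R U U' → DualF R (com q p T U) (com q (dualPol p) T' U')
  | sel (q w) {n} {ℓ ℓ' : Fin n → ℕ} {T T' : Fin n → Ty} (e : Equiv.Perm (Fin n)) :
      (∀ i, ℓ' (e i) = ℓ i ∧ R (T i) (T' (e i))) →
      DualF R (sel q w n ℓ T) (sel q w.dual n ℓ' T')

/-- Duality of the types of the two endpoints of a channel. -/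
def Dual (T U : Ty) : Prop := ∃ R : Ty → Ty → Prop, (∀ T U, R T U → DualF R T U) ∧ R T U

/-- Payloads are contravariant in outputs and covariant in inputs. -/
def payload (R : Ty → Ty → Prop) : Pol → Ty → Ty → Prop
  | .snd, T, T' => R T' T
  | .rcv, T, T' => R T T'

/-- One unfolding of the coinductive definition of subtyping. -/
inductive SubF (R : Ty → Ty → Prop) : Ty → Ty → Prop where
  | fin : SubF R fin fin
  | nat : SubF R nat nat
  | bool : SubF R bool bool
  | recL {T U} : R T.unfold U → SubF R (mu T) U
  | recR {T U} : R T U.unfold → SubF R T (mu U)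
  | choiceInt (q) {n m} {b : Fin n → ℕ × Pol} {b' : Fin m → ℕ × Pol} {T U : Fin n → Ty}
      {T' U' : Fin m → Ty} :
      (∀ j, ∃ i, b i = b' j ∧ payload R (b i).2 (T i) (T' j) ∧ R (U i) (U' j)) →
      SubF R (choice q .int n b T U) (choice q .int m b' T' U')
  | choiceExt (q) {n m} {b : Fin n → ℕ × Pol} {b' : Fin m → ℕ × Pol} {T U : Fin n → Ty}
      {T' U' : Fin m → Ty} :
      (∀ i, ∃ j, b i = b' j ∧ payload R (b i).2 (T i) (T' j) ∧ R (U i) (U' j)) →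
      SubF R (choice q .ext n b T U) (choice q .ext m b' T' U')
  | com (q p) {T U T' U'} : payload R p T T' → R U U' → SubF R (com q p T U) (com q p T' U')
  | selInt (q) {n m} {ℓ : Fin n → ℕ} {ℓ' : Fin m → ℕ} {T : Fin n → Ty} {T' : Fin m → Ty} :
      (∀ j, ∃ i, ℓ i = ℓ' j ∧ R (T i) (T' j)) →
      SubF R (sel q .int n ℓ T) (sel q .int m ℓ' T')
  | selExt (q) {n m} {ℓ : Fin n → ℕ} {ℓ' : Fin m → ℕ} {T : Fin n → Ty} {T' : Fin m → Ty} :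
      (∀ i, ∃ j, ℓ i = ℓ' j ∧ R (T i) (T' j)) →
      SubF R (sel q .ext n ℓ T) (sel q .ext m ℓ' T')

/-- Subtyping. -/
def Subtype (T U : Ty) : Prop := ∃ R : Ty → Ty → Prop, (∀ T U, R T U → SubF R T U) ∧ R T U

/-- Unrestricted types. -/
def Un : Ty → Prop
  | fin => True
  | nat => True
  | bool => True
  | var _ => False
  | mu T => Un T
  | choice q _ _ _ _ _ => q = .un
  | com q _ _ _ => q = .un
  | sel q _ _ _ _ => q = .un

end Ty

abbrev TCtx := Ctxt Ty

namespace TCtx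

/-- all types in the context are unrestricted -/
def Un (Γ : TCtx) : Prop := ∀ x T, Γ x = some T → T.Un

/-- `Γ = Γ₁ ∘ Γ₂`: unrestricted assignments are shared, each linear one goes to one of the parts -/
def Split (Γ Γ₁ Γ₂ : TCtx) : Prop := ∀ x,
  (Γ x = none ∧ Γ₁ x = none ∧ Γ₂ x = none) ∨
  ∃ T, Γ x = some T ∧
    ((T.Un ∧ Γ₁ x = some T ∧ Γ₂ x = some T) ∨
     (¬ T.Un ∧ ((Γ₁ x = some T ∧ Γ₂ x = none) ∨ (Γ₁ x = none ∧ Γ₂ x = some T))))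

/-- `Γ + x:T = Γ'` -/
def Add (Γ : TCtx) (x : Var) (T : Ty) (Γ' : TCtx) : Prop :=
  (Γ x = none ∧ Γ' = Function.update Γ x (some T)) ∨ (Γ x = some T ∧ T.Un ∧ Γ' = Γ)

end TCtx

/-- Typing of values; only types that satisfy `A` may be used. -/
inductive ValTy (A : Ty → Prop) : TCtx → Val → Ty → Prop where
  | num {Γ} (n) : Γ.Un → ValTy A Γ (.num n) .nat
  | tt {Γ} : Γ.Un → ValTy A Γ .tt .bool
  | ff {Γ} : Γ.Un → ValTy A Γ .ff .bool
  | var {Γ x T} : Γ x = some T → (∀ y U, y ≠ x → Γ y = some U → U.Un) → ValTy A Γ (.var x) T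
  | sub {Γ v T U} : ValTy A Γ v T → T.Subtype U → A U → ValTy A Γ v U

/-- `BrTy A Γ B T Γ'`: under `Γ`, the head `B` of a branch communicates a value of type `T`, and the
continuation is to be typed under `Γ'` -/
inductive BrTy (A : Ty → Prop) (Γ : TCtx) : Br → Ty → TCtx → Prop where
  | out {ℓ v T Γ₁ Γ₂} : Γ.Split Γ₁ Γ₂ → ValTy A Γ₁ v T → BrTy A Γ (.out ℓ v) T Γ₂
  | inp (ℓ T) : BrTy A Γ (.inp ℓ) T (Γ.ext T)

/-- Typing of processes; only types that satisfy `A` may be used. -/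
inductive ProcTy (A : Ty → Prop) : TCtx → Tm → Prop where
  | nil {Γ} : Γ.Un → ProcTy A Γ nil
  | ok {Γ} : Γ.Un → ProcTy A Γ ok
  | par {Γ Γ₁ Γ₂ P Q} : Γ.Split Γ₁ Γ₂ → ProcTy A Γ₁ P → ProcTy A Γ₂ Q → ProcTy A Γ (par P Q)
  | cnd {Γ Γ₁ Γ₂ v P Q} : Γ.Split Γ₁ Γ₂ → ValTy A Γ₁ v .bool → ProcTy A Γ₂ P → ProcTy A Γ₂ Q →
      ProcTy A Γ (cnd v P Q)
  | res {Γ P T U} : A T → A U → T.Dual U → ProcTy A ((Γ.ext U).ext T) P → ProcTy A Γ (res P)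
  | choice {Γ Γ₁ Γ₂} {q₁ q₂ w x} {m n : ℕ} {b : Fin n → ℕ × Pol} {T U : Fin n → Ty}
      {B : Fin m → Br} {P : Fin m → Tm} (f : Fin m → Fin n) (Γ' Γ'' : Fin m → TCtx) :
      Γ.Split Γ₁ Γ₂ → (q₁ = .un → Γ.Un) → ValTy A Γ₁ (.var x) (.choice q₂ w n b T U) →
      Function.Surjective f → (∀ j, (B j).key = b (f j)) →
      (∀ j, Γ₂.Add x (U (f j)) (Γ' j)) → (∀ j, BrTy A (Γ' j) (B j) (T (f j)) (Γ'' j)) →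
      (∀ j, ProcTy A (Γ'' j) (P j)) →
      ProcTy A Γ (choice q₁ (.var x) m B P)
  | out {Γ Γ₁ Γ₂ Γ' Γ₃ Γ₄ q x v P T U} : Γ.Split Γ₁ Γ₂ → ValTy A Γ₁ (.var x) (.com q .snd T U) →
      Γ₂.Add x U Γ' → Γ'.Split Γ₃ Γ₄ → ValTy A Γ₃ v T → ProcTy A Γ₄ P →
      ProcTy A Γ (out (.var x) v P)
  | inp {Γ Γ₁ Γ₂ Γ' q₁ q₂ x P T U} : Γ.Split Γ₁ Γ₂ → (q₁ = .un → Γ.Un) →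
      ValTy A Γ₁ (.var x) (.com q₂ .rcv T U) → Γ₂.Add x U Γ' → ProcTy A (Γ'.ext T) P →
      ProcTy A Γ (inp q₁ (.var x) P)
  | sel {Γ Γ₁ Γ₂ Γ' q x ℓ P T} : Γ.Split Γ₁ Γ₂ →
      ValTy A Γ₁ (.var x) (.sel q .int 1 (fun _ => ℓ) (fun _ => T)) → Γ₂.Add x T Γ' →
      ProcTy A Γ' P → ProcTy A Γ (sel (.var x) ℓ P)
  | branch {Γ Γ₁ Γ₂ q x} {n : ℕ} {ℓ : Fin n → ℕ} {T : Fin n → Ty} {P : Fin n → Tm}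
      (Γ' : Fin n → TCtx) : Γ.Split Γ₁ Γ₂ → ValTy A Γ₁ (.var x) (.sel q .ext n ℓ T) →
      (∀ i, Γ₂.Add x (T i) (Γ' i)) → (∀ i, ProcTy A (Γ' i) (P i)) →
      ProcTy A Γ (branch (.var x) n ℓ P)

/-- `P` is typed. -/
def Typed (A : Ty → Prop) (P : Tm) : Prop :=
  ∃ Γ : TCtx, Γ.Named ∧ (∀ x T, Γ x = some T → A T) ∧ ProcTy A Γ P

/-! ### Mixed sessions: subcalculi -/

/-- Heads of branches with a named variable for inputs. -/
inductive NBr where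
  | out (ℓ : ℕ) (v : Val)
  | inp (ℓ x : ℕ)

def NBr.br : NBr → Br
  | .out ℓ v => .out ℓ v
  | .inp ℓ _ => .inp ℓ

def NBr.close : NBr → Tm → Tm
  | .out _ _, P => P
  | .inp _ x, P => P.vsub (Sub.bind x)

/-- Operators. -/
inductive Op where
  | nil
  | ok
  | par
  | res (y z : ℕ)
  | cnd (v : Val)
  | choice (q : Qual) (y : Val) (n : ℕ) (B : Fin n → NBr)
  | out (y v : Val)
  | inp (q : Qual) (y : Val) (x : ℕ)
  | sel (y : Val) (ℓ : ℕ)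
  | branch (y : Val) (n : ℕ) (ℓ : Fin n → ℕ)

def Op.arity : Op → ℕ
  | nil => 0
  | ok => 0
  | par => 2
  | res _ _ => 1
  | cnd _ => 2
  | choice _ _ n _ => n
  | out _ _ => 1
  | inp _ _ _ => 1
  | sel _ _ => 1
  | branch _ n _ => n

def Op.build : (o : Op) → (Fin o.arity → Tm) → Tm
  | nil, _ => .nil
  | ok, _ => .ok
  | par, P => .par (P (0 : Fin 2)) (P (1 : Fin 2))
  | res y z, P => .res ((P (0 : Fin 1)).vsub (Sub.bind₂ y z))
  | cnd v, P => .cnd v (P (0 : Fin 2)) (P (1 : Fin 2))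
  | choice q y n B, P => .choice q y n (fun i => (B i).br) fun i => (B i).close (P i)
  | out y v, P => .out y v (P (0 : Fin 1))
  | inp q y x, P => .inp q y ((P (0 : Fin 1)).vsub (Sub.bind x))
  | sel y ℓ, P => .sel y ℓ (P (0 : Fin 1))
  | branch y n ℓ, P => .branch y n ℓ P

/-- The calculus of processes that satisfy `frag` and are typed with types that satisfy `A`.  Names are
variables and channel endpoints.  There is no recursion to unfold. -/
def calculus (frag : Tm → Prop) (A : Ty → Prop) : Calculus where
  Term := Tm
  IsTerm P := frag P ∧ Typed A P
  IsPhrase P := frag P ∧ Typed A P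
  Cong := Cong
  Cong₀ := Cong
  Step := Step
  par := par
  HasSuccess := HasSuccess
  Op := Op
  arity := Op.arity
  build := Op.build
  Name := ℕ
  names := fv
  Ren := ℕ → ℕ
  app σ := σ
  ren σ P := P.vsub (Sub.ofNames σ)

end MS

/-- mixed sessions -/
def CMVplus : Calculus := MS.calculus MS.Tm.OnlyMixed fun T => T.WF ∧ T.OnlyMixed

/-- sessions with the standard branching construct -/
def CMV : Calculus := MS.calculus MS.Tm.NoMixed fun T => T.WF ∧ T.NoMixed

/-- the linear, single-session, delegation-free fragment of mixed sessions -/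
def LCMVplus : Calculus :=
  MS.calculus (fun P => P.OnlyMixed ∧ P.resCount ≤ 1) fun T => T.WF ∧ T.OnlyMixed ∧ T.Linear

/-- the linear, single-session, delegation-free fragment of sessions with the standard branching
construct -/
def LCMV : Calculus :=
  MS.calculus (fun P => P.NoMixed ∧ P.resCount ≤ 1) fun T => T.WF ∧ T.NoMixed ∧ T.Linear

end SessionCalculi

/-!
A term is called *reliable* if it may still succeed whatever it does. Good encodings preserve and
reflect reliability (`IsGoodEncodingWith.reliable_enc`, `IsGoodEncodingWith.not_reliable_enc`), and
by distributability preservation the two components of a parallel composition can be recovered, up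
to bisimilarity, in its encoding (`IsGoodEncodingWith.exists_par`). Three arguments cover the pairs
of calculi.

*Linear mixed sessions as targets.* In each source there is a *chooser*, which may succeed but may
also fail, and two choosers can be put in parallel. The encoding of the two has at most one
restriction. The number of restrictions that are used is invariant under structural congruence
(`MS.Cong.usedRes_eq`), so one of the two components has none. There are no communications in such a
component; it merely resolves conditionals, and thus it is reliable as soon as it may succeed
(`MS.reliable_component`). So it is not the encoding of a
chooser (`IsGoodEncodingWith.not_two_choosers`).

*`CMV` and `CMV⁺` into multiparty sessions.* The context that represents the parallel composition
`D | D` of a closed term `D` with itself depends on the free names of the components only, so it is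
filled with two copies of the same session. Their participants coincide, but those of a typed
session are pairwise different (`MC.not_duplicable`).

*`SCMP` into multiparty sessions.* In all these targets each choice is *directed*: it addresses a
single participant. If `K` is reliable and all choices are directed, then `K | R` is reliable
(`MC.reliable_par`): when a participant `r` of `K` communicates with a participant `t` of `R`, its
choice addresses only `t`, so within `K` alone `r` would have been blocked forever, and the rest of
`K` had to be reliable without it (`MC.reliable_of_frozen`). In `SCMP`, however, there is a ring of
two senders and two receivers that may fail, although one of its two halves is reliable
(`MC.ringLeft_reliable`, `MC.not_scmp_encoding`).

The last argument needs to know to which component a redex of `K | R` belongs, that is, an inversion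
of structural congruence (`MC.par_decomp`). As congruence may pass through terms that are not
well-sorted, such as recursions whose bodies are sessions, there is no normal form to compute.
Instead, each term is interpreted by the ways to split off an atom, recursion being a least fixed
point (`MC.den`); this interpretation is invariant under congruence (`MC.den_cong`) and sound
(`MC.cong_of_den`).
-/

namespace SessionCalculi

/-! ### Reliable terms and good encodings -/

namespace Calculus

variable {L : Calculus}

/-- Whatever a reliable term does, it may still succeed. -/
def Reliable (L : Calculus) (M : L.Term) : Prop := ∀ M', L.Steps M M' → L.MaySucceed M'

lemma Reliable.of_steps {M M' : L.Term} (h : L.Reliable M) (hM : L.Steps M M') : L.Reliable M' :=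
  fun _ h' => h _ (hM.trans h')

lemma MaySucceed.of_steps {M M' : L.Term} (hM : L.Steps M M') (h : L.MaySucceed M') :
    L.MaySucceed M :=
  let ⟨N, hN, hs⟩ := h
  ⟨N, hM.trans hN, hs⟩

/-- Bisimilar terms are equally reliable: being reliable only depends on what can be reached and on
whether success is still possible there. -/
lemma IsBisimulation.reliable {R : L.Term → L.Term → Prop} (h : L.IsBisimulation R)
    {M N : L.Term} (hR : R M N) (hM : L.Reliable M) : L.Reliable N := fun N' hN' => by
  obtain ⟨M', hM', hR'⟩ := h.back M N N' hR hN'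
  exact (h.success _ _ hR').1 (hM M' hM')

end Calculus

namespace IsGoodEncodingWith

variable {S T : Calculus} {enc : S.Term → T.Term} {eqv : T.Term → T.Term → Prop}
  {φ : S.Name → List T.Name}

lemma reliable_enc (h : IsGoodEncodingWith S T enc eqv φ) {M : S.Term} (hM : S.IsTerm M)
    (hr : S.Reliable M) : T.Reliable (enc M) := fun N hN => by
  obtain ⟨M', hM', hs, N', hN', he⟩ := h.sound M N hM hN
  exact .of_steps hN'
    ((h.bisimulation.success _ _ he).2 ((h.successSensitive M' hM').1 (hr M' hs)))

lemma not_reliable_enc (h : IsGoodEncodingWith S T enc eqv φ) {M M' : S.Term} (hM : S.IsTerm M)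
    (hM' : S.IsTerm M') (hs : S.Steps M M') (hf : ¬ S.MaySucceed M') : ¬ T.Reliable (enc M) := by
  obtain ⟨N, hN, he⟩ := h.complete M M' hM hM' hs
  exact fun hr => hf
    ((h.successSensitive M' hM').2 ((h.bisimulation.success _ _ he).1 (hr N hN)))

/-- Distributability preservation for two components. -/
lemma exists_par (h : IsGoodEncodingWith S T enc eqv φ) {M₁ M₂ : S.Term}
    (hM : S.IsTerm (S.par M₁ M₂)) (h₁ : S.IsTerm M₁) (h₂ : S.IsTerm M₂)
    (hc : S.Cong₀ (S.par M₁ M₂) (S.par M₁ M₂)) :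
    ∃ N₁ N₂, T.Cong₀ (enc (S.par M₁ M₂)) (T.par N₁ N₂) ∧ eqv N₁ (enc M₁) ∧ eqv N₂ (enc M₂) := by
  obtain ⟨N₁, Ns, hd, hf⟩ := h.distributabilityPreserving (S.par M₁ M₂) M₁ [M₂] hM
    (by simp [h₁, h₂]) hc
  obtain ⟨he₁, hf⟩ := List.forall₂_cons.1 hf
  obtain ⟨N₂, Ns', he₂, hnil, rfl⟩ := List.forall₂_cons_right_iff.1 hf
  obtain rfl := List.forall₂_nil_right_iff.1 hnil
  exact ⟨N₁, N₂, hd, he₁, he₂⟩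

/-- If the target only has distributable terms with a component that is reliable as soon as it may
succeed, then two components of the source cannot both choose between success and failure. -/
lemma not_two_choosers (h : IsGoodEncodingWith S T enc eqv φ) {M₁ M₂ M₁' M₂' : S.Term}
    (hT : ∀ N N₁ N₂, T.IsTerm N → T.Cong₀ N (T.par N₁ N₂) →
      (T.MaySucceed N₁ → T.Reliable N₁) ∨ (T.MaySucceed N₂ → T.Reliable N₂))
    (hM : S.IsTerm (S.par M₁ M₂)) (h₁ : S.IsTerm M₁) (h₂ : S.IsTerm M₂)
    (hc : S.Cong₀ (S.par M₁ M₂) (S.par M₁ M₂)) (h₁' : S.IsTerm M₁') (h₂' : S.IsTerm M₂')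
    (s₁ : S.MaySucceed M₁) (s₂ : S.MaySucceed M₂) (r₁ : S.Steps M₁ M₁') (r₂ : S.Steps M₂ M₂')
    (f₁ : ¬ S.MaySucceed M₁') (f₂ : ¬ S.MaySucceed M₂') : False := by
  have key : ∀ M M' N, S.IsTerm M → S.IsTerm M' → S.MaySucceed M → S.Steps M M' →
      ¬ S.MaySucceed M' → eqv N (enc M) → ¬ (T.MaySucceed N → T.Reliable N) := by
    intro M M' N hM hM' s r f he hN
    refine h.not_reliable_enc hM hM' r f (h.bisimulation.reliable he (hN ?_))
    exact (h.bisimulation.success _ _ he).2 ((h.successSensitive M hM).1 s)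
  obtain ⟨N₁, N₂, hd, he₁, he₂⟩ := h.exists_par hM h₁ h₂ hc
  rcases hT _ _ _ (h.maps _ hM) hd with hN | hN
  · exact key _ _ _ h₁ h₁' s₁ r₁ f₁ he₁ hN
  · exact key _ _ _ h₂ h₂' s₂ r₂ f₂ he₂ hN

end IsGoodEncodingWith

/-! ### Mixed sessions: used restrictions -/

namespace MS

/-- Passing a renaming of indices under one binder. -/
def liftIdx (f : ℕ → ℕ) : ℕ → ℕ
  | 0 => 0
  | k + 1 => f k + 1

lemma Sub.lift_ofIndices (f : ℕ → ℕ) : (Sub.ofIndices f).lift = Sub.ofIndices (liftIdx f) := by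
  funext x
  rcases x with x | _ | k <;> rfl

lemma Sub.liftN_ofIndices (f : ℕ → ℕ) (n : ℕ) :
    Sub.liftN n (Sub.ofIndices f) = Sub.ofIndices (liftIdx^[n] f) := by
  induction n with
  | zero => rfl
  | succ n ih => rw [Sub.liftN, ih, Sub.lift_ofIndices, Function.iterate_succ_apply']

lemma liftIdx_injective {f : ℕ → ℕ} (hf : f.Injective) : (liftIdx f).Injective := by
  rintro (_ | a) (_ | b) h <;> simp_all [liftIdx, hf.eq_iff]

lemma liftIdx_iterate_injective {f : ℕ → ℕ} (hf : f.Injective) (n : ℕ) :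
    (liftIdx^[n] f).Injective := by
  induction n with
  | zero => exact hf
  | succ n ih => rw [Function.iterate_succ_apply']; exact liftIdx_injective ih

/-- The value is the index `k`. -/
def _root_.SessionCalculi.Val.IsIdx (k : ℕ) (v : Val) : Prop := v = .var (.bd k)

namespace Br

/-- The index `k` occurs in the head of a branch. -/
def Uses (k : ℕ) : Br → Prop
  | .out _ v => v.IsIdx k
  | .inp _ => False

end Br

namespace Tm

/-- The index `k` occurs in a term (where it is `k + n` below `n` binders). -/
def Uses : ℕ → Tm → Prop
  | _, nil => False
  | _, ok => False
  | k, par P Q => Uses k P ∨ Uses k Q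
  | k, res P => Uses (k + 2) P
  | k, cnd v P Q => v.IsIdx k ∨ Uses k P ∨ Uses k Q
  | k, choice _ y _ B P => y.IsIdx k ∨ ∃ i, (B i).Uses k ∨ Uses (k + (B i).binds) (P i)
  | k, out y v P => y.IsIdx k ∨ v.IsIdx k ∨ Uses k P
  | k, inp _ y P => y.IsIdx k ∨ Uses (k + 1) P
  | k, sel y _ P => y.IsIdx k ∨ Uses k P
  | k, branch y _ _ P => y.IsIdx k ∨ ∃ i, Uses k (P i)

open Classical in
/-- `1` if `p` holds, `0` otherwise. -/
noncomputable def indicator (p : Prop) : ℕ := if p then 1 else 0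

/-- The number of restrictions one of whose endpoints occurs. Unlike `resCount`, it is invariant
under structural congruence. -/
noncomputable def usedRes : Tm → ℕ
  | nil => 0
  | ok => 0
  | par P Q => usedRes P + usedRes Q
  | res P => usedRes P + indicator (Uses 0 P ∨ Uses 1 P)
  | cnd _ P Q => usedRes P + usedRes Q
  | choice _ _ _ _ P => ∑ i, usedRes (P i)
  | out _ _ P => usedRes P
  | inp _ _ P => usedRes P
  | sel _ _ P => usedRes P
  | branch _ _ _ P => ∑ i, usedRes (P i)

lemma indicator_le (p : Prop) : indicator p ≤ 1 := by
  unfold indicator; split_ifs <;> omega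

lemma indicator_eq_zero {p : Prop} : indicator p = 0 ↔ ¬ p := by
  unfold indicator; split_ifs <;> simp_all

lemma usedRes_le_resCount (P : Tm) : usedRes P ≤ resCount P := by
  induction P with
  | nil | ok => simp [usedRes]
  | par P Q hP hQ | cnd v P Q hP hQ => simp only [usedRes, resCount]; omega
  | res P hP => simp only [usedRes, resCount]; have := indicator_le (Uses 0 P ∨ Uses 1 P); omega
  | choice q y n B P hP => exact Finset.sum_le_sum fun i _ => hP i
  | branch y n ℓ P hP => exact Finset.sum_le_sum fun i _ => hP i
  | out y v P hP | inp q y P hP | sel y ℓ P hP => exact hP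

end Tm

lemma isIdx_sub {f : ℕ → ℕ} {k : ℕ} {v : Val} :
    (v.sub (Sub.ofIndices f)).IsIdx k ↔ ∃ j, f j = k ∧ v.IsIdx j := by
  rcases v with (x | j) | n | _ | _ <;>
    simp [Val.sub, Sub.ofIndices, Val.IsIdx, eq_comm]

lemma Br.uses_vsub {f : ℕ → ℕ} {k : ℕ} {B : Br} :
    (B.vsub (Sub.ofIndices f)).Uses k ↔ ∃ j, f j = k ∧ B.Uses j := by
  cases B <;> simp [Br.vsub, Br.Uses, isIdx_sub]

lemma Br.binds_vsub (σ : Sub) (B : Br) : (B.vsub σ).binds = B.binds := by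
  cases B <;> rfl

/-- Below `n` binders, the indices from `n` on correspond to those outside. -/
lemma liftIdx_iterate_eq {f : ℕ → ℕ} {n j k : ℕ} :
    (liftIdx^[n] f j = k + n) ↔ ∃ i, f i = k ∧ j = i + n := by
  induction n generalizing j k with
  | zero => simp
  | succ n ih =>
    rw [Function.iterate_succ_apply']
    cases j with
    | zero => simp [liftIdx]
    | succ j =>
      simp only [liftIdx, ← add_assoc, add_left_inj]
      exact ih

lemma exists_liftIdx {f : ℕ → ℕ} {n k : ℕ} {p : ℕ → Prop} :
    (∃ j, liftIdx^[n] f j = k + n ∧ p j) ↔ ∃ j, f j = k ∧ p (j + n) := by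
  simp only [liftIdx_iterate_eq]
  constructor
  · rintro ⟨_, ⟨i, hi, rfl⟩, h⟩; exact ⟨i, hi, h⟩
  · rintro ⟨i, hi, h⟩; exact ⟨_, ⟨i, hi, rfl⟩, h⟩

namespace Tm

lemma uses_vsub {f : ℕ → ℕ} {k : ℕ} {P : Tm} :
    (P.vsub (Sub.ofIndices f)).Uses k ↔ ∃ j, f j = k ∧ P.Uses j := by
  induction P generalizing f k with
  | nil | ok => simp [vsub, Uses]
  | par P Q hP hQ => simp only [vsub, Uses, hP, hQ, ← exists_or, and_or_left]
  | res P hP => simp only [vsub, Uses, Sub.liftN_ofIndices, hP, exists_liftIdx]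
  | cnd v P Q hP hQ => simp only [vsub, Uses, isIdx_sub, hP, hQ, ← exists_or, and_or_left]
  | choice q y n B P hP =>
    simp only [vsub, Uses, isIdx_sub, Br.uses_vsub, Br.binds_vsub, Sub.liftN_ofIndices, hP,
      exists_liftIdx, ← exists_or, ← and_or_left]
    rw [exists_comm]
    simp only [exists_and_left, ← exists_or, ← and_or_left]
  | out y v P hP => simp only [vsub, Uses, isIdx_sub, hP, ← exists_or, and_or_left]
  | inp q y P hP =>
    simp only [vsub, Uses, isIdx_sub, Sub.liftN_ofIndices, hP, exists_liftIdx, ← exists_or,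
      and_or_left]
  | sel y ℓ P hP => simp only [vsub, Uses, isIdx_sub, hP, ← exists_or, and_or_left]
  | branch y n ℓ P hP =>
    simp only [vsub, Uses, isIdx_sub, hP]
    rw [exists_comm]
    simp only [exists_and_left, ← exists_or, ← and_or_left]

lemma usedRes_vsub {f : ℕ → ℕ} (hf : f.Injective) (P : Tm) :
    (P.vsub (Sub.ofIndices f)).usedRes = P.usedRes := by
  induction P generalizing f with
  | nil | ok => rfl
  | par P Q hP hQ | cnd v P Q hP hQ => simp only [vsub, usedRes, hP hf, hQ hf]
  | res P hP =>
    have hu : ∀ k < 2, (P.vsub (Sub.ofIndices (liftIdx^[2] f))).Uses k ↔ P.Uses k := by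
      intro k hk
      have h2 : liftIdx^[2] f k = k := by
        interval_cases k <;> rfl
      rw [uses_vsub]
      constructor
      · rintro ⟨j, hj, h⟩
        rwa [liftIdx_iterate_injective hf 2 (hj.trans h2.symm)] at h
      · exact fun h => ⟨k, h2, h⟩
    simp only [vsub, usedRes, Sub.liftN_ofIndices, hP (liftIdx_iterate_injective hf 2),
      hu 0 (by omega), hu 1 (by omega)]
  | choice q y n B P hP =>
    simp only [vsub, usedRes, Sub.liftN_ofIndices]
    exact Finset.sum_congr rfl fun i _ => hP i (liftIdx_iterate_injective hf _)
  | branch y n ℓ P hP => exact Finset.sum_congr rfl fun i _ => hP i hf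
  | out y v P hP | sel y ℓ P hP => exact hP hf
  | inp q y P hP =>
    simp only [vsub, usedRes, Sub.liftN_ofIndices, hP (liftIdx_iterate_injective hf _)]

end Tm

lemma swapEnds_involutive : Function.Involutive swapEnds := by
  rintro (_ | _ | k) <;> rfl

lemma swapRes_involutive : Function.Involutive swapRes := by
  rintro (_ | _ | _ | _ | k) <;> rfl

lemma exists_involutive {f : ℕ → ℕ} (hf : f.Involutive) {k : ℕ} {p : ℕ → Prop} :
    (∃ j, f j = k ∧ p j) ↔ p (f k) :=
  ⟨fun ⟨j, hj, h⟩ => by rwa [← hj, hf j], fun h => ⟨f k, hf k, h⟩⟩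

open Tm

lemma uses_vsub_involutive {f : ℕ → ℕ} (hf : f.Involutive) {k : ℕ} {P : Tm} :
    (P.vsub (Sub.ofIndices f)).Uses k ↔ P.Uses (f k) := by
  rw [uses_vsub, exists_involutive hf]

lemma Cong.uses_iff {P Q : Tm} (h : Cong P Q) : ∀ k, P.Uses k ↔ Q.Uses k := by
  induction h with
  | refl => exact fun _ => Iff.rfl
  | symm _ ih => exact fun k => (ih k).symm
  | trans _ _ ih₁ ih₂ => exact fun k => (ih₁ k).trans (ih₂ k)
  | comm => exact fun k => or_comm
  | assoc => exact fun k => or_assoc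
  | parNil => exact fun k => by simp only [Uses, or_false]
  | resNil => exact fun k => Iff.rfl
  | resEnds P =>
    intro k
    exact (uses_vsub_involutive swapEnds_involutive (k := k + 2)).symm
  | extrude P Q =>
    intro k
    simp [Uses, uses_vsub]
  | resRes P =>
    intro k
    exact (uses_vsub_involutive swapRes_involutive (k := k + 2 + 2)).symm
  | permChoice q y n B P e =>
    exact fun k => or_congr_right (e.surjective.exists
      (p := fun i => (B i).Uses k ∨ Uses (k + (B i).binds) (P i)))
  | permBranch y n ℓ P e =>
    exact fun k => or_congr_right (e.surjective.exists (p := fun i => Uses k (P i)))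
  | par _ _ ih₁ ih₂ => exact fun k => or_congr (ih₁ k) (ih₂ k)
  | res _ ih => exact fun k => ih _
  | cnd v _ _ ih₁ ih₂ => exact fun k => or_congr_right (or_congr (ih₁ k) (ih₂ k))
  | choice q y B _ ih => exact fun k => or_congr_right (exists_congr fun i => or_congr_right (ih i _))
  | out y v _ ih => exact fun k => or_congr_right (or_congr_right (ih k))
  | inp q y _ ih => exact fun k => or_congr_right (ih _)
  | sel y ℓ _ ih => exact fun k => or_congr_right (ih _)
  | branch y ℓ _ ih => exact fun k => or_congr_right (exists_congr fun i => ih i _)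

lemma Cong.usedRes_eq {P Q : Tm} (h : Cong P Q) : P.usedRes = Q.usedRes := by
  induction h with
  | refl => rfl
  | symm _ ih => exact ih.symm
  | trans _ _ ih₁ ih₂ => exact ih₁.trans ih₂
  | comm => exact Nat.add_comm _ _
  | assoc => exact Nat.add_assoc _ _ _
  | parNil => rfl
  | resNil => simp [usedRes, Uses, indicator_eq_zero]
  | resEnds P =>
    have hu := fun k => uses_vsub_involutive swapEnds_involutive (k := k) (P := P)
    simp only [usedRes, usedRes_vsub swapEnds_involutive.injective, hu]
    simp only [swapEnds, or_comm]
  | extrude P Q =>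
    have h0 : ¬ (P.vsub (Sub.ofIndices (· + 2))).Uses 0 := by simp [uses_vsub]
    have h1 : ¬ (P.vsub (Sub.ofIndices (· + 2))).Uses 1 := by simp [uses_vsub]
    simp only [usedRes, usedRes_vsub (add_left_injective 2), Uses, h0, h1, false_or, add_assoc]
  | resRes P =>
    have hu := fun k => uses_vsub_involutive swapRes_involutive (k := k) (P := P)
    simp only [usedRes, usedRes_vsub swapRes_involutive.injective, Uses, hu]
    simp only [swapRes, zero_add, Nat.reduceAdd]
    omega
  | permChoice q y n B P e => exact (Equiv.sum_comp e fun i => (P i).usedRes).symm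
  | permBranch y n ℓ P e => exact (Equiv.sum_comp e fun i => (P i).usedRes).symm
  | par _ _ ih₁ ih₂ | cnd v _ _ ih₁ ih₂ => exact congrArg₂ (· + ·) ih₁ ih₂
  | res h ih => simp only [usedRes, ih, h.uses_iff]
  | choice q y B _ ih => exact Finset.sum_congr rfl fun i _ => ih i
  | branch y ℓ _ ih => exact Finset.sum_congr rfl fun i _ => ih i
  | out y v _ ih | inp q y _ ih | sel y ℓ _ ih => exact ih

/-! ### Mixed sessions: terms without used restrictions are deterministic -/

namespace Tm

/-- Resolving the top-level conditionals exposes `✓`. -/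
def EvalsOk : Tm → Prop
  | ok => True
  | par P Q => EvalsOk P ∨ EvalsOk Q
  | res P => EvalsOk P
  | cnd .tt P _ => EvalsOk P
  | cnd .ff _ Q => EvalsOk Q
  | _ => False

lemma HasSuccess.evalsOk {P : Tm} (h : P.HasSuccess) : P.EvalsOk := by
  induction P with
  | ok => trivial
  | par P Q hP hQ => exact h.imp hP hQ
  | res P hP => exact hP h
  | _ => exact h.elim

lemma evalsOk_vsub {f : ℕ → ℕ} {P : Tm} :
    (P.vsub (Sub.ofIndices f)).EvalsOk ↔ P.EvalsOk := by
  induction P generalizing f with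
  | par P Q hP hQ => exact or_congr hP hQ
  | res P hP => simp only [vsub, Sub.liftN_ofIndices, EvalsOk, hP]
  | cnd v P Q hP hQ =>
    rcases v with (x | j) | n | _ | _
    · exact Iff.rfl
    · exact Iff.rfl
    · exact Iff.rfl
    · exact hP
    · exact hQ
  | _ => exact Iff.rfl

end Tm

lemma Cong.evalsOk_iff {P Q : Tm} (h : Cong P Q) : P.EvalsOk ↔ Q.EvalsOk := by
  induction h with
  | symm _ ih => exact ih.symm
  | trans _ _ ih₁ ih₂ => exact ih₁.trans ih₂
  | comm => exact or_comm
  | assoc => exact or_assoc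
  | parNil => exact by simp only [EvalsOk, or_false]
  | resEnds P => exact (evalsOk_vsub (P := P)).symm
  | extrude P Q => exact or_congr_left evalsOk_vsub.symm
  | resRes P => exact (evalsOk_vsub (P := P)).symm
  | par _ _ ih₁ ih₂ => exact or_congr ih₁ ih₂
  | res _ ih => exact ih
  | cnd v _ _ ih₁ ih₂ =>
    rcases v with _ | n | _ | _
    · exact Iff.rfl
    · exact Iff.rfl
    · exact ih₁
    · exact ih₂
  | _ => exact Iff.rfl

/-- Without used restrictions there are no communications, so a step only resolves a conditional;
this neither uses a new index nor changes whether `✓` is going to be exposed. -/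
lemma Step.of_usedRes_eq_zero {P Q : Tm} (h : Step P Q) (h0 : P.usedRes = 0) :
    Q.usedRes = 0 ∧ (∀ k, Q.Uses k → P.Uses k) ∧ (P.EvalsOk ↔ Q.EvalsOk) := by
  induction h with
  | ifT P Q =>
    simp only [usedRes] at h0
    exact ⟨by omega, fun k h => .inr (.inl h), Iff.rfl⟩
  | ifF P Q =>
    simp only [usedRes] at h0
    exact ⟨by omega, fun k h => .inr (.inr h), Iff.rfl⟩
  | par Q _ ih =>
    simp only [usedRes] at h0
    obtain ⟨h1, h2, h3⟩ := ih (by omega)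
    exact ⟨by simp only [usedRes]; omega, fun k => Or.imp_left (h2 k), or_congr_left h3⟩
  | res h ih =>
    simp only [usedRes, Nat.add_eq_zero_iff, indicator_eq_zero] at h0
    obtain ⟨h1, h2, h3⟩ := ih h0.1
    refine ⟨?_, fun k => h2 _, h3⟩
    simp only [usedRes, Nat.add_eq_zero_iff, indicator_eq_zero]
    exact ⟨h1, fun h => h0.2 (h.imp (h2 0) (h2 1))⟩
  | struct c₁ _ c₂ ih =>
    rw [c₁.usedRes_eq] at h0
    obtain ⟨h1, h2, h3⟩ := ih h0
    exact ⟨c₂.usedRes_eq ▸ h1, fun k h => (c₁.uses_iff k).2 (h2 k ((c₂.uses_iff k).2 h)),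
      c₁.evalsOk_iff.trans (h3.trans c₂.evalsOk_iff)⟩
  -- a communication needs a restriction whose endpoints are the subjects of a redex
  | _ => simp [usedRes, Uses, Val.IsIdx, end₀, end₁, indicator_eq_zero] at h0

section Steps

variable {frag : Tm → Prop} {A : Ty → Prop}

lemma Steps.par {P P' : Tm} (h : (calculus frag A).Steps P P') (Q : Tm) :
    (calculus frag A).Steps (par P Q) (par P' Q) :=
  Relation.ReflTransGen.lift (fun P => Tm.par P Q)
    (fun _ _ => Or.imp (fun c => Cong.par c (.refl Q)) (Step.par Q)) _ _ h

lemma Steps.res {P P' : Tm} (h : (calculus frag A).Steps P P') :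
    (calculus frag A).Steps (res P) (res P') :=
  Relation.ReflTransGen.lift Tm.res (fun _ _ => Or.imp Cong.res Step.res) _ _ h

lemma maySucceed_of_evalsOk {P : Tm} (h : P.EvalsOk) : (calculus frag A).MaySucceed P := by
  induction P with
  | ok => exact ⟨_, .refl, trivial⟩
  | par P Q hP hQ =>
    rcases h with h | h
    · obtain ⟨P', hs, hP'⟩ := hP h
      exact ⟨_, Steps.par hs Q, .inl hP'⟩
    · obtain ⟨Q', hs, hQ'⟩ := hQ h
      exact ⟨_, .head (.inl (Cong.comm P Q)) (Steps.par hs P), .inl hQ'⟩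
  | res P hP =>
    obtain ⟨P', hs, hP'⟩ := hP h
    exact ⟨_, Steps.res hs, hP'⟩
  | cnd v P Q hP hQ =>
    rcases v with _ | n | _ | _
    · exact h.elim
    · exact h.elim
    · obtain ⟨P', hs, hP'⟩ := hP h
      exact ⟨P', .head (.inr (Step.ifT P Q)) hs, hP'⟩
    · obtain ⟨Q', hs, hQ'⟩ := hQ h
      exact ⟨Q', .head (.inr (Step.ifF P Q)) hs, hQ'⟩
  | _ => exact h.elim

lemma Steps.of_usedRes_eq_zero {P Q : Tm} (h : (calculus frag A).Steps P Q) (h0 : P.usedRes = 0) :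
    Q.usedRes = 0 ∧ (P.EvalsOk ↔ Q.EvalsOk) := by
  induction h with
  | refl => exact ⟨h0, Iff.rfl⟩
  | tail _ h ih =>
    obtain ⟨h1, h2⟩ := ih
    rcases h with h | h
    · have h : Cong _ _ := h
      exact ⟨h.usedRes_eq ▸ h1, h2.trans h.evalsOk_iff⟩
    · obtain ⟨h3, -, h4⟩ := Step.of_usedRes_eq_zero h h1
      exact ⟨h3, h2.trans h4⟩

/-- Without used restrictions only conditionals are resolved, in a confluent way. -/
lemma reliable_of_usedRes_eq_zero {P : Tm} (h0 : P.usedRes = 0)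
    (h : (calculus frag A).MaySucceed P) : (calculus frag A).Reliable P := fun Q hQ => by
  obtain ⟨P', hs, hP'⟩ := h
  exact maySucceed_of_evalsOk ((Steps.of_usedRes_eq_zero hQ h0).2.1
    ((Steps.of_usedRes_eq_zero hs h0).2.2 (HasSuccess.evalsOk hP')))

/-- With at most one restriction, one of two distributable components is deterministic. -/
lemma reliable_component {N N₁ N₂ : Tm} (h : N.resCount ≤ 1) (hc : Cong N (par N₁ N₂)) :
    ((calculus frag A).MaySucceed N₁ → (calculus frag A).Reliable N₁) ∨
      ((calculus frag A).MaySucceed N₂ → (calculus frag A).Reliable N₂) := by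
  have h1 := (usedRes_le_resCount N).trans h
  rw [hc.usedRes_eq, usedRes] at h1
  rcases Nat.eq_zero_or_pos N₁.usedRes with h0 | h0
  · exact .inl (reliable_of_usedRes_eq_zero h0)
  · exact .inr (reliable_of_usedRes_eq_zero (by omega))

end Steps

end MS
end SessionCalculi

namespace SessionCalculi

/-! ### Mixed sessions: choosers -/

namespace MS

namespace Tm

/-- There is no occurrence of `✓`, not even below prefixes. -/
def OkFree : Tm → Prop
  | nil => True
  | ok => False
  | par P Q => OkFree P ∧ OkFree Q
  | res P => OkFree P
  | cnd _ P Q => OkFree P ∧ OkFree Q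
  | choice _ _ _ _ P => ∀ i, OkFree (P i)
  | out _ _ P => OkFree P
  | inp _ _ P => OkFree P
  | sel _ _ P => OkFree P
  | branch _ _ _ P => ∀ i, OkFree (P i)

lemma okFree_vsub {σ : Sub} {P : Tm} : (P.vsub σ).OkFree ↔ P.OkFree := by
  induction P generalizing σ <;> simp_all [vsub, OkFree]

lemma OkFree.not_hasSuccess {P : Tm} (h : P.OkFree) : ¬ P.HasSuccess := by
  induction P with
  | par P Q hP hQ => exact not_or.2 ⟨hP h.1, hQ h.2⟩
  | res P hP => exact hP h
  | ok => exact h.elim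
  | _ => exact not_false

end Tm

open Tm

lemma Cong.okFree_iff {P Q : Tm} (h : Cong P Q) : P.OkFree ↔ Q.OkFree := by
  induction h with
  | symm _ ih => exact ih.symm
  | trans _ _ ih₁ ih₂ => exact ih₁.trans ih₂
  | comm => exact and_comm
  | assoc => exact and_assoc
  | parNil => exact by simp only [OkFree, and_true]
  | resEnds P => exact (okFree_vsub (P := P)).symm
  | extrude P Q => exact and_congr_left' okFree_vsub.symm
  | resRes P => exact (okFree_vsub (P := P)).symm
  | permChoice q y n B P e => exact e.surjective.forall (p := fun i => OkFree (P i))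
  | permBranch y n ℓ P e => exact e.surjective.forall (p := fun i => OkFree (P i))
  | par _ _ ih₁ ih₂ | cnd v _ _ ih₁ ih₂ => exact and_congr ih₁ ih₂
  | choice _ _ _ _ ih | branch _ _ _ ih => exact forall_congr' ih
  | res _ ih | out _ _ _ ih | inp _ _ _ ih | sel _ _ _ ih => exact ih
  | _ => exact Iff.rfl

lemma Step.okFree {P Q : Tm} (h : Step P Q) (hP : P.OkFree) : Q.OkFree := by
  induction h with
  | ifT => exact hP.1
  | ifF => exact hP.2
  | par _ _ ih => exact ⟨ih hP.1, hP.2⟩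
  | res _ ih => exact ih hP
  | struct c₁ _ c₂ ih => exact c₂.okFree_iff.1 (ih (c₁.okFree_iff.1 hP))
  | _ => simp_all [OkFree, okFree_vsub]

section

variable {frag : Tm → Prop} {A : Ty → Prop}

lemma not_maySucceed_of_okFree {P : Tm} (h : P.OkFree) : ¬ (calculus frag A).MaySucceed P := by
  rintro ⟨Q, hs, hQ⟩
  have : Q.OkFree := by
    clear hQ
    induction hs with
    | refl => exact h
    | tail _ h' ih =>
      rcases h' with h' | h'
      · exact (Cong.okFree_iff h').1 ih
      · exact Step.okFree h' ih
  exact this.not_hasSuccess hQ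

end

lemma TCtx.Un.split {Γ : TCtx} (h : Γ.Un) : Γ.Split Γ Γ := fun x => by
  rcases hx : Γ x with _ | T
  · exact .inl ⟨rfl, rfl, rfl⟩
  · exact .inr ⟨T, rfl, .inl ⟨h x T hx, rfl, rfl⟩⟩

lemma TCtx.Un.ext {Γ : TCtx} (h : Γ.Un) {T : Ty} (hT : T.Un) : TCtx.Un (Γ.ext T) := by
  rintro (x | _ | k) U hU
  · exact h _ _ hU
  · obtain rfl := Option.some.inj hU; exact hT
  · exact h _ _ hU

/-- The empty context. -/
def emp : TCtx := fun _ => none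

lemma emp_un : emp.Un := fun _ _ h => nomatch h

lemma Typed.of_emp {A : Ty → Prop} {P : Tm} (h : ProcTy A emp P) : Typed A P :=
  ⟨emp, fun _ => rfl, fun _ _ h => by simp [emp] at h, h⟩

/-- The conditional `if x then ✓ else 0` on the outermost bound variable. -/
def testVar : Tm := cnd (.var (.bd 0)) ok nil

lemma testVar_typed {A : Ty → Prop} {Γ : TCtx} (h : Γ.Un) : ProcTy A (Γ.ext .bool) testVar :=
  have hu : TCtx.Un (Γ.ext .bool) := h.ext (T := .bool) trivial
  .cnd hu.split (.var rfl fun y U _ => hu y U) (.ok hu) (.nil hu)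

/-! ### The chooser of `CMV`: two outputs compete for one input on an unrestricted channel -/

/-- The type `μt.un!bool.t` or `μt.un?bool.t`. -/
def boolStream (p : Pol) : Ty := .mu (.com .un p .bool (.var 0))

lemma boolStream_dual : (boolStream .snd).Dual (boolStream .rcv) := by
  refine ⟨fun T U => (T = boolStream .snd ∨ T = .com .un .snd .bool (boolStream .snd)) ∧
    (U = boolStream .rcv ∨ U = .com .un .rcv .bool (boolStream .rcv)), ?_, .inl rfl, .inl rfl⟩
  rintro T U ⟨rfl | rfl, rfl | rfl⟩
  · exact .recL ⟨.inr rfl, .inl rfl⟩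
  · exact .recL ⟨.inr rfl, .inr rfl⟩
  · exact .recR ⟨.inr rfl, .inr rfl⟩
  · refine .com .un .snd ⟨fun T U => T = .bool ∧ U = .bool, ?_, rfl, rfl⟩ ⟨.inl rfl, .inl rfl⟩
    rintro T U ⟨rfl, rfl⟩
    exact .bool

lemma boolStream_subtype (p : Pol) :
    (boolStream p).Subtype (.com .un p .bool (boolStream p)) := by
  refine ⟨fun T U => (T = .bool ∧ U = .bool) ∨
    (T = boolStream p ∨ T = .com .un p .bool (boolStream p)) ∧
    (U = boolStream p ∨ U = .com .un p .bool (boolStream p)), ?_, .inr ⟨.inl rfl, .inr rfl⟩⟩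
  rintro T U (⟨rfl, rfl⟩ | ⟨rfl | rfl, rfl | rfl⟩)
  · exact .bool
  · exact .recL (.inr ⟨.inr rfl, .inl rfl⟩)
  · exact .recL (.inr ⟨.inr rfl, .inr rfl⟩)
  · exact .recR (.inr ⟨.inr rfl, .inr rfl⟩)
  · refine .com .un p ?_ (.inr ⟨.inl rfl, .inl rfl⟩)
    cases p <;> exact .inl ⟨rfl, rfl⟩

/-- The types that may be used in `CMV`. -/
abbrev CMVTy (T : Ty) : Prop := T.WF ∧ T.NoMixed

lemma boolStream_cmvTy (p : Pol) : CMVTy (boolStream p) := by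
  simp [CMVTy, boolStream, Ty.WF, Ty.ClosedBelow, Ty.WellFormed, Ty.GuardsVar, Ty.NoMixed]

lemma boolStream_com_cmvTy (p : Pol) : CMVTy (.com .un p .bool (boolStream p)) := by
  simp [CMVTy, boolStream, Ty.WF, Ty.ClosedBelow, Ty.WellFormed, Ty.GuardsVar, Ty.NoMixed]

/-- The context of the two endpoints of the channel, `0` for the output and `1` for the input. -/
def streamCtx : TCtx := (emp.ext (boolStream .rcv)).ext (boolStream .snd)

lemma streamCtx_un : streamCtx.Un :=
  TCtx.Un.ext (TCtx.Un.ext emp_un (T := boolStream .rcv) rfl) (T := boolStream .snd) rfl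

lemma stream_res {P : Tm} (h : ProcTy CMVTy streamCtx P) : ProcTy CMVTy emp (res P) :=
  .res (boolStream_cmvTy _) (boolStream_cmvTy _) boolStream_dual h

lemma stream_par {P Q : Tm} (hP : ProcTy CMVTy streamCtx P) (hQ : ProcTy CMVTy streamCtx Q) :
    ProcTy CMVTy streamCtx (par P Q) :=
  .par streamCtx_un.split hP hQ

lemma stream_out {v : Val} (h : ValTy CMVTy streamCtx v .bool) :
    ProcTy CMVTy streamCtx (out end₀ v nil) :=
  .out streamCtx_un.split
    (.sub (.var (T := boolStream .snd) rfl fun y U _ => streamCtx_un y U) (boolStream_subtype _)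
      (boolStream_com_cmvTy _))
    (.inr ⟨rfl, rfl, rfl⟩) streamCtx_un.split h (.nil streamCtx_un)

lemma stream_inp : ProcTy CMVTy streamCtx (inp .lin end₁ testVar) :=
  .inp streamCtx_un.split nofun
    (.sub (.var (T := boolStream .rcv) rfl fun y U _ => streamCtx_un y U) (boolStream_subtype _)
      (boolStream_com_cmvTy _))
    (.inr ⟨rfl, rfl, rfl⟩) (testVar_typed streamCtx_un)

/-- The chooser `(νyz)(y!tt.0 | lin z?x.if x then ✓ else 0 | y!ff.0)`. -/
def cmvChooser : Tm :=
  res (par (out end₀ .tt nil) (par (inp .lin end₁ testVar) (out end₀ .ff nil)))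

/-- The chooser after it has received `ff`. -/
def cmvFailed : Tm := res (par nil (par nil (out end₀ .tt nil)))

lemma cmvChooser_typed : ProcTy CMVTy emp cmvChooser :=
  stream_res (stream_par (stream_out (.tt streamCtx_un))
    (stream_par stream_inp (stream_out (.ff streamCtx_un))))

lemma cmvFailed_typed : ProcTy CMVTy emp cmvFailed :=
  stream_res (stream_par (.nil streamCtx_un)
    (stream_par (.nil streamCtx_un) (stream_out (.tt streamCtx_un))))

lemma step_testVar (v : Val) (P : Tm) (h : Step (cnd v ok nil) P) (R : Tm) :
    Step (res (par nil (par (testVar.vsub (Sub.inst v)) R))) (res (par nil (par P R))) :=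
  .res (.struct (.comm _ _) (.par nil (.par R h)) (.comm _ _))

lemma cmvChooser_maySucceed : CMV.MaySucceed cmvChooser :=
  ⟨_, .head (.inr (Step.linCom .tt _ _ _)) (.single (.inr (step_testVar .tt ok (.ifT _ _) _))),
    .inr (.inl trivial)⟩

lemma cmvChooser_steps : CMV.Steps cmvChooser cmvFailed := by
  refine .head (b := res (par (out end₀ .ff nil) (par (inp .lin end₁ testVar) (out end₀ .tt nil))))
    (.inl (.res ?_)) (.head (.inr (Step.linCom .ff _ _ _))
      (.single (.inr (step_testVar .ff nil (.ifF _ _) _))))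
  exact (Cong.comm _ _).trans ((Cong.par (.comm _ _) (.refl _)).trans (.assoc _ _ _))

/-! ### The chooser of `CMV⁺`: two outputs with the same label in a linear choice -/

/-- The type of the chosen endpoint, `lin⊕{ℓ!bool.end}`, and that of the other one,
`lin&{ℓ?bool.end}`. -/
def oneBool : Pol → Ty
  | .snd => .choice .lin .int 1 (fun _ => (0, .snd)) (fun _ => .bool) fun _ => .fin
  | .rcv => .choice .lin .ext 1 (fun _ => (0, .rcv)) (fun _ => .bool) fun _ => .fin

lemma oneBool_dual : (oneBool .snd).Dual (oneBool .rcv) := by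
  refine ⟨fun T U => (T = oneBool .snd ∧ U = oneBool .rcv) ∨ T = .fin ∧ U = .fin, ?_,
    .inl ⟨rfl, rfl⟩⟩
  rintro T U (⟨rfl, rfl⟩ | ⟨rfl, rfl⟩)
  · refine .choice .lin .int (.refl _) fun _ =>
      ⟨rfl, ⟨fun T U => T = .bool ∧ U = .bool, ?_, rfl, rfl⟩, .inr ⟨rfl, rfl⟩⟩
    rintro T U ⟨rfl, rfl⟩
    exact .bool
  · exact .fin

/-- The types that may be used in `CMV⁺`. -/
abbrev CMVplusTy (T : Ty) : Prop := T.WF ∧ T.OnlyMixed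

lemma oneBool_cmvplusTy (p : Pol) : CMVplusTy (oneBool p) := by
  cases p <;> simp [CMVplusTy, oneBool, Ty.WF, Ty.ClosedBelow, Ty.WellFormed, Ty.OnlyMixed,
    Function.injective_of_subsingleton]

/-- The context with the single assignment `x:T`. -/
def single (x : Var) (T : Ty) : TCtx := Function.update emp x (some T)

lemma single_other {x : Var} {T : Ty} : ∀ y U, y ≠ x → single x T y = some U → U.Un := by
  intro y U hy h
  simp [single, hy, emp] at h

lemma single_un {x : Var} {T : Ty} (h : T.Un) : (single x T).Un := by
  intro y U hU
  by_cases hy : y = x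
  · subst hy
    simp only [single, Function.update_self, Option.some.injEq] at hU
    exact hU ▸ h
  · exact single_other y U hy hU

lemma single_split {x : Var} {T : Ty} (h : ¬ T.Un) : (single x T).Split (single x T) emp := by
  intro y
  by_cases hy : y = x
  · subst hy
    exact .inr ⟨T, by simp [single], .inr ⟨h, .inl ⟨by simp [single], rfl⟩⟩⟩
  · exact .inl ⟨by simp [single, hy, emp], by simp [single, hy, emp], rfl⟩

lemma oneBool_not_un (p : Pol) : ¬ (oneBool p).Un := by
  cases p <;> exact nofun

lemma ends_split :
    TCtx.Split ((emp.ext (oneBool .rcv)).ext (oneBool .snd)) (single (.bd 0) (oneBool .snd))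
      (single (.bd 1) (oneBool .rcv)) := by
  rintro (x | _ | _ | k)
  · exact .inl ⟨rfl, by simp [single, emp], by simp [single, emp]⟩
  · exact .inr ⟨_, rfl, .inr ⟨oneBool_not_un _, .inl ⟨by simp [single], by simp [single, emp]⟩⟩⟩
  · exact .inr ⟨_, rfl, .inr ⟨oneBool_not_un _, .inr ⟨by simp [single, emp], by simp [single]⟩⟩⟩
  · exact .inl ⟨rfl, by simp [single, emp], by simp [single, emp]⟩

/-- The values among which the chooser chooses. -/
def bit : Fin 2 → Val
  | 0 => .tt
  | 1 => .ff

/-- The chooser `(νyz)(lin y (ℓ!tt.0 + ℓ!ff.0) | lin z (ℓ?x.if x then ✓ else 0) | 0)`.  The last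
component lets it evolve in the same way as that of `CMV`. -/
def cmvplusChooser : Tm :=
  res (par (choice .lin end₀ 2 (fun i => .out 0 (bit i)) fun _ => nil)
    (par (choice .lin end₁ 1 (fun _ => .inp 0) fun _ => testVar) nil))

/-- The chooser after it has received `ff`. -/
def cmvplusFailed : Tm := res (par nil (par nil nil))

lemma cmvplusChooser_typed : ProcTy CMVplusTy emp cmvplusChooser := by
  have h0 : TCtx.Un (single (.bd 0) .fin) := single_un trivial
  refine .res (oneBool_cmvplusTy .snd) (oneBool_cmvplusTy .rcv) oneBool_dual
    (.par ends_split ?_ (.par (Γ₂ := emp) (single_split (oneBool_not_un _)) ?_ (.nil emp_un)))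
  · refine .choice (T := fun _ : Fin 1 => .bool) (U := fun _ => .fin) (fun _ => 0) _
      (fun _ => single (.bd 0) .fin) (single_split (oneBool_not_un _)) nofun
      (.var (by simp [single]; rfl) single_other) (fun i => ⟨0, (Subsingleton.elim _ _)⟩)
      (fun _ => rfl) (fun _ => .inl ⟨rfl, rfl⟩) (fun j => .out h0.split ?_) fun _ => .nil h0
    fin_cases j
    · exact .tt h0
    · exact .ff h0
  · have h1 : TCtx.Un (single (.bd 1) .fin) := single_un trivial
    exact .choice (T := fun _ : Fin 1 => .bool) (U := fun _ => .fin) (fun _ => 0) _ _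
      (single_split (oneBool_not_un _)) nofun
      (.var (by simp [single]; rfl) single_other) (fun i => ⟨0, (Subsingleton.elim _ _)⟩)
      (fun _ => rfl) (fun _ => .inl ⟨rfl, rfl⟩) (fun j => .inp 0 .bool) fun _ => testVar_typed h1

lemma cmvplusFailed_typed : ProcTy CMVplusTy emp cmvplusFailed := by
  have hu : TCtx.Un ((emp.ext .fin).ext .fin) :=
    TCtx.Un.ext (TCtx.Un.ext emp_un (T := .fin) trivial) (T := .fin) trivial
  have hA : CMVplusTy .fin := ⟨⟨trivial, trivial⟩, trivial⟩
  refine .res hA hA ⟨fun T U => T = .fin ∧ U = .fin, ?_, rfl, rfl⟩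
    (.par hu.split (.nil hu) (.par hu.split (.nil hu) (.nil hu)))
  rintro T U ⟨rfl, rfl⟩
  exact .fin

lemma cmvplusChooser_maySucceed : CMVplus.MaySucceed cmvplusChooser :=
  ⟨_, .head (.inr (Step.linLin _ _ _ _ 0 0 0 .tt _ rfl rfl))
    (.single (.inr (step_testVar .tt ok (.ifT _ _) _))), .inr (.inl trivial)⟩

lemma cmvplusChooser_steps : CMVplus.Steps cmvplusChooser cmvplusFailed :=
  .head (.inr (Step.linLin _ _ _ _ 1 0 0 .ff _ rfl rfl))
    (.single (.inr (step_testVar .ff nil (.ifF _ _) _)))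

lemma isTerm_cmv {P : Tm} (hf : P.NoMixed) (h : ProcTy CMVTy emp P) : CMV.IsTerm P :=
  ⟨hf, .of_emp h⟩

lemma isTerm_cmvplus {P : Tm} (hf : P.OnlyMixed) (h : ProcTy CMVplusTy emp P) : CMVplus.IsTerm P :=
  ⟨hf, .of_emp h⟩

lemma cmvChooser_isTerm : CMV.IsTerm cmvChooser :=
  isTerm_cmv (by simp [cmvChooser, testVar, NoMixed]) cmvChooser_typed

lemma cmvFailed_isTerm : CMV.IsTerm cmvFailed :=
  isTerm_cmv (by simp [cmvFailed, NoMixed]) cmvFailed_typed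

lemma cmvChooser_par_isTerm : CMV.IsTerm (par cmvChooser cmvChooser) :=
  isTerm_cmv (by simp [cmvChooser, testVar, NoMixed])
    (.par emp_un.split cmvChooser_typed cmvChooser_typed)

lemma cmvplusChooser_isTerm : CMVplus.IsTerm cmvplusChooser :=
  isTerm_cmvplus (by simp [cmvplusChooser, testVar, OnlyMixed]) cmvplusChooser_typed

lemma cmvplusFailed_isTerm : CMVplus.IsTerm cmvplusFailed :=
  isTerm_cmvplus (by simp [cmvplusFailed, OnlyMixed]) cmvplusFailed_typed

lemma cmvplusChooser_par_isTerm : CMVplus.IsTerm (par cmvplusChooser cmvplusChooser) :=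
  isTerm_cmvplus (by simp [cmvplusChooser, testVar, OnlyMixed])
    (.par emp_un.split cmvplusChooser_typed cmvplusChooser_typed)

end MS
end SessionCalculi

namespace SessionCalculi

/-! ### Multiparty sessions: substitutions -/

lemma Val.sub_sub (σ σ' : Sub) (v : Val) :
    (v.sub σ).sub σ' = v.sub fun x => (σ x).sub σ' := by
  cases v <;> rfl

lemma Val.shift_sub_lift (σ : Sub) (v : Val) :
    (v.sub Sub.shift).sub σ.lift = (v.sub σ).sub Sub.shift := by
  rcases v with (x | k) | n | _ | _ <;> rfl

lemma Sub.lift_comp (σ σ' : Sub) :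
    (Sub.lift fun x => (σ x).sub σ') = fun x => (σ.lift x).sub σ'.lift := by
  funext x
  rcases x with x | _ | k
  · exact (Val.shift_sub_lift _ _).symm
  · rfl
  · exact (Val.shift_sub_lift _ _).symm

lemma Sub.liftN_comp (n : ℕ) (σ σ' : Sub) :
    (Sub.liftN n fun x => (σ x).sub σ') = fun x => (Sub.liftN n σ x).sub (Sub.liftN n σ') := by
  induction n with
  | zero => rfl
  | succ n ih => simp only [Sub.liftN, ih, Sub.lift_comp]

lemma Val.ofIndices_add_succ (n : ℕ) (v : Val) :
    v.sub (Sub.ofIndices (· + (n + 1))) = (v.sub (Sub.ofIndices (· + n))).sub Sub.shift := by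
  rcases v with (x | k) | _ | _ | _ <;> rfl

lemma Val.ofIndices_sub_liftN (n : ℕ) (σ : Sub) (v : Val) :
    (v.sub (Sub.ofIndices (· + n))).sub (Sub.liftN n σ) =
      (v.sub σ).sub (Sub.ofIndices (· + n)) := by
  induction n with
  | zero =>
    have h : ∀ w : Val, w.sub (Sub.ofIndices (· + 0)) = w := by
      rintro ((x | k) | _ | _ | _) <;> rfl
    rw [h, h]; rfl
  | succ n ih =>
    rw [Val.ofIndices_add_succ, Val.ofIndices_add_succ, Sub.liftN, Val.shift_sub_lift, ih]

namespace MC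

@[simp] lemma Pre.binds_vsub (σ : Sub) (π : Pre) : (π.vsub σ).binds = π.binds := by
  cases π <;> rfl

@[simp] lemma Pre.peer_vsub (σ : Sub) (π : Pre) : (π.vsub σ).peer = π.peer := by
  cases π <;> rfl

lemma Pre.vsub_vsub (σ σ' : Sub) (π : Pre) :
    (π.vsub σ).vsub σ' = π.vsub fun x => (σ x).sub σ' := by
  cases π <;> simp [Pre.vsub, Val.sub_sub]

/-- Extend a family indexed by variables by a value for a new outermost bound variable. -/
def cons {α : Type*} (a : α) (τ : Var → α) : Var → α
  | .fr X => τ (.fr X)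
  | .bd 0 => a
  | .bd (k + 1) => τ (.bd k)

namespace Tm

lemma vsub_vsub (σ σ' : Sub) (P : Tm) :
    (P.vsub σ).vsub σ' = P.vsub fun x => (σ x).sub σ' := by
  induction P generalizing σ σ' <;>
    simp_all [vsub, Pre.vsub_vsub, Val.sub_sub, Sub.liftN_comp]

lemma vsub_ofIndices_liftN (n : ℕ) (σ : Sub) (P : Tm) :
    (P.vsub (Sub.ofIndices (· + n))).vsub (Sub.liftN n σ) =
      (P.vsub σ).vsub (Sub.ofIndices (· + n)) := by
  rw [vsub_vsub, vsub_vsub]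
  congr 1
  funext x
  exact Val.ofIndices_sub_liftN n σ (.var x)

lemma liftP_comp (ρ ρ' : Var → Var) : liftP (ρ' ∘ ρ) = liftP ρ' ∘ liftP ρ := by
  funext X
  rcases X with X | _ | k
  · simp only [liftP, Function.comp]; cases ρ (.fr X) <;> rfl
  · rfl
  · simp only [liftP, Function.comp]; cases ρ (.bd k) <;> rfl

lemma pren_pren (ρ ρ' : Var → Var) (P : Tm) : (P.pren ρ).pren ρ' = P.pren (ρ' ∘ ρ) := by
  induction P generalizing ρ ρ' <;> simp_all [pren, liftP_comp]

lemma pren_vsub (ρ : Var → Var) (σ : Sub) (P : Tm) :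
    (P.vsub σ).pren ρ = (P.pren ρ).vsub σ := by
  induction P generalizing ρ σ <;> simp_all [pren, vsub]

lemma liftT_comp_liftP (τ : Var → Tm) (ρ : Var → Var) : liftT τ ∘ liftP ρ = liftT (τ ∘ ρ) := by
  funext X
  rcases X with X | _ | k
  · simp only [liftP, liftT, Function.comp]; cases ρ (.fr X) <;> rfl
  · rfl
  · simp only [liftP, liftT, Function.comp]; cases ρ (.bd k) <;> rfl

lemma psub_pren (τ : Var → Tm) (ρ : Var → Var) (P : Tm) :
    (P.pren ρ).psub τ = P.psub (τ ∘ ρ) := by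
  induction P generalizing τ ρ with
  | mu P ih => simp only [pren, psub, ih, liftT_comp_liftP]
  | _ => simp_all [pren, psub, Function.comp_def]

lemma pren_liftT (ρ : Var → Var) (τ : Var → Tm) :
    (fun X => (liftT τ X).pren (liftP ρ)) = liftT fun X => (τ X).pren ρ := by
  have h : ∀ Q : Tm, (Q.pren shiftP).pren (liftP ρ) = (Q.pren ρ).pren shiftP := by
    intro Q
    rw [pren_pren, pren_pren]
    congr 1
    funext X
    cases X <;> rfl
  funext X
  rcases X with X | _ | k
  · exact h _
  · rfl
  · exact h _

lemma pren_psub (ρ : Var → Var) (τ : Var → Tm) (P : Tm) :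
    (P.psub τ).pren ρ = P.psub fun X => (τ X).pren ρ := by
  induction P generalizing τ ρ with
  | mu P ih => simp only [pren, psub, ih, pren_liftT]
  | _ => simp_all [pren, psub, pren_vsub]

lemma vsub_liftT (σ : Sub) (τ : Var → Tm) :
    (fun X => (liftT τ X).vsub σ) = liftT fun X => (τ X).vsub σ := by
  funext X
  rcases X with X | _ | k
  · exact (pren_vsub _ _ _).symm
  · rfl
  · exact (pren_vsub _ _ _).symm

lemma vsub_psub (σ : Sub) (τ : Var → Tm) (P : Tm) :
    (P.psub τ).vsub σ = (P.vsub σ).psub fun X => (τ X).vsub σ := by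
  induction P generalizing τ σ with
  | mu P ih => simp only [vsub, psub, ih, vsub_liftT]
  | sum n π P ih =>
    simp only [vsub, psub, ih, vsub_ofIndices_liftN, Pre.binds_vsub]
  | _ => simp_all [vsub, psub]

lemma psub_liftT_pren_shiftP (τ : Var → Tm) (Q : Tm) :
    (Q.pren shiftP).psub (liftT τ) = (Q.psub τ).pren shiftP := by
  rw [psub_pren, pren_psub]
  congr 1
  funext X
  cases X <;> rfl

lemma psub_liftT (τ τ' : Var → Tm) :
    (fun X => (liftT τ X).psub (liftT τ')) = liftT fun X => (τ X).psub τ' := by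
  funext X
  rcases X with X | _ | k
  · exact psub_liftT_pren_shiftP _ _
  · rfl
  · exact psub_liftT_pren_shiftP _ _

lemma psub_psub (τ τ' : Var → Tm) (P : Tm) :
    (P.psub τ).psub τ' = P.psub fun X => (τ X).psub τ' := by
  induction P generalizing τ τ' with
  | mu P ih => simp only [psub, ih, psub_liftT]
  | sum n π P ih => simp only [psub, ih, vsub_psub]
  | _ => simp_all [psub]

lemma liftT_pvar : liftT pvar = pvar := by
  funext X
  rcases X with X | _ | k <;> rfl

@[simp] lemma psub_pvar (P : Tm) : P.psub pvar = P := by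
  induction P <;> simp_all [psub, liftT_pvar, vsub]

lemma unfold_eq (P Q : Tm) : P.unfold Q = P.psub (cons Q pvar) := rfl

lemma psub_cons_liftT (τ : Var → Tm) (Q : Tm) (τ' : Var → Tm) :
    (fun X => (liftT τ X).psub (cons Q τ')) = cons Q fun X => (τ X).psub τ' := by
  have h : cons Q τ' ∘ shiftP = τ' := by
    funext X
    cases X <;> rfl
  funext X
  rcases X with X | _ | k
  · simp only [liftT, psub_pren, h, cons]
  · rfl
  · simp only [liftT, psub_pren, h, cons]

lemma unfold_psub_liftT (τ : Var → Tm) (P Q : Tm) :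
    (P.psub (liftT τ)).unfold Q = P.psub (cons Q τ) := by
  simp only [unfold_eq, psub_psub, psub_cons_liftT, psub_pvar]

lemma psub_unfold (τ : Var → Tm) (P Q : Tm) :
    (P.unfold Q).psub τ = P.psub (cons (Q.psub τ) τ) := by
  rw [unfold_eq, psub_psub]
  congr 1
  funext X
  rcases X with X | _ | k <;> rfl

lemma vsub_unfold (σ : Sub) (P Q : Tm) : (P.unfold Q).vsub σ = (P.vsub σ).unfold (Q.vsub σ) := by
  rw [unfold_eq, unfold_eq, vsub_psub]
  congr 1
  funext X
  rcases X with X | _ | k <;> rfl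

@[simp] lemma locs_vsub (σ : Sub) (P : Tm) : (P.vsub σ).locs = P.locs := by
  induction P generalizing σ <;> simp_all [vsub, locs]

lemma locs_finite (P : Tm) : P.locs.Finite := by
  induction P <;> simp_all [locs]

end Tm

open Tm

/-! ### Multiparty sessions: structural congruence -/

/-- Structural congruence including the unfolding of recursion, on all terms, well-sorted or not. -/
infix:50 " ≈ₛ " => Cong true

/-- The empty session, represented by an inactive participant. -/
def unit : Tm := loc 0 nil

lemma Cong.unit_loc (p q : ℕ) : Tm.loc p .nil ≈ₛ Tm.loc q .nil := by
  by_cases h : p = q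
  · exact h ▸ .refl _
  -- each of the two is inactive besides the other one
  exact (Cong.symm (.inactive q (Tm.loc p .nil) (fun h' => h (Eq.symm h')))).trans
    ((Cong.comm _ _).trans (.inactive p (Tm.loc q .nil) h))

/-- Inactive participants may be added under any name. -/
lemma Cong.loc_nil_par (p : ℕ) (M : Tm) : Tm.par (Tm.loc p .nil) M ≈ₛ M := by
  obtain ⟨r, hr⟩ := M.locs_finite.exists_notMem
  exact (Cong.par (.unit_loc p r) (.refl M)).trans (.inactive r M hr)

lemma Cong.unit_par (M : Tm) : Tm.par MC.unit M ≈ₛ M := .loc_nil_par 0 M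

lemma Cong.par_unit (M : Tm) : Tm.par M MC.unit ≈ₛ M := (Cong.comm _ _).trans (.unit_par M)

lemma Cong.left_comm (M N K : Tm) : Tm.par M (Tm.par N K) ≈ₛ Tm.par N (Tm.par M K) :=
  (Cong.symm (.assoc M N K)).trans ((Cong.par (.comm M N) (.refl K)).trans (.assoc N M K))

lemma Cong.of_false {M N : Tm} {u : Bool} (h : Cong u M N) : M ≈ₛ N := by
  induction h with
  | refl => exact .refl _
  | symm _ ih => exact .symm ih
  | trans _ _ ih₁ ih₂ => exact .trans ih₁ ih₂
  | unfold P _ => exact .unfold P rfl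
  | perm n π P e => exact .perm n π P e
  | inactive p M h => exact .inactive p M h
  | comm => exact .comm _ _
  | assoc => exact .assoc _ _ _
  | mu _ ih => exact .mu ih
  | sum π _ ih => exact .sum π ih
  | cnd v _ _ ih₁ ih₂ => exact .cnd v ih₁ ih₂
  | loc p _ ih => exact .loc p ih
  | par _ _ ih₁ ih₂ => exact .par ih₁ ih₂

lemma Cong.vsub {M N : Tm} (h : M ≈ₛ N) (σ : Sub) : M.vsub σ ≈ₛ N.vsub σ := by
  induction h generalizing σ with
  | refl => exact .refl _
  | symm _ ih => exact .symm (ih σ)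
  | trans _ _ ih₁ ih₂ => exact .trans (ih₁ σ) (ih₂ σ)
  | unfold P _ => rw [vsub_unfold]; exact .unfold _ rfl
  | perm n π P e =>
    exact .perm n (fun i => (π i).vsub σ) (fun i => (P i).vsub (Sub.liftN (π i).binds σ)) e
  | inactive p M h => exact .inactive p _ (by simpa using h)
  | comm => exact .comm _ _
  | assoc => exact .assoc _ _ _
  | mu _ ih => exact .mu (ih σ)
  | sum π _ ih => exact .sum _ fun i => ih i _
  | cnd v _ _ ih₁ ih₂ => exact .cnd _ (ih₁ σ) (ih₂ σ)
  | loc p _ ih => exact .loc p (ih σ)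
  | par _ _ ih₁ ih₂ => exact .par (ih₁ σ) (ih₂ σ)

/-- Congruence is closed under substitution for process variables. The substitution may add
participants, so the law for inactive participants has to hold without its side condition
(`loc_nil_par`). -/
lemma Cong.psub {M N : Tm} (h : M ≈ₛ N) (τ : Var → Tm) : M.psub τ ≈ₛ N.psub τ := by
  induction h generalizing τ with
  | refl => exact .refl _
  | symm _ ih => exact .symm (ih τ)
  | trans _ _ ih₁ ih₂ => exact .trans (ih₁ τ) (ih₂ τ)
  | unfold P _ =>
    rw [psub_unfold, ← unfold_psub_liftT]
    exact .unfold (P.psub (liftT τ)) rfl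
  | perm n π P e => exact .perm n π (fun i => (P i).psub _) e
  | inactive p M h => exact .loc_nil_par p _
  | comm => exact .comm _ _
  | assoc => exact .assoc _ _ _
  | mu _ ih => exact .mu (ih _)
  | sum π _ ih => exact .sum _ fun i => ih i _
  | cnd v _ _ ih₁ ih₂ => exact .cnd _ (ih₁ τ) (ih₂ τ)
  | loc p _ ih => exact .loc p (ih τ)
  | par _ _ ih₁ ih₂ => exact .par (ih₁ τ) (ih₂ τ)

lemma pren_eq_psub (ρ : Var → Var) (P : Tm) : P.pren ρ = P.psub fun X => pvar (ρ X) := by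
  conv_lhs => rw [← psub_pvar P, pren_psub]
  rfl

lemma Cong.psub_congr {τ τ' : Var → Tm} (h : ∀ X, τ X ≈ₛ τ' X) (P : Tm) :
    P.psub τ ≈ₛ P.psub τ' := by
  induction P generalizing τ τ' with
  | nil | ok => exact .refl _
  | pvar X => exact h X
  | mu P ih =>
    refine .mu (ih fun X => ?_)
    rcases X with X | _ | k
    · simp only [liftT, pren_eq_psub]; exact (h _).psub _
    · exact .refl _
    · simp only [liftT, pren_eq_psub]; exact (h _).psub _
  | sum n π P ih => exact .sum π fun i => ih i fun X => (h X).vsub _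
  | cnd v P Q hP hQ => exact .cnd v (hP h) (hQ h)
  | loc p P hP => exact .loc p (hP h)
  | par P Q hP hQ => exact .par (hP h) (hQ h)

/-- Atoms of a parallel composition: equality up to congruence of their immediate subterms and up to
the order of summands. -/
inductive AtomEq : Tm → Tm → Prop where
  | nil : AtomEq nil nil
  | ok : AtomEq ok ok
  | sum {n} {π π' : Fin n → Pre} {P P' : Fin n → Tm} (e : Equiv.Perm (Fin n)) :
      (∀ i, π' i = π (e i)) → (∀ i, P (e i) ≈ₛ P' i) → AtomEq (sum n π P) (sum n π' P')
  | cnd {v P P' Q Q'} : P ≈ₛ P' → Q ≈ₛ Q' → AtomEq (cnd v P Q) (cnd v P' Q')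
  | loc {p P P'} : P ≈ₛ P' → AtomEq (loc p P) (loc p P')

lemma AtomEq.symm {a b : Tm} (h : AtomEq a b) : AtomEq b a := by
  cases h with
  | nil => exact .nil
  | ok => exact .ok
  | sum e h₁ h₂ =>
    exact .sum e.symm (fun i => by simp [h₁]) fun i => by simpa using (h₂ (e.symm i)).symm
  | cnd h₁ h₂ => exact .cnd h₁.symm h₂.symm
  | loc h => exact .loc h.symm

lemma AtomEq.trans {a b c : Tm} (h : AtomEq a b) (h' : AtomEq b c) : AtomEq a c := by
  cases h with
  | nil => exact h'
  | ok => exact h'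
  | sum e h₁ h₂ =>
    cases h' with
    | sum e' h₁' h₂' =>
      exact .sum (e'.trans e) (fun i => by simp [h₁, h₁']) fun i => (h₂ (e' i)).trans (h₂' i)
  | cnd h₁ h₂ =>
    cases h' with
    | cnd h₁' h₂' => exact .cnd (h₁.trans h₁') (h₂.trans h₂')
  | loc h =>
    cases h' with
    | loc h' => exact .loc (h.trans h')

lemma AtomEq.cong {a b : Tm} (h : AtomEq a b) : a ≈ₛ b := by
  cases h with
  | nil => exact .refl _
  | ok => exact .refl _
  | @sum n π π' P P' e h₁ h₂ =>
    obtain rfl : π' = π ∘ e := funext h₁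
    exact (Cong.perm n π P e).trans (.sum _ h₂)
  | cnd h₁ h₂ => exact .cnd _ h₁ h₂
  | loc h => exact .loc _ h

lemma AtomEq.left_iff {a b c : Tm} (h : AtomEq a b) : AtomEq a c ↔ AtomEq b c :=
  ⟨h.symm.trans, h.trans⟩

end MC
end SessionCalculi

namespace SessionCalculi
namespace MC
open Tm

/-! ### Multiparty sessions: inversion of structural congruence -/

/-- Observations of a term: `d a Y` says that the atom `a` can be split off with the remainder `Y`.
-/
abbrev Obs := Tm → Tm → Prop

/-- The least fixed point of a monotone operator, as the intersection of its pre-fixed points. -/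
def lfp (F : Obs → Obs) : Obs := fun a Y => ∀ e : Obs, (∀ b Z, F e b Z → e b Z) → e a Y

lemma lfp_eq {F : Obs → Obs}
    (hF : ∀ d e : Obs, (∀ a Y, d a Y → e a Y) → ∀ a Y, F d a Y → F e a Y) : F (lfp F) = lfp F := by
  have h : ∀ a Y, F (lfp F) a Y → lfp F a Y := fun a Y ha e he =>
    he a Y (hF _ _ (fun b Z hb => hb e he) a Y ha)
  funext a Y
  exact propext ⟨h a Y, fun ha => ha _ (hF _ _ h)⟩

/-- The decompositions of `P.psub τ` into an atom and a remainder, where those of the term for the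
variable `X` are given by `d X`. A recursion is interpreted by a least fixed point, so that
unfolding does not change the interpretation. Inactive participants have no atoms. -/
def den : Tm → (Var → Tm) → (Var → Obs) → Obs
  | pvar X, _, d => fun a Y => ∃ Y', d X a Y' ∧ Y ≈ₛ Y'
  | mu P, τ, d => lfp fun e => den P (cons ((mu P).psub τ) τ) (cons e d)
  | par P Q, τ, d => fun a Y =>
      (∃ P', den P τ d a P' ∧ Y ≈ₛ par P' (Q.psub τ)) ∨
      (∃ Q', den Q τ d a Q' ∧ Y ≈ₛ par (P.psub τ) Q')
  | loc p P, τ, _ => fun a Y => AtomEq (loc p (P.psub τ)) a ∧ ¬ P.psub τ ≈ₛ nil ∧ Y ≈ₛ unit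
  | nil, _, _ => fun a Y => AtomEq nil a ∧ Y ≈ₛ unit
  | ok, _, _ => fun a Y => AtomEq ok a ∧ Y ≈ₛ unit
  | sum n π P, τ, _ => fun a Y => AtomEq ((sum n π P).psub τ) a ∧ Y ≈ₛ unit
  | cnd v P Q, τ, _ => fun a Y => AtomEq ((cnd v P Q).psub τ) a ∧ Y ≈ₛ unit

lemma cons_rel {α : Type*} {r : α → α → Prop} {a b : α} {τ τ' : Var → α} (h : r a b)
    (hτ : ∀ X, r (τ X) (τ' X)) : ∀ X, r (cons a τ X) (cons b τ' X) := by
  rintro (X | _ | k)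
  · exact hτ _
  · exact h
  · exact hτ _

lemma cons_liftP {α : Type*} (a : α) (τ : Var → α) (ρ : Var → Var) :
    cons a τ ∘ liftP ρ = cons a (τ ∘ ρ) := by
  funext X
  rcases X with X | _ | k
  · simp only [liftP, cons, Function.comp]; cases ρ (.fr X) <;> rfl
  · rfl
  · simp only [liftP, cons, Function.comp]; cases ρ (.bd k) <;> rfl

lemma cons_shiftP {α : Type*} (a : α) (τ : Var → α) : cons a τ ∘ shiftP = τ := by
  funext X
  cases X <;> rfl

lemma den_mono {P : Tm} {τ : Var → Tm} {d d' : Var → Obs}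
    (h : ∀ X a Y, d X a Y → d' X a Y) : ∀ a Y, den P τ d a Y → den P τ d' a Y := by
  induction P generalizing τ d d' with
  | pvar X => exact fun a Y ⟨Y', hd, hY⟩ => ⟨Y', h _ _ _ hd, hY⟩
  | mu P ih =>
    exact fun a Y ha e he => ha e fun b Z hb => he b Z
      (ih (cons_rel (r := fun d d' : Obs => ∀ a Y, d a Y → d' a Y) (fun _ _ => id) h) b Z hb)
  | par P Q hP hQ =>
    exact fun a Y => Or.imp (fun ⟨P', h', hY⟩ => ⟨P', hP h _ _ h', hY⟩)
      fun ⟨Q', h', hY⟩ => ⟨Q', hQ h _ _ h', hY⟩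
  | _ => exact fun _ _ => id

lemma den_mu (P : Tm) (τ : Var → Tm) (d : Var → Obs) :
    den P (cons ((mu P).psub τ) τ) (cons (den (mu P) τ d) d) = den (mu P) τ d :=
  lfp_eq fun _ _ h => den_mono
    (cons_rel (r := fun d d' : Obs => ∀ a Y, d a Y → d' a Y) h fun _ _ _ => id)

/-- Observations are closed under congruence of the remainder. -/
lemma den_closed {P : Tm} {τ : Var → Tm} {d : Var → Obs} {a Y Y' : Tm} (h : den P τ d a Y)
    (hY : Y ≈ₛ Y') : den P τ d a Y' := by
  induction P generalizing τ d with
  | pvar X => exact let ⟨Z, hd, hZ⟩ := h; ⟨Z, hd, hY.symm.trans hZ⟩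
  | mu P ih => rw [← den_mu] at h ⊢; exact ih h
  | par P Q _ _ =>
    exact h.imp (fun ⟨P', h', hZ⟩ => ⟨P', h', hY.symm.trans hZ⟩)
      fun ⟨Q', h', hZ⟩ => ⟨Q', h', hY.symm.trans hZ⟩
  | loc p P _ => exact ⟨h.1, h.2.1, hY.symm.trans h.2.2⟩
  | nil | ok | sum _ _ _ _ | cnd _ _ _ _ _ => exact ⟨h.1, hY.symm.trans h.2⟩

/-- Equality of observations up to congruence of the remainders. -/
def Obs.Equiv (d d' : Obs) : Prop :=
  ∀ a Y, (∃ Y', d a Y' ∧ Y ≈ₛ Y') ↔ ∃ Y', d' a Y' ∧ Y ≈ₛ Y'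

lemma Obs.Equiv.refl (d : Obs) : d.Equiv d := fun _ _ => Iff.rfl

lemma den_pvar_equiv (X : Var) (τ : Var → Tm) (d : Var → Obs) : (den (pvar X) τ d).Equiv (d X) :=
  fun _ _ => ⟨fun ⟨_, ⟨Z, h, hZ⟩, hY⟩ => ⟨Z, h, hY.trans hZ⟩,
    fun ⟨Z, h, hY⟩ => ⟨Z, ⟨Z, h, .refl _⟩, hY⟩⟩

/-- The interpretation depends on the observations of variables only up to congruence. -/
lemma den_obs {P : Tm} {τ : Var → Tm} {d d' : Var → Obs} (h : ∀ X, (d X).Equiv (d' X)) :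
    den P τ d = den P τ d' := by
  induction P generalizing τ d d' with
  | pvar X => exact funext fun a => funext fun Y => propext (h X a Y)
  | mu P ih =>
    simp only [den]
    congr 1
    funext e
    exact ih (cons_rel (r := Obs.Equiv) (.refl e) h)
  | par P Q hP hQ => simp only [den, hP h, hQ h]
  | _ => rfl

lemma den_pren (ρ : Var → Var) (P : Tm) (τ : Var → Tm) (d : Var → Obs) :
    den (P.pren ρ) τ d = den P (τ ∘ ρ) (d ∘ ρ) := by
  induction P generalizing ρ τ d with
  | mu P ih =>
    have h : (mu (P.pren (liftP ρ))).psub τ = (mu P).psub (τ ∘ ρ) := psub_pren τ ρ (mu P)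
    simp only [pren, den, ih, cons_liftP, h]
  | sum n π P _ =>
    have h : (sum n π fun i => (P i).pren ρ).psub τ = (sum n π P).psub (τ ∘ ρ) :=
      psub_pren τ ρ (sum n π P)
    simp only [pren, den, h]
  | cnd v P Q _ _ =>
    have h : (cnd v (P.pren ρ) (Q.pren ρ)).psub τ = (cnd v P Q).psub (τ ∘ ρ) :=
      psub_pren τ ρ (cnd v P Q)
    simp only [pren, den, h]
  | _ => simp_all [pren, den, psub_pren]

/-- The interpretation is compositional: substituted terms only matter through their observations.
-/
lemma den_psub (τ' : Var → Tm) (P : Tm) (τ : Var → Tm) (d : Var → Obs) :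
    den (P.psub τ') τ d = den P (fun X => (τ' X).psub τ) fun X => den (τ' X) τ d := by
  induction P generalizing τ' τ d with
  | pvar X =>
    funext a Y
    exact propext ⟨fun h => ⟨Y, h, .refl _⟩, fun ⟨Y', h, hY⟩ => den_closed h hY.symm⟩
  | mu P ih =>
    have h : (mu (P.psub (liftT τ'))).psub τ = (mu P).psub fun X => (τ' X).psub τ :=
      psub_psub τ' τ (mu P)
    simp only [psub, den, ih] at h ⊢
    rw [h, psub_cons_liftT]
    congr 1
    funext e
    refine den_obs ?_
    rintro (X | _ | k)
    · simp only [liftT, den_pren, cons_shiftP, cons]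
      exact .refl _
    · exact den_pvar_equiv _ _ _
    · simp only [liftT, den_pren, cons_shiftP, cons]
      exact .refl _
  | sum n π P _ =>
    have h := psub_psub τ' τ (sum n π P)
    simp only [psub] at h
    simp only [psub, den, h]
  | cnd v P Q _ _ =>
    have h := psub_psub τ' τ (cnd v P Q)
    simp only [psub] at h
    simp only [psub, den, h]
  | _ => simp_all [psub, den, psub_psub]

lemma AtomEq.psub_congr {τ τ' : Var → Tm} (h : ∀ X, τ X ≈ₛ τ' X) {n : ℕ} (π : Fin n → Pre)
    (P : Fin n → Tm) : AtomEq ((Tm.sum n π P).psub τ) ((Tm.sum n π P).psub τ') :=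
  .sum (.refl _) (fun _ => rfl) fun _ => .psub_congr (fun X => (h X).vsub _) _

/-- The interpretation depends on the terms for the variables only up to congruence. -/
lemma den_env {P : Tm} {τ τ' : Var → Tm} {d : Var → Obs} (h : ∀ X, τ X ≈ₛ τ' X) :
    den P τ d = den P τ' d := by
  have hc := fun P => Cong.psub_congr h P
  induction P generalizing τ τ' d with
  | pvar X | nil | ok => rfl
  | mu P ih =>
    simp only [den]
    congr 1
    funext e
    have h' := cons_rel (r := fun P Q => P ≈ₛ Q) (hc (mu P)) h
    exact ih h' fun P => .psub_congr h' P
  | par P Q hP hQ =>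
    have h1 : ∀ Y P', (Y ≈ₛ par P' (Q.psub τ)) ↔ (Y ≈ₛ par P' (Q.psub τ')) := fun Y P' =>
      ⟨fun h => h.trans (.par (.refl _) (hc Q)), fun h => h.trans (.par (.refl _) (hc Q).symm)⟩
    have h2 : ∀ Y Q', (Y ≈ₛ par (P.psub τ) Q') ↔ (Y ≈ₛ par (P.psub τ') Q') := fun Y Q' =>
      ⟨fun h => h.trans (.par (hc P) (.refl _)), fun h => h.trans (.par (hc P).symm (.refl _))⟩
    simp only [den, hP h hc, hQ h hc, h1, h2]
  | loc p P _ =>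
    have h1 : (P.psub τ ≈ₛ nil) ↔ (P.psub τ' ≈ₛ nil) := ⟨(hc P).symm.trans, (hc P).trans⟩
    simp only [den, (AtomEq.loc (hc P)).left_iff, h1]
  | sum n π P _ => simp only [den, (AtomEq.psub_congr h π P).left_iff]
  | cnd v P Q _ _ =>
    have h1 : AtomEq ((cnd v P Q).psub τ) ((cnd v P Q).psub τ') := .cnd (hc P) (hc Q)
    simp only [den, h1.left_iff]

/-- The interpretation is invariant under structural congruence. -/
lemma den_cong {P Q : Tm} (h : P ≈ₛ Q) (τ : Var → Tm) (d : Var → Obs) :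
    den P τ d = den Q τ d := by
  induction h generalizing τ d with
  | refl => rfl
  | symm _ ih => exact (ih τ d).symm
  | trans _ _ ih₁ ih₂ => exact (ih₁ τ d).trans (ih₂ τ d)
  | unfold P _ =>
    rw [unfold_eq, den_psub, ← den_mu P τ d]
    symm
    have h1 : (fun X => (cons (mu P) pvar X).psub τ) = cons ((mu P).psub τ) τ := by
      funext X
      rcases X with X | _ | k <;> rfl
    rw [h1]
    refine den_obs ?_
    rintro (X | _ | k)
    · exact den_pvar_equiv _ _ _
    · exact .refl _
    · exact den_pvar_equiv _ _ _
  | perm n π P e =>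
    have h1 : AtomEq ((sum n π P).psub τ) ((sum n (π ∘ e) (P ∘ e)).psub τ) :=
      .sum e (fun _ => rfl) fun _ => .refl _
    simp only [den, h1.left_iff]
  | inactive p M _ =>
    funext a Y
    refine propext ⟨?_, fun h => .inr ⟨Y, h, (Cong.loc_nil_par p Y).symm⟩⟩
    rintro (⟨P', ⟨-, h, -⟩, -⟩ | ⟨Q', h, hY⟩)
    · exact (h (.refl _)).elim
    · exact den_closed h (hY.trans (.loc_nil_par p Q')).symm
  | comm M N =>
    funext a Y
    refine propext (or_comm.trans (or_congr ?_ ?_))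
    · exact exists_congr fun Z => and_congr_right fun _ =>
        ⟨fun h => h.trans (.comm _ _), fun h => h.trans (.comm _ _)⟩
    · exact exists_congr fun Z => and_congr_right fun _ =>
        ⟨fun h => h.trans (.comm _ _), fun h => h.trans (.comm _ _)⟩
  | assoc M N K =>
    funext a Y
    refine propext ⟨?_, ?_⟩
    · rintro (⟨_, ⟨M', h, hZ⟩ | ⟨N', h, hZ⟩, hY⟩ | ⟨K', h, hY⟩)
      · exact .inl ⟨M', h, hY.trans ((Cong.par hZ (.refl _)).trans (.assoc _ _ _))⟩
      · exact .inr ⟨_, .inl ⟨N', h, .refl _⟩, hY.trans ((Cong.par hZ (.refl _)).trans (.assoc _ _ _))⟩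
      · exact .inr ⟨_, .inr ⟨K', h, .refl _⟩, hY.trans (.assoc _ _ _)⟩
    · rintro (⟨M', h, hY⟩ | ⟨_, ⟨N', h, hZ⟩ | ⟨K', h, hZ⟩, hY⟩)
      · exact .inl ⟨_, .inl ⟨M', h, .refl _⟩, hY.trans (.symm (.assoc _ _ _))⟩
      · exact .inl ⟨_, .inr ⟨N', h, .refl _⟩,
          hY.trans ((Cong.par (.refl _) hZ).trans (.symm (.assoc _ _ _)))⟩
      · exact .inr ⟨K', h, hY.trans ((Cong.par (.refl _) hZ).trans (.symm (.assoc _ _ _)))⟩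
  | @mu P P' h ih =>
    simp only [den]
    congr 1
    funext e
    rw [ih]
    exact den_env (cons_rel (r := fun P Q => P ≈ₛ Q) ((Cong.mu h).psub τ) fun _ => .refl _)
  | @sum n π P P' h _ =>
    have h1 : AtomEq ((sum n π P).psub τ) ((sum n π P').psub τ) :=
      .sum (.refl _) (fun _ => rfl) fun i => (h i).psub _
    simp only [den, h1.left_iff]
  | @cnd v P P' Q Q' h h' _ _ =>
    have h1 : AtomEq ((cnd v P Q).psub τ) ((cnd v P' Q').psub τ) := .cnd (h.psub τ) (h'.psub τ)
    simp only [den, h1.left_iff]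
  | @loc p P P' h _ =>
    have h1 : (P.psub τ ≈ₛ nil) ↔ (P'.psub τ ≈ₛ nil) :=
      ⟨(h.psub τ).symm.trans, (h.psub τ).trans⟩
    simp only [den, (AtomEq.loc (h.psub τ)).left_iff, h1]
  | @par M M' N N' hM hN ihM ihN =>
    have h1 : ∀ Y P', (Y ≈ₛ par P' (N.psub τ)) ↔ (Y ≈ₛ par P' (N'.psub τ)) := fun Y P' =>
      ⟨fun h => h.trans (.par (.refl _) (hN.psub τ)),
        fun h => h.trans (.par (.refl _) (hN.psub τ).symm)⟩
    have h2 : ∀ Y Q', (Y ≈ₛ par (M.psub τ) Q') ↔ (Y ≈ₛ par (M'.psub τ) Q') := fun Y Q' =>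
      ⟨fun h => h.trans (.par (hM.psub τ) (.refl _)),
        fun h => h.trans (.par (hM.psub τ).symm (.refl _))⟩
    simp only [den, ihM, ihN, h1, h2]

/-- Observations are decompositions. -/
lemma cong_of_den {P : Tm} {τ : Var → Tm} {d : Var → Obs}
    (hd : ∀ X a Y, d X a Y → τ X ≈ₛ par a Y) {a Y : Tm} (h : den P τ d a Y) :
    P.psub τ ≈ₛ par a Y := by
  have base : ∀ {b Z}, AtomEq b a → Z ≈ₛ unit → b ≈ₛ par a Z := fun hb hZ =>
    hb.cong.trans ((Cong.par_unit a).symm.trans (.par (.refl _) hZ.symm))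
  induction P generalizing τ d a Y with
  | pvar X => exact let ⟨Y', h', hY⟩ := h; (hd _ _ _ h').trans (.par (.refl _) hY.symm)
  | mu P ih =>
    refine h (fun a Y => (mu P).psub τ ≈ₛ par a Y) fun b Z hb => ?_
    have h1 := ih (τ := cons ((mu P).psub τ) τ) (a := b) (Y := Z) ?_ hb (fun h h' =>
      h.cong.trans ((Cong.par_unit b).symm.trans (.par (.refl _) h'.symm)))
    · rw [← unfold_psub_liftT] at h1
      exact (Cong.unfold (P.psub (liftT τ)) rfl).trans h1
    · rintro (X | _ | k) a Y ha
      · exact hd _ _ _ ha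
      · exact ha
      · exact hd _ _ _ ha
  | par P Q hP hQ =>
    rcases h with ⟨P', h, hY⟩ | ⟨Q', h, hY⟩
    · exact (Cong.par (hP hd h base) (.refl _)).trans
        ((Cong.assoc _ _ _).trans (.par (.refl _) hY.symm))
    · exact (Cong.par (.refl _) (hQ hd h base)).trans
        ((Cong.left_comm _ _ _).trans (.par (.refl _) hY.symm))
  | loc p P _ => exact base h.1 h.2.2
  | nil | ok | sum _ _ _ _ | cnd _ _ _ _ _ => exact base h.1 h.2

/-- The decompositions of a term without free process variables. -/
def Exhibits (P a Y : Tm) : Prop := den P pvar (fun _ _ _ => False) a Y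

lemma Exhibits.cong {P a Y : Tm} (h : Exhibits P a Y) : P ≈ₛ par a Y := by
  simpa using cong_of_den (fun _ _ _ => False.elim) h

lemma exhibits_congr {P Q a Y : Tm} (h : P ≈ₛ Q) : Exhibits P a Y ↔ Exhibits Q a Y := by
  rw [Exhibits, Exhibits, den_cong h]

/-- The process is a choice or a conditional, so that it takes part in reductions when it is
located. -/
inductive Active : Tm → Prop where
  | sum (n π P) : Active (sum n π P)
  | cnd (v P Q) : Active (cnd v P Q)

lemma Active.exhibits {a : Tm} (h : Active a) : Exhibits a a unit := by
  cases h with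
  | sum n π P =>
    refine ⟨?_, .refl _⟩
    rw [psub_pvar]
    exact .sum (.refl _) (fun _ => rfl) fun _ => .refl _
  | cnd v P Q =>
    refine ⟨?_, .refl _⟩
    rw [psub_pvar]
    exact .cnd (.refl _) (.refl _)

/-- An active process is not inactive. -/
lemma Active.not_cong_nil {a : Tm} (h : Active a) : ¬ a ≈ₛ nil := fun hn => by
  obtain ⟨h', -⟩ := (exhibits_congr hn).1 h.exhibits
  cases h <;> cases h'

lemma Active.atomEq {a b : Tm} (ha : Active a) (hb : Active b) (h : a ≈ₛ b) : AtomEq a b := by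
  have h' := (exhibits_congr h).1 ha.exhibits
  cases hb with
  | sum n π P => obtain ⟨h', -⟩ := h'; rw [psub_pvar] at h'; exact h'.symm
  | cnd v P Q => obtain ⟨h', -⟩ := h'; rw [psub_pvar] at h'; exact h'.symm

lemma exhibits_loc_iff {p : ℕ} {P a Y : Tm} :
    Exhibits (loc p P) a Y ↔ AtomEq (loc p P) a ∧ ¬ P ≈ₛ nil ∧ Y ≈ₛ unit := by
  simp only [Exhibits, den, psub_pvar]

lemma exhibits_par_iff {P Q a Y : Tm} :
    Exhibits (par P Q) a Y ↔ (∃ P', Exhibits P a P' ∧ Y ≈ₛ par P' Q) ∨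
      ∃ Q', Exhibits Q a Q' ∧ Y ≈ₛ par P Q' := by
  simp only [Exhibits, den, psub_pvar]

lemma exhibits_of_cong {p : ℕ} {M S Y : Tm} (hS : Active S) (h : M ≈ₛ par (loc p S) Y) :
    Exhibits M (loc p S) Y := by
  rw [exhibits_congr h, exhibits_par_iff]
  exact .inl ⟨unit, exhibits_loc_iff.2 ⟨.loc (.refl _), hS.not_cong_nil, .refl _⟩,
    (Cong.unit_par Y).symm⟩

/-- A located process of a parallel composition belongs to one of the two components. -/
lemma par_decomp {p : ℕ} {M N S Y : Tm} (hS : Active S) (h : par M N ≈ₛ par (loc p S) Y) :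
    (∃ M', M ≈ₛ par (loc p S) M' ∧ Y ≈ₛ par M' N) ∨ ∃ N', N ≈ₛ par (loc p S) N' ∧ Y ≈ₛ par M N' :=
  (exhibits_par_iff.1 (exhibits_of_cong hS h)).imp (fun ⟨M', h, hY⟩ => ⟨M', h.cong, hY⟩)
    fun ⟨N', h, hY⟩ => ⟨N', h.cong, hY⟩

/-- A single participant only splits trivially. -/
lemma loc_decomp {p q : ℕ} {P S Y : Tm} (hS : Active S) (h : loc q P ≈ₛ par (loc p S) Y) :
    q = p ∧ P ≈ₛ S ∧ Y ≈ₛ unit := by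
  obtain ⟨h, -, hY⟩ := exhibits_loc_iff.1 (exhibits_of_cong hS h)
  cases h with
  | loc h => exact ⟨rfl, h, hY⟩

lemma unit_decomp {p : ℕ} {S Y : Tm} (hS : Active S) (h : unit ≈ₛ par (loc p S) Y) : False :=
  (exhibits_loc_iff.1 (exhibits_of_cong hS h)).2.1 (.refl _)

end MC
end SessionCalculi

namespace SessionCalculi
namespace MC
open Tm

/-! ### Multiparty sessions: invariants of structural congruence -/

namespace Tm

@[simp] lemma hasSuccess_vsub {σ : Sub} {P : Tm} : (P.vsub σ).HasSuccess ↔ P.HasSuccess := by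
  induction P generalizing σ <;> simp_all [vsub, HasSuccess]

@[simp] lemma hasSuccess_pren {ρ : Var → Var} {P : Tm} :
    (P.pren ρ).HasSuccess ↔ P.HasSuccess := by
  induction P generalizing ρ <;> simp_all [pren, HasSuccess]

lemma HasSuccess.psub {τ : Var → Tm} {P : Tm} (h : P.HasSuccess) : (P.psub τ).HasSuccess := by
  induction P generalizing τ with
  | ok => trivial
  | mu P ih | loc p P ih => exact ih h
  | par P Q hP hQ => exact h.imp (fun h => hP h) (fun h => hQ h)
  | _ => exact h.elim

lemma HasSuccess.of_psub {τ : Var → Tm} {P : Tm} (h : (P.psub τ).HasSuccess) :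
    P.HasSuccess ∨ ∃ X, (τ X).HasSuccess := by
  induction P generalizing τ with
  | ok => exact .inl trivial
  | pvar X => exact .inr ⟨X, h⟩
  | mu P ih =>
    refine (ih h).imp_right ?_
    rintro ⟨X | _ | k, hX⟩
    · exact ⟨_, hasSuccess_pren.1 hX⟩
    · exact hX.elim
    · exact ⟨_, hasSuccess_pren.1 hX⟩
  | loc p P ih => exact ih h
  | par P Q hP hQ =>
    rcases h with h | h
    · exact (hP h).imp_left .inl
    · exact (hQ h).imp_left .inr
  | _ => exact h.elim

/-- Every choice addresses a single participant. -/
abbrev AllDirected (M : Tm) : Prop := M.AllSums Directed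

lemma allDirected_vsub {σ : Sub} {P : Tm} : (P.vsub σ).AllDirected ↔ P.AllDirected := by
  induction P generalizing σ <;> simp_all [vsub, AllDirected, AllSums, Directed]

lemma allDirected_pren {ρ : Var → Var} {P : Tm} : (P.pren ρ).AllDirected ↔ P.AllDirected := by
  induction P generalizing ρ <;> simp_all [pren, AllDirected, AllSums]

lemma AllDirected.psub {τ : Var → Tm} {P : Tm} (h : P.AllDirected)
    (hτ : ∀ X, (τ X).AllDirected) : (P.psub τ).AllDirected := by
  induction P generalizing τ with
  | nil | ok => trivial
  | pvar X => exact hτ X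
  | mu P ih =>
    refine ih h ?_
    rintro (X | _ | k)
    · exact allDirected_pren.2 (hτ _)
    · trivial
    · exact allDirected_pren.2 (hτ _)
  | sum n π P ih => exact ⟨h.1, fun i => ih i (h.2 i) fun X => allDirected_vsub.2 (hτ X)⟩
  | cnd v P Q hP hQ | par P Q hP hQ => exact ⟨hP h.1 hτ, hQ h.2 hτ⟩
  | loc p P ih => exact ih h hτ

lemma AllDirected.of_psub {τ : Var → Tm} {P : Tm} (h : (P.psub τ).AllDirected) :
    P.AllDirected := by
  induction P generalizing τ with
  | nil | ok | pvar X => trivial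
  | mu P ih | loc p P ih => exact ih h
  | sum n π P ih => exact ⟨h.1, fun i => ih i (h.2 i)⟩
  | cnd v P Q hP hQ | par P Q hP hQ => exact ⟨hP h.1, hQ h.2⟩

end Tm

lemma Cong.hasSuccess_iff {M N : Tm} (h : M ≈ₛ N) : M.HasSuccess ↔ N.HasSuccess := by
  induction h with
  | symm _ ih => exact ih.symm
  | trans _ _ ih₁ ih₂ => exact ih₁.trans ih₂
  | unfold P _ =>
    refine ⟨fun h => HasSuccess.psub (P := P) h, fun h => ?_⟩
    rw [unfold_eq] at h
    rcases h.of_psub with h | ⟨X | _ | k, h⟩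
    · exact h
    · exact h.elim
    · exact h
    · exact h.elim
  | inactive p M _ => simp only [HasSuccess, false_or]
  | comm => exact or_comm
  | assoc => exact or_assoc
  | mu _ ih | loc p _ ih => exact ih
  | par _ _ ih₁ ih₂ => exact or_congr ih₁ ih₂
  | _ => exact Iff.rfl

lemma Cong.allDirected_iff {M N : Tm} (h : M ≈ₛ N) : M.AllDirected ↔ N.AllDirected := by
  induction h with
  | refl => exact Iff.rfl
  | symm _ ih => exact ih.symm
  | trans _ _ ih₁ ih₂ => exact ih₁.trans ih₂
  | unfold P _ =>
    rw [unfold_eq]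
    refine ⟨fun h => AllDirected.psub h ?_, fun h => h.of_psub⟩
    rintro (X | _ | k)
    · trivial
    · exact h
    · trivial
  | perm n π P e =>
    refine and_congr ?_ (e.surjective.forall (p := fun i => (P i).AllDirected))
    exact e.surjective.forall₂ (p := fun i j => (π i).peer = (π j).peer)
  | inactive p M _ => simp only [AllSums, true_and]
  | comm => exact and_comm
  | assoc => exact and_assoc
  | mu _ ih | loc p _ ih => exact ih
  | sum π _ ih => exact and_congr_right fun _ => forall_congr' ih
  | cnd v _ _ ih₁ ih₂ | par _ _ ih₁ ih₂ => exact and_congr ih₁ ih₂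

/-! ### Multiparty sessions: inversion of reduction -/

/-- The outcome of a conditional. -/
inductive Chooses (P Q : Tm) : Val → Tm → Prop where
  | tt : Chooses P Q .tt P
  | ff : Chooses P Q .ff Q

/-- Reduction in terms of the redex and the rest of the session, with congruence only at the
outside. -/
inductive Red (M M' : Tm) : Prop where
  | com (p q ℓ : ℕ) (v : Val) {n m : ℕ} (π : Fin n → Pre) (P : Fin n → Tm) (π' : Fin m → Pre)
      (Q : Fin m → Tm) (i : Fin n) (j : Fin m) (Y : Tm) :
      π i = .inp q ℓ → π' j = .out p ℓ v →
      M ≈ₛ par (loc p (sum n π P)) (par (loc q (sum m π' Q)) Y) →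
      M' ≈ₛ par (loc p ((P i).vsub (Sub.inst v))) (par (loc q (Q j)) Y) → Red M M'
  | cnd (p : ℕ) (v : Val) (P Q R Y : Tm) : Chooses P Q v R →
      M ≈ₛ par (loc p (cnd v P Q)) Y → M' ≈ₛ par (loc p R) Y → Red M M'

lemma Red.congr {M₁ M M' M₁' : Tm} (h : Red M M') (h₁ : M₁ ≈ₛ M) (h₂ : M' ≈ₛ M₁') :
    Red M₁ M₁' := by
  cases h with
  | com p q ℓ v π P π' Q i j Y hi hj h h' =>
    exact .com p q ℓ v π P π' Q i j Y hi hj (h₁.trans h) (h₂.symm.trans h')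
  | cnd p v P Q R Y hR h h' => exact .cnd p v P Q R Y hR (h₁.trans h) (h₂.symm.trans h')

lemma Red.step {M M' : Tm} (h : Red M M') : Step M M' := by
  cases h with
  | com p q ℓ v π P π' Q i j Y hi hj h h' =>
    exact .cong h (.com p q ℓ v π P π' Q i j Y hi hj) h'.symm
  | cnd p v P Q R Y hR h h' =>
    cases hR with
    | tt => exact .cong h (.ifT _ _ _ _) h'.symm
    | ff => exact .cong h (.ifF _ _ _ _) h'.symm

lemma Step.red {M M' : Tm} (h : Step M M') : Red M M' := by
  induction h with
  | com p q ℓ v π P π' Q i j Y hi hj =>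
    exact .com p q ℓ v π P π' Q i j Y hi hj (.refl _) (.refl _)
  | ifT p P Q M => exact .cnd p .tt P Q P M .tt (.refl _) (.refl _)
  | ifF p P Q M => exact .cnd p .ff P Q Q M .ff (.refl _) (.refl _)
  | cong h₁ _ h₂ ih => exact ih.congr h₁ h₂

lemma Step.par {M M' : Tm} (h : Step M M') (N : Tm) : Step (par M N) (par M' N) := by
  apply Red.step
  cases h.red with
  | com p q ℓ v π P π' Q i j Y hi hj h h' =>
    have hc : ∀ {K A B : Tm}, K ≈ₛ Tm.par A (Tm.par B Y) →
        Tm.par K N ≈ₛ Tm.par A (Tm.par B (Tm.par Y N)) := fun h =>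
      (Cong.par h (.refl N)).trans ((Cong.assoc _ _ _).trans (.par (.refl _) (.assoc _ _ _)))
    exact .com p q ℓ v π P π' Q i j _ hi hj (hc h) (hc h')
  | cnd p v P Q R Y hR h h' =>
    have hc : ∀ {K A : Tm}, K ≈ₛ Tm.par A Y → Tm.par K N ≈ₛ Tm.par A (Tm.par Y N) := fun h =>
      (Cong.par h (.refl N)).trans (.assoc _ _ _)
    exact .cnd p v P Q R _ hR (hc h) (hc h')

lemma Step.hasSuccess {M M' : Tm} (h : Step M M') (hM : M.HasSuccess) : M'.HasSuccess := by
  cases h.red with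
  | com p q ℓ v π P π' Q i j Y hi hj h h' =>
    refine h'.hasSuccess_iff.2 (.inr (.inr ?_))
    rcases h.hasSuccess_iff.1 hM with h | h | h
    · exact h.elim
    · exact h.elim
    · exact h
  | cnd p v P Q R Y hR h h' =>
    refine h'.hasSuccess_iff.2 (.inr ?_)
    rcases h.hasSuccess_iff.1 hM with h | h
    · exact h.elim
    · exact h

lemma Step.allDirected {M M' : Tm} (h : Step M M') (hM : M.AllDirected) : M'.AllDirected := by
  cases h.red with
  | com p q ℓ v π P π' Q i j Y hi hj h h' =>
    obtain ⟨hP, hQ, hY⟩ := h.allDirected_iff.1 hM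
    exact h'.allDirected_iff.2 ⟨allDirected_vsub.2 (hP.2 i), hQ.2 j, hY⟩
  | cnd p v P Q R Y hR h h' =>
    obtain ⟨⟨hP, hQ⟩, hY⟩ := h.allDirected_iff.1 hM
    refine h'.allDirected_iff.2 ⟨?_, hY⟩
    cases hR
    · exact hP
    · exact hQ

/-! ### Multiparty sessions: participants are pairwise different -/

/-- No choice or conditional is located at `p`. -/
def Free (p : ℕ) (M : Tm) : Prop := ∀ S Y, Active S → ¬ M ≈ₛ par (loc p S) Y

/-- No participant has two choices or conditionals. -/
def NoClash (M : Tm) : Prop :=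
  ∀ p S S' Y, Active S → Active S' → ¬ M ≈ₛ par (loc p S) (par (loc p S') Y)

lemma Free.congr {p : ℕ} {M N : Tm} (h : Free p M) (hc : M ≈ₛ N) : Free p N :=
  fun S Y hS hN => h S Y hS (hc.trans hN)

lemma NoClash.congr {M N : Tm} (h : NoClash M) (hc : M ≈ₛ N) : NoClash N :=
  fun p S S' Y hS hS' hN => h p S S' Y hS hS' (hc.trans hN)

lemma free_par_iff {p : ℕ} {M N : Tm} : Free p (par M N) ↔ Free p M ∧ Free p N := by
  refine ⟨fun h => ⟨fun S Y hS hM => ?_, fun S Y hS hN => ?_⟩, fun ⟨hM, hN⟩ S Y hS h => ?_⟩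
  · exact h S _ hS ((Cong.par hM (.refl N)).trans (.assoc _ _ _))
  · exact h S _ hS ((Cong.par (.refl M) hN).trans (.left_comm _ _ _))
  · rcases par_decomp hS h with ⟨M', h, -⟩ | ⟨N', h, -⟩
    · exact hM S _ hS h
    · exact hN S _ hS h

lemma free_loc {p q : ℕ} (h : q ≠ p) (P : Tm) : Free p (loc q P) :=
  fun _ _ hS hc => h (loc_decomp hS hc).1

lemma not_free_loc {p : ℕ} {S : Tm} (hS : Active S) : ¬ Free p (loc p S) :=
  fun h => h S _ hS (Cong.par_unit _).symm

lemma noClash_par {M N : Tm} (hM : NoClash M) (hN : NoClash N) (h : ∀ p, Free p M ∨ Free p N) :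
    NoClash (par M N) := by
  intro p S S' Y hS hS' hc
  rcases par_decomp hS hc with ⟨M', h₁, h₂⟩ | ⟨N', h₁, h₂⟩
  · rcases par_decomp hS' h₂.symm with ⟨M'', h₃, -⟩ | ⟨N'', h₃, -⟩
    · exact hM p S S' _ hS hS' (h₁.trans (.par (.refl _) h₃))
    · exact (h p).elim (fun h => h S _ hS h₁) fun h => h S' _ hS' h₃
  · rcases par_decomp hS' h₂.symm with ⟨M'', h₃, -⟩ | ⟨N'', h₃, -⟩
    · exact (h p).elim (fun h => h S' _ hS' h₃) fun h => h S _ hS h₁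
    · exact hN p S S' _ hS hS' (h₁.trans (.par (.refl _) h₃))

lemma noClash_loc (p : ℕ) (P : Tm) : NoClash (loc p P) := fun _ _ _ _ hS hS' hc =>
  unit_decomp hS' (loc_decomp hS hc).2.2.symm

lemma noClash_loc_par {p : ℕ} {M : Tm} (P : Tm) (hM : NoClash M) (h : Free p M) :
    NoClash (par (loc p P) M) :=
  noClash_par (noClash_loc p P) hM fun q =>
    if hq : p = q then .inr (hq ▸ h) else .inl (free_loc hq P)

lemma NoClash.left {M N : Tm} (h : NoClash (par M N)) : NoClash M :=
  fun p S S' _ hS hS' hc => h p S S' _ hS hS'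
    ((Cong.par hc (.refl N)).trans ((Cong.assoc _ _ _).trans (.par (.refl _) (.assoc _ _ _))))

lemma NoClash.right {M N : Tm} (h : NoClash (par M N)) : NoClash N :=
  (h.congr (.comm _ _)).left

lemma NoClash.free {p : ℕ} {M S : Tm} (hS : Active S) (h : NoClash (par (loc p S) M)) :
    Free p M := fun S' Y hS' hc => h p S S' Y hS hS' (.par (.refl _) hc)

lemma Step.noClash {M M' : Tm} (h : Step M M') (hM : NoClash M) : NoClash M' := by
  cases h.red with
  | com p q ℓ v π P π' Q i j Y hi hj h h' =>
    have h₁ := hM.congr h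
    obtain ⟨hq, hp⟩ := free_par_iff.1 (h₁.free (.sum _ _ _))
    have hpq : q ≠ p := fun e => not_free_loc (.sum _ _ _) (e ▸ hq)
    exact (noClash_loc_par _ (noClash_loc_par _ h₁.right.right (h₁.right.free (.sum _ _ _)))
      (free_par_iff.2 ⟨free_loc hpq _, hp⟩)).congr h'.symm
  | cnd p v P Q R Y hR h h' =>
    have h₁ := hM.congr h
    exact (noClash_loc_par _ h₁.right (h₁.free (.cnd _ _ _))).congr h'.symm

/-- Typed sessions have no clash, and only the participants of the local context are occupied. -/
lemma LocTy.noClash {M : Tm} {Δ : LCtx} (h : LocTy M Δ) :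
    NoClash M ∧ ∀ p, Δ p = none → Free p M := by
  induction h with
  | @loc p P T _ =>
    refine ⟨noClash_loc p P, fun q hq => free_loc (fun h => ?_) P⟩
    simp [h] at hq
  | @par M N Δ₁ Δ₂ _ _ hd ihM ihN =>
    refine ⟨noClash_par ihM.1 ihN.1 fun p => (hd p).imp (ihM.2 p) (ihN.2 p), fun p hp => ?_⟩
    rw [Option.or_eq_none_iff] at hp
    exact free_par_iff.2 ⟨ihM.2 p hp.1, ihN.2 p hp.2⟩

/-! ### Multiparty sessions: reliability is preserved by directed contexts -/

section Reliable

variable {frag : Tm → Prop}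

lemma Steps.par {M M' : Tm} (h : (calculus frag).Steps M M') (N : Tm) :
    (calculus frag).Steps (par M N) (par M' N) :=
  Relation.ReflTransGen.lift (fun M => Tm.par M N)
    (fun _ _ => Or.imp (fun c => Cong.par c (.refl N)) fun s => Step.par s N) _ _ h

lemma Steps.of_cong {M N : Tm} (h : M ≈ₛ N) : (calculus frag).Steps M N := .single (.inl h)

lemma Steps.noClash {M M' : Tm} (h : (calculus frag).Steps M M') (hM : NoClash M) : NoClash M' := by
  induction h with
  | refl => exact hM
  | tail _ h ih => exact h.elim (fun h => ih.congr h) fun h => Step.noClash h ih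

/-- A choice that only addresses `t` is stuck as long as `t` belongs to the environment. -/
lemma step_of_frozen {r t : ℕ} {n : ℕ} {π : Fin n → Pre} {P : Fin n → Tm} {S' K R Z : Tm}
    (hπ : ∀ i, (π i).peer = t) (hS' : Active S')
    (hc : NoClash (par (par (loc r (sum n π P)) K) (par (loc t S') R)))
    (h : Step (par (loc r (sum n π P)) K) Z) :
    ∃ K', Step K K' ∧ Z ≈ₛ par (loc r (sum n π P)) K' := by
  have hK : Free t K := by
    have h1 : NoClash (par (loc t S') (par R (par (loc r (sum n π P)) K))) :=
      hc.congr ((Cong.comm _ _).trans (.assoc _ _ _))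
    exact (free_par_iff.1 (free_par_iff.1 (h1.free hS')).2).2
  have hsum : ∀ {m : ℕ} {π' : Fin m → Pre} {Q : Fin m → Tm} (j : Fin m),
      sum n π P ≈ₛ sum m π' Q → (π' j).peer = t := by
    intro m π' Q j h
    cases Active.atomEq (.sum _ _ _) (.sum _ _ _) h with
    | sum e h₁ h₂ => rw [h₁]; exact hπ _
  cases h.red with
  | com p q ℓ v π₁ P₁ π₂ P₂ i j Y hi hj h h' =>
    rcases par_decomp (.sum _ _ _) h with ⟨M', h₁, h₂⟩ | ⟨K₁, h₁, h₂⟩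
    · obtain ⟨rfl, h₃, h₄⟩ := loc_decomp (.sum _ _ _) h₁
      have hq := hsum i h₃
      rw [hi] at hq
      obtain rfl : q = t := hq
      exact (hK _ _ (.sum _ _ _) (((Cong.unit_par K).symm.trans
        (.par h₄.symm (.refl _))).trans h₂.symm)).elim
    · rcases par_decomp (.sum _ _ _) h₂.symm with ⟨M', h₃, h₄⟩ | ⟨K₂, h₃, h₄⟩
      · obtain ⟨rfl, h₅, -⟩ := loc_decomp (.sum _ _ _) h₃
        have hp := hsum j h₅
        rw [hj] at hp
        obtain rfl : p = t := hp
        exact (hK _ _ (.sum _ _ _) h₁).elim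
      · refine ⟨_, Red.step (.com p q ℓ v π₁ P₁ π₂ P₂ i j K₂ hi hj
          (h₁.trans (.par (.refl _) h₃)) (.refl _)), h'.trans ?_⟩
        exact (Cong.par (.refl _) ((Cong.par (.refl _) h₄).trans (.left_comm _ _ _))).trans
          (.left_comm _ _ _)
  | cnd p v P₁ Q₁ R₁ Y hR h h' =>
    rcases par_decomp (.cnd _ _ _) h with ⟨M', h₁, h₂⟩ | ⟨K₁, h₁, h₂⟩
    · obtain ⟨-, h₃, -⟩ := loc_decomp (.cnd _ _ _) h₁
      cases Active.atomEq (.sum _ _ _) (.cnd _ _ _) h₃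
    · exact ⟨_, Red.step (.cnd p v P₁ Q₁ R₁ K₁ hR h₁ (.refl _)),
        h'.trans ((Cong.par (.refl _) h₂).trans (.left_comm _ _ _))⟩

lemma steps_of_frozen {r t : ℕ} {n : ℕ} {π : Fin n → Pre} {P : Fin n → Tm} {S' K R Z : Tm}
    (hπ : ∀ i, (π i).peer = t) (hS' : Active S')
    (hc : NoClash (par (par (loc r (sum n π P)) K) (par (loc t S') R)))
    (h : (calculus frag).Steps (par (loc r (sum n π P)) K) Z) :
    ∃ K', (calculus frag).Steps K K' ∧ Z ≈ₛ par (loc r (sum n π P)) K' := by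
  induction h with
  | refl => exact ⟨K, .refl, .refl _⟩
  | @tail Z Z' hs h ih =>
    obtain ⟨K', hK', hZ⟩ := ih
    rcases h with h | h
    · exact ⟨K', hK', (Cong.symm h).trans hZ⟩
    · obtain ⟨K'', hK'', hZ'⟩ := step_of_frozen hπ hS'
        ((Steps.noClash (Steps.par hs _) hc).congr (.par hZ (.refl _)))
        (.cong hZ.symm h (.refl _))
      exact ⟨K'', hK'.tail (.inr hK''), hZ'⟩

/-- When a participant of the reliable part `K` communicates with the environment, the rest of `K`
is still reliable: it has to succeed even if that participant never moves again. -/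
lemma reliable_of_frozen {r t : ℕ} {n : ℕ} {π : Fin n → Pre} {P : Fin n → Tm} {S' K K₁ R R₁ : Tm}
    (hπ : ∀ i, (π i).peer = t) (hS' : Active S') (hc : NoClash (par K R))
    (hK : K ≈ₛ par (loc r (sum n π P)) K₁) (hR : R ≈ₛ par (loc t S') R₁)
    (h : (calculus frag).Reliable K) : (calculus frag).Reliable K₁ := by
  intro K₂ hK₂
  have h₂ : (calculus frag).Steps (par (loc r (sum n π P)) K₁) (par (loc r (sum n π P)) K₂) :=
    ((Steps.of_cong (.comm _ _)).trans (Steps.par hK₂ _)).trans (Steps.of_cong (.comm _ _))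
  obtain ⟨Z, hZ, hs⟩ := h _ ((Steps.of_cong hK).trans h₂)
  obtain ⟨K₃, hK₃, hZ'⟩ := steps_of_frozen hπ hS'
    (Steps.noClash (Steps.par h₂ _) (hc.congr (.par hK hR))) hZ
  refine ⟨K₃, hK₃, ?_⟩
  rcases hZ'.hasSuccess_iff.1 hs with h | h
  · exact h.elim
  · exact h

/-- A step of `K | R` leaves a reliable component: either `K` itself does a step, or `K` is not
involved, or one of its participants communicates with `R`; that participant is then handed over to
`R`. -/
lemma reliable_part_of_step {K R Z : Tm} (hc : NoClash (par K R)) (hd : (par K R).AllDirected)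
    (hK : (calculus frag).Reliable K) (h : Step (par K R) Z) :
    ∃ K' R', Z ≈ₛ par K' R' ∧ (calculus frag).Reliable K' := by
  -- directedness of the choices of the redex
  have hdir : ∀ {N N' : Tm} {p n} {π : Fin n → Pre} {P : Fin n → Tm} (i : Fin n), N.AllDirected →
      N ≈ₛ par (loc p (sum n π P)) N' → ∀ j, (π j).peer = (π i).peer :=
    fun i hN hc j => (hc.allDirected_iff.1 hN).1.1 j i
  cases h.red with
  | com p q ℓ v π P π' Q i j Y hi hj h h' =>
    have hq : (π i).peer = q := by rw [hi]; rfl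
    have hp : (π' j).peer = p := by rw [hj]; rfl
    rcases par_decomp (.sum _ _ _) h with ⟨K₁, h₁, h₂⟩ | ⟨R₁, h₁, h₂⟩
    · rcases par_decomp (.sum _ _ _) h₂.symm with ⟨K₂, h₃, h₄⟩ | ⟨R₁, h₃, h₄⟩
      · refine ⟨_, R, h'.trans ?_, hK.of_steps (.single (.inr (Red.step (.com p q ℓ v π P π' Q i j K₂
          hi hj (h₁.trans (.par (.refl _) h₃)) (.refl _)))))⟩
        exact (Cong.par (.refl _) ((Cong.par (.refl _) h₄).trans (.symm (.assoc _ _ _)))).trans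
          (.symm (.assoc _ _ _))
      · exact ⟨K₁, _, h'.trans ((Cong.par (.refl _) ((Cong.par (.refl _) h₄).trans
          (.left_comm _ _ _))).trans (.left_comm _ _ _)),
          reliable_of_frozen (fun k => (hdir i hd.1 h₁ k).trans hq) (.sum _ _ _) hc h₁ h₃ hK⟩
    · rcases par_decomp (.sum _ _ _) h₂.symm with ⟨K₁, h₃, h₄⟩ | ⟨R₂, h₃, h₄⟩
      · refine ⟨K₁, _, h'.trans ((Cong.par (.refl _) ((Cong.par (.refl _) h₄).trans
          (.left_comm _ _ _))).trans (.left_comm _ _ _)),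
          reliable_of_frozen (fun k => (hdir j hd.1 h₃ k).trans hp) (.sum _ _ _) hc h₃ h₁ hK⟩
      · exact ⟨K, _, h'.trans ((Cong.par (.refl _) ((Cong.par (.refl _) h₄).trans
          (.left_comm _ _ _))).trans (.left_comm _ _ _)), hK⟩
  | cnd p v P Q R' Y hR h h' =>
    rcases par_decomp (.cnd _ _ _) h with ⟨K₁, h₁, h₂⟩ | ⟨R₁, h₁, h₂⟩
    · exact ⟨_, R, h'.trans ((Cong.par (.refl _) h₂).trans (.symm (.assoc _ _ _))),
        hK.of_steps (.single (.inr (Red.step (.cnd p v P Q R' K₁ hR h₁ (.refl _)))))⟩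
    · exact ⟨K, _, h'.trans ((Cong.par (.refl _) h₂).trans (.left_comm _ _ _)), hK⟩

/-- In the absence of undirected choices, a session with a reliable component is reliable. -/
theorem reliable_par {K R : Tm} (hc : NoClash (par K R)) (hd : (par K R).AllDirected)
    (hK : (calculus frag).Reliable K) : (calculus frag).Reliable (par K R) := by
  intro Z hZ
  obtain ⟨K', R', h, hK', -, -⟩ : ∃ K' R', Z ≈ₛ par K' R' ∧ (calculus frag).Reliable K' ∧
      NoClash (par K' R') ∧ (par K' R').AllDirected := by
    induction hZ with
    | refl => exact ⟨K, R, .refl _, hK, hc, hd⟩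
    | tail _ h ih =>
      obtain ⟨K', R', hZ, hK', hc', hd'⟩ := ih
      rcases h with h | h
      · exact ⟨K', R', (Cong.symm h).trans hZ, hK', hc', hd'⟩
      · have h : Step (par K' R') _ := .cong hZ.symm h (.refl _)
        obtain ⟨K'', R'', hZ', hK''⟩ := reliable_part_of_step hc' hd' hK' h
        exact ⟨K'', R'', hZ', hK'', (Step.noClash h hc').congr hZ',
          hZ'.allDirected_iff.1 (Step.allDirected h hd')⟩
  obtain ⟨W, hW, hs⟩ := hK' K' .refl
  exact ⟨_, (Steps.of_cong h).trans (Steps.par hW R'), .inl hs⟩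

end Reliable

end MC
end SessionCalculi

namespace SessionCalculi
namespace MC
open Tm

/-! ### Multiparty sessions: two senders and two receivers -/

namespace LTy

lemma trans_sum_iff {n : ℕ} {a : Fin n → Act} {T : Fin n → LTy} {b : Act} {U : LTy} :
    (LTy.sum n a T).Trans b U ↔ ∃ i, b = a i ∧ U = T i := by
  constructor
  · intro h
    cases h with
    | sum a T i => exact ⟨i, rfl, rfl⟩
  · rintro ⟨i, rfl, rfl⟩
    exact .sum a T i

lemma not_trans_fin {b : Act} {U : LTy} : ¬ LTy.fin.Trans b U := nofun

end LTy

/-- The type of the participants `0` and `1`, who send a boolean to `2` or `3`. -/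
def sndTy : LTy := .sum 2 (fun i => ⟨2 + i, .snd, 0, .bool⟩) fun _ => .fin

/-- The type of the participants `2` and `3`, who receive a boolean from `0` or `1`. -/
def rcvTy : LTy := .sum 2 (fun i => ⟨i, .rcv, 0, .bool⟩) fun _ => .fin

lemma sndTy_wf : sndTy.WF := by
  refine ⟨fun _ => trivial, Nat.two_pos, fun i j h => ?_, fun _ => trivial⟩
  have h := congrArg Prod.fst h
  dsimp only at h
  omega

lemma rcvTy_wf : rcvTy.WF := by
  refine ⟨fun _ => trivial, Nat.two_pos, fun i j h => ?_, fun _ => trivial⟩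
  have h := congrArg Prod.fst h
  dsimp only at h
  omega

lemma sndTy_trans {q ℓ : ℕ} {pol : Pol} {U : Base} {T : LTy} (h : sndTy.Trans ⟨q, pol, ℓ, U⟩ T) :
    pol = .snd ∧ (q = 2 ∨ q = 3) ∧ ℓ = 0 ∧ U = .bool ∧ T = .fin := by
  obtain ⟨i, he, rfl⟩ := LTy.trans_sum_iff.1 h
  obtain ⟨rfl, rfl, rfl, rfl⟩ := Act.mk.inj he
  exact ⟨rfl, by omega, rfl, rfl, rfl⟩

lemma rcvTy_trans {q ℓ : ℕ} {pol : Pol} {U : Base} {T : LTy} (h : rcvTy.Trans ⟨q, pol, ℓ, U⟩ T) :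
    pol = .rcv ∧ (q = 0 ∨ q = 1) ∧ ℓ = 0 ∧ U = .bool ∧ T = .fin := by
  obtain ⟨i, he, rfl⟩ := LTy.trans_sum_iff.1 h
  obtain ⟨rfl, rfl, rfl, rfl⟩ := Act.mk.inj he
  exact ⟨rfl, by omega, rfl, rfl, rfl⟩

lemma sndTy_trans_of {q : ℕ} (h : q = 2 ∨ q = 3) : sndTy.Trans ⟨q, .snd, 0, .bool⟩ .fin := by
  rcases h with rfl | rfl
  · exact LTy.trans_sum_iff.2 ⟨0, rfl, rfl⟩
  · exact LTy.trans_sum_iff.2 ⟨1, rfl, rfl⟩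

lemma rcvTy_trans_of {p : ℕ} (h : p = 0 ∨ p = 1) : rcvTy.Trans ⟨p, .rcv, 0, .bool⟩ .fin := by
  rcases h with rfl | rfl
  · exact LTy.trans_sum_iff.2 ⟨0, rfl, rfl⟩
  · exact LTy.trans_sum_iff.2 ⟨1, rfl, rfl⟩

/-- `0` for absent participants and for those of type `end`, `1` for all others. -/
def pendingTy : Option LTy → ℕ
  | none => 0
  | some .fin => 0
  | some _ => 1

/-- The number of communications that a participant of type `sndTy`, `rcvTy` or `end` still has to
perform. -/
def pending (Δ : LCtx) (p : ℕ) : ℕ := pendingTy (Δ p)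

/-- Some of the participants `0`, `1`, `2` and `3` still have to send or receive a boolean, and
there are as many senders as receivers. -/
structure Balanced (Δ : LCtx) : Prop where
  types : ∀ p, Δ p = none ∨ Δ p = some .fin ∨ ((p = 0 ∨ p = 1) ∧ Δ p = some sndTy) ∨
    ((p = 2 ∨ p = 3) ∧ Δ p = some rcvTy)
  count : pending Δ 0 + pending Δ 1 = pending Δ 2 + pending Δ 3

lemma pending_update (Δ : LCtx) (p r : ℕ) :
    pending (Function.update Δ p (some .fin)) r = if r = p then 0 else pending Δ r := by
  by_cases h : r = p <;> simp [pending, h, pendingTy]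

namespace Balanced

variable {Δ Δ' : LCtx}

lemma sender (h : Balanced Δ) {p q ℓ : ℕ} {U : Base} {T T₁ : LTy} (hT : Δ p = some T)
    (ht : T.Trans ⟨q, .snd, ℓ, U⟩ T₁) :
    (p = 0 ∨ p = 1) ∧ T = sndTy ∧ (q = 2 ∨ q = 3) ∧ ℓ = 0 ∧ U = .bool ∧ T₁ = .fin := by
  rcases h.types p with hp | hp | ⟨hp, hp'⟩ | ⟨hp, hp'⟩
  · rw [hp] at hT; cases hT
  · rw [hp] at hT; cases hT; exact (LTy.not_trans_fin ht).elim
  · rw [hp'] at hT; cases hT; exact ⟨hp, rfl, (sndTy_trans ht).2⟩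
  · rw [hp'] at hT; cases hT; exact nomatch (rcvTy_trans ht).1

lemma receiver (h : Balanced Δ) {p q ℓ : ℕ} {U : Base} {T T₁ : LTy} (hT : Δ p = some T)
    (ht : T.Trans ⟨q, .rcv, ℓ, U⟩ T₁) :
    (p = 2 ∨ p = 3) ∧ T = rcvTy ∧ (q = 0 ∨ q = 1) ∧ ℓ = 0 ∧ U = .bool ∧ T₁ = .fin := by
  rcases h.types p with hp | hp | ⟨hp, hp'⟩ | ⟨hp, hp'⟩
  · rw [hp] at hT; cases hT
  · rw [hp] at hT; cases hT; exact (LTy.not_trans_fin ht).elim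
  · rw [hp'] at hT; cases hT; exact nomatch (sndTy_trans ht).1
  · rw [hp'] at hT; cases hT; exact ⟨hp, rfl, (rcvTy_trans ht).2⟩

lemma step (h : Balanced Δ) (hs : LCtx.Step Δ Δ') : Balanced Δ' := by
  obtain ⟨p, q, ℓ, U, -, T, T₁, T', T₁', hT, hT', ht, ht', rfl⟩ := hs
  obtain ⟨hp, rfl, hq, -, -, rfl⟩ := h.sender hT ht
  obtain ⟨-, rfl, -, -, -, rfl⟩ := h.receiver hT' ht'
  constructor
  · intro r
    rcases eq_or_ne r q with rfl | hrq
    · simp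
    · rcases eq_or_ne r p with rfl | hrp
      · simp [hrq]
      · simpa [hrq, hrp] using h.types r
  · have hc := h.count
    have h2 : pending Δ p = 1 := by rw [pending, hT]; rfl
    have h3 : pending Δ q = 1 := by rw [pending, hT']; rfl
    simp only [pending_update]
    rcases hp with rfl | rfl <;> rcases hq with rfl | rfl <;> simp <;> omega

lemma steps (h : Balanced Δ) (hs : Relation.ReflTransGen LCtx.Step Δ Δ') : Balanced Δ' := by
  induction hs with
  | refl => exact h
  | tail _ hs ih => exact ih.step hs

lemma safe (h : Balanced Δ) : Δ.Safe := by
  intro Δ' hs p q ℓ ℓ' U U' T T' T₁ T₁' hpq hT hT' ht ht'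
  obtain ⟨-, rfl, -, rfl, rfl, rfl⟩ := (h.steps hs).sender hT ht
  obtain ⟨-, rfl, -, rfl, rfl, rfl⟩ := (h.steps hs).receiver hT' ht'
  exact ⟨_, hpq, _, _, _, _, hT, hT', ht, ht', rfl⟩

lemma deadlockFree (h : Balanced Δ) : Δ.DeadlockFree := by
  intro Δ' hs hn
  have h' := h.steps hs
  have hs : ∀ p q, (p = 0 ∨ p = 1) → (q = 2 ∨ q = 3) → Δ' p = some sndTy → Δ' q = some rcvTy →
      False := fun p q hp hq hT hT' =>
    hn ⟨_, p, q, 0, .bool, by omega, _, _, _, _, hT, hT', sndTy_trans_of hq, rcvTy_trans_of hp, rfl⟩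
  have h0 : ∀ p, pending Δ' p = 0 ∨ (pending Δ' p = 1 ∧ (((p = 0 ∨ p = 1) ∧ Δ' p = some sndTy) ∨
      ((p = 2 ∨ p = 3) ∧ Δ' p = some rcvTy))) := by
    intro p
    rcases h'.types p with hp | hp | hp | hp
    · exact .inl (by rw [pending, hp]; rfl)
    · exact .inl (by rw [pending, hp]; rfl)
    · exact .inr ⟨by rw [pending, hp.2]; rfl, .inl hp⟩
    · exact .inr ⟨by rw [pending, hp.2]; rfl, .inr hp⟩
  have hz : ∀ p, pending Δ' p = 0 := by
    have hc := h'.count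
    have h1 : ∀ p q, (p = 0 ∨ p = 1) → (q = 2 ∨ q = 3) → pending Δ' p = 0 ∨ pending Δ' q = 0 := by
      intro p q hp hq
      rcases h0 p with h1 | ⟨-, h1⟩
      · exact .inl h1
      rcases h0 q with h2 | ⟨-, h2⟩
      · exact .inr h2
      exact (hs p q hp hq (by rcases h1 with h1 | h1 <;> [exact h1.2; omega])
        (by rcases h2 with h2 | h2 <;> [omega; exact h2.2])).elim
    have h2 := h1 0 2 (.inl rfl) (.inl rfl)
    have h3 := h1 0 3 (.inl rfl) (.inr rfl)
    have h4 := h1 1 2 (.inr rfl) (.inl rfl)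
    have h5 := h1 1 3 (.inr rfl) (.inr rfl)
    intro p
    rcases h0 p with h6 | ⟨-, ⟨rfl | rfl, -⟩ | ⟨rfl | rfl, -⟩⟩ <;> omega
  intro p T hT
  have := hz p
  rw [pending, hT] at this
  cases T with
  | fin => rfl
  | _ => cases this

end Balanced

/-- The sender offers `tt` to both `2` and `3`. -/
def sender : Tm := sum 2 (fun i => .out (2 + i) 0 .tt) fun _ => nil

/-- A receiver whose `i`-th branch receives from `peer i`, and then succeeds or stops. -/
def receiver {n : ℕ} (peer : Fin n → Fin 2) (good : Fin n → Bool) : Tm :=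
  sum n (fun i => .inp (peer i) 0) fun i => if good i then ok else nil

/-- The session of a sender and a receiver, or of two inactive participants. -/
def duo (p q : ℕ) (P Q : Tm) : Tm := par (loc p P) (loc q Q)

lemma sender_typed : ProcTy (fun _ => none) (fun _ => none) sender sndTy :=
  .sum id _ sndTy_wf Function.surjective_id (fun i j h => by rw [show i = j from h])
    (fun _ => .out .tt) fun _ => .nil _ _

lemma receiver_typed {n : ℕ} {peer : Fin n → Fin 2} {good : Fin n → Bool}
    (h : Function.Surjective peer) :
    ProcTy (fun _ => none) (fun _ => none) (receiver peer good) rcvTy := by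
  refine .sum peer _ rcvTy_wf h (fun i j h => by rw [h]) (fun i => .inp _ _ _) fun i => ?_
  split
  · exact .ok _ _
  · exact .nil _ _

lemma nil_typed : ProcTy (fun _ => none) (fun _ => none) nil .fin := .nil _ _

/-- The local context of a `duo`. -/
def duoCtx (p q : ℕ) (T U : LTy) : LCtx :=
  fun r => (if r = p then some T else none).or (if r = q then some U else none)

lemma duo_typed {p q : ℕ} {P Q : Tm} {T U : LTy} (h : p ≠ q)
    (hP : ProcTy (fun _ => none) (fun _ => none) P T)
    (hQ : ProcTy (fun _ => none) (fun _ => none) Q U) : LocTy (duo p q P Q) (duoCtx p q T U) := by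
  refine .par (.loc hP) (.loc hQ) fun r => ?_
  by_cases hr : r = p
  · exact .inr (by simp [hr, h])
  · exact .inl (by simp [hr])

/-- The types of a `duo` are those of a sender and a receiver, or both `end`. -/
inductive DuoTy : LTy → LTy → Prop where
  | active : DuoTy sndTy rcvTy
  | done : DuoTy .fin .fin

lemma duo_balanced {p q : ℕ} {T U : LTy} (hp : p = 0 ∨ p = 1) (hq : q = 2 ∨ q = 3)
    (h : DuoTy T U) : Balanced (duoCtx p q T U) := by
  constructor
  · intro r
    rcases eq_or_ne r p with rfl | h1
    · cases h <;> simp [duoCtx, hp]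
    · rcases eq_or_ne r q with rfl | h2
      · cases h <;> simp [duoCtx, h1, hq]
      · simp [duoCtx, h1, h2]
  · rcases hp with rfl | rfl <;> rcases hq with rfl | rfl <;> cases h <;>
      simp [pending, pendingTy, duoCtx, sndTy, rcvTy]

lemma duo_duo_balanced {p q p' q' : ℕ} {T U T' U' : LTy} (hp : p = 0 ∨ p = 1)
    (hp' : p' = 0 ∨ p' = 1) (hpp : p ≠ p') (hq : q = 2 ∨ q = 3) (hq' : q' = 2 ∨ q' = 3)
    (hqq : q ≠ q') (h : DuoTy T U) (h' : DuoTy T' U') :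
    Balanced fun r => (duoCtx p q T U r).or (duoCtx p' q' T' U' r) := by
  have h1 := (duo_balanced hp hq h).types
  have h2 := (duo_balanced hp' hq' h').types
  constructor
  · intro r
    show _ ∨ _
    rcases ho : duoCtx p q T U r with _ | V
    · simpa using h2 r
    · have := h1 r
      rw [ho] at this
      simpa using this
  · rcases hp with rfl | rfl <;> rcases hq with rfl | rfl <;> rcases hp' with rfl | rfl <;>
      rcases hq' with rfl | rfl <;> cases h <;> cases h' <;>
      first
      | exact absurd rfl hpp
      | exact absurd rfl hqq
      | simp [pending, pendingTy, duoCtx, sndTy, rcvTy]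

lemma scmp_isTerm {M : Tm} {Δ : LCtx} (hf : M.AllSums Separate) (hg : M.Guarded)
    (h : LocTy M Δ) (hb : Balanced Δ) : SCMP.IsTerm M :=
  ⟨hf, hg, Δ, ⟨h, hb.safe⟩, hb.deadlockFree⟩

/-- The processes of the examples: choices are separate, and there is no recursion. -/
def Simple (P : Tm) : Prop := P.AllSums Separate ∧ P.Guarded

lemma simple_nil : Simple nil := ⟨trivial, trivial⟩

lemma simple_sender : Simple sender := ⟨⟨.inl fun _ => trivial, fun _ => trivial⟩, fun _ => trivial⟩

lemma simple_receiver {n : ℕ} (peer : Fin n → Fin 2) (good : Fin n → Bool) :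
    Simple (receiver peer good) := by
  refine ⟨⟨.inr fun _ h => h, fun i => ?_⟩, fun i => ?_⟩ <;> dsimp only <;> split <;> trivial

lemma duo_isTerm {p q : ℕ} {P Q : Tm} {T U : LTy} (hp : p = 0 ∨ p = 1) (hq : q = 2 ∨ q = 3)
    (sP : Simple P) (sQ : Simple Q) (h : DuoTy T U)
    (hP : ProcTy (fun _ => none) (fun _ => none) P T)
    (hQ : ProcTy (fun _ => none) (fun _ => none) Q U) : SCMP.IsTerm (duo p q P Q) :=
  scmp_isTerm ⟨sP.1, sQ.1⟩ ⟨sP.2, sQ.2⟩ (duo_typed (by omega) hP hQ) (duo_balanced hp hq h)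

lemma duo_duo_isTerm {p q p' q' : ℕ} {P Q P' Q' : Tm} {T U : LTy} (hp : p = 0 ∨ p = 1)
    (hp' : p' = 0 ∨ p' = 1) (hpp : p ≠ p') (hq : q = 2 ∨ q = 3) (hq' : q' = 2 ∨ q' = 3)
    (hqq : q ≠ q') (sP : Simple P) (sQ : Simple Q) (sP' : Simple P') (sQ' : Simple Q')
    (h : DuoTy T U) (hP : ProcTy (fun _ => none) (fun _ => none) P T)
    (hQ : ProcTy (fun _ => none) (fun _ => none) Q U)
    (hP' : ProcTy (fun _ => none) (fun _ => none) P' T)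
    (hQ' : ProcTy (fun _ => none) (fun _ => none) Q' U) :
    SCMP.IsTerm (par (duo p q P Q) (duo p' q' P' Q')) := by
  refine scmp_isTerm ⟨⟨sP.1, sQ.1⟩, sP'.1, sQ'.1⟩ ⟨⟨sP.2, sQ.2⟩, sP'.2, sQ'.2⟩
    (.par (duo_typed (by omega) hP hQ) (duo_typed (by omega) hP' hQ') fun r => ?_)
    (duo_duo_balanced hp hp' hpp hq hq' hqq h h)
  by_cases h1 : r = p
  · exact .inr (by simp [duoCtx]; omega)
  · by_cases h2 : r = q
    · exact .inr (by simp [duoCtx]; omega)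
    · exact .inl (by simp [duoCtx]; omega)

/-- A communication of a `duo`. -/
lemma duo_step {p q n : ℕ} (k : Fin 2) (hq : q = 2 + (k : ℕ)) {peer : Fin n → Fin 2}
    {good : Fin n → Bool} (i : Fin n) (hi : (peer i : ℕ) = p) :
    Step (duo p q sender (receiver peer good)) (duo p q nil (if good i then ok else nil)) := by
  subst hi hq
  have hv : (if good i then ok else nil : Tm).vsub (Sub.inst .tt) = if good i then ok else nil := by
    split <;> rfl
  have hc : ∀ A B : Tm, par A B ≈ₛ par B (par A unit) := fun A B =>
    (Cong.comm _ _).trans (.par (.refl _) (Cong.par_unit _).symm)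
  refine Red.step (.com _ _ 0 .tt _ _ _ _ i k unit rfl rfl (hc _ _) ?_)
  rw [hv]
  exact hc _ _

/-! ### Multiparty sessions: terms without `✓` -/

namespace Tm

/-- There is no occurrence of `✓`, not even below prefixes. -/
def OkFree : Tm → Prop
  | nil => True
  | ok => False
  | pvar _ => True
  | mu P => OkFree P
  | sum _ _ P => ∀ i, OkFree (P i)
  | cnd _ P Q => OkFree P ∧ OkFree Q
  | loc _ P => OkFree P
  | par M N => OkFree M ∧ OkFree N

lemma okFree_vsub {σ : Sub} {P : Tm} : (P.vsub σ).OkFree ↔ P.OkFree := by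
  induction P generalizing σ <;> simp_all [vsub, OkFree]

lemma okFree_pren {ρ : Var → Var} {P : Tm} : (P.pren ρ).OkFree ↔ P.OkFree := by
  induction P generalizing ρ <;> simp_all [pren, OkFree]

lemma OkFree.psub {τ : Var → Tm} {P : Tm} (h : P.OkFree) (hτ : ∀ X, (τ X).OkFree) :
    (P.psub τ).OkFree := by
  induction P generalizing τ with
  | nil => trivial
  | ok => exact h
  | pvar X => exact hτ X
  | mu P ih =>
    refine ih h ?_
    rintro (X | _ | k)
    · exact okFree_pren.2 (hτ _)
    · trivial
    · exact okFree_pren.2 (hτ _)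
  | sum n π P ih => exact fun i => ih i (h i) fun X => okFree_vsub.2 (hτ X)
  | cnd v P Q hP hQ | par P Q hP hQ => exact ⟨hP h.1 hτ, hQ h.2 hτ⟩
  | loc p P ih => exact ih h hτ

lemma OkFree.of_psub {τ : Var → Tm} {P : Tm} (h : (P.psub τ).OkFree) : P.OkFree := by
  induction P generalizing τ with
  | nil | pvar X => trivial
  | ok => exact h
  | mu P ih | loc p P ih => exact ih h
  | sum n π P ih => exact fun i => ih i (h i)
  | cnd v P Q hP hQ | par P Q hP hQ => exact ⟨hP h.1, hQ h.2⟩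

lemma OkFree.not_hasSuccess {P : Tm} (h : P.OkFree) : ¬ P.HasSuccess := by
  induction P with
  | par P Q hP hQ => exact not_or.2 ⟨hP h.1, hQ h.2⟩
  | mu P ih | loc p P ih => exact ih h
  | ok => exact h.elim
  | _ => exact not_false

end Tm

lemma Cong.okFree_iff {M N : Tm} (h : M ≈ₛ N) : M.OkFree ↔ N.OkFree := by
  induction h with
  | refl => exact Iff.rfl
  | symm _ ih => exact ih.symm
  | trans _ _ ih₁ ih₂ => exact ih₁.trans ih₂
  | unfold P _ =>
    rw [unfold_eq]
    refine ⟨fun h => OkFree.psub h ?_, fun h => h.of_psub⟩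
    rintro (X | _ | k)
    · trivial
    · exact h
    · trivial
  | perm n π P e => exact e.surjective.forall (p := fun i => (P i).OkFree)
  | inactive p M _ => simp only [OkFree, true_and]
  | comm => exact and_comm
  | assoc => exact and_assoc
  | mu _ ih | loc p _ ih => exact ih
  | sum π _ ih => exact forall_congr' ih
  | cnd v _ _ ih₁ ih₂ | par _ _ ih₁ ih₂ => exact and_congr ih₁ ih₂

lemma Step.okFree {M M' : Tm} (h : Step M M') (hM : M.OkFree) : M'.OkFree := by
  cases h.red with
  | com p q ℓ v π P π' Q i j Y hi hj h h' =>
    obtain ⟨hP, hQ, hY⟩ := h.okFree_iff.1 hM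
    exact h'.okFree_iff.2 ⟨okFree_vsub.2 (hP i), hQ j, hY⟩
  | cnd p v P Q R Y hR h h' =>
    obtain ⟨⟨hP, hQ⟩, hY⟩ := h.okFree_iff.1 hM
    refine h'.okFree_iff.2 ⟨?_, hY⟩
    cases hR
    · exact hP
    · exact hQ

lemma not_maySucceed_of_okFree {frag : Tm → Prop} {M : Tm} (h : M.OkFree) :
    ¬ (calculus frag).MaySucceed M := by
  rintro ⟨N, hs, hN⟩
  have : N.OkFree := by
    clear hN
    induction hs with
    | refl => exact h
    | tail _ h' ih => exact h'.elim (fun h' => (Cong.okFree_iff h').1 ih) fun h' => Step.okFree h' ih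
  exact this.not_hasSuccess hN

/-! ### Multiparty sessions: the examples -/

/-- The receiver `q` of a `duo` of `p` and `q` may succeed or fail after having heard from `p`; its
third branch, which is needed for its type, receives from the other sender. -/
def chooser (k : Fin 2) : Tm := receiver (n := 3) ![k, k, 1 - k] ![true, false, false]

lemma chooser_typed (k : Fin 2) :
    ProcTy (fun _ => none) (fun _ => none) (chooser k) rcvTy := by
  refine receiver_typed fun j => ?_
  fin_cases k <;> fin_cases j
  exacts [⟨0, rfl⟩, ⟨2, rfl⟩, ⟨2, rfl⟩, ⟨0, rfl⟩]

/-- The chooser of the participants `0` and `2`, or `1` and `3`. -/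
def scmpChooser (k : Fin 2) : Tm := duo k (2 + k) sender (chooser k)

/-- The chooser after it has failed. -/
def scmpFailed (k : Fin 2) : Tm := duo k (2 + k) nil nil

lemma scmpChooser_isTerm (k : Fin 2) : SCMP.IsTerm (scmpChooser k) :=
  duo_isTerm (by omega) (by omega) simple_sender (simple_receiver _ _) .active sender_typed
    (chooser_typed k)

lemma scmpFailed_isTerm (k : Fin 2) : SCMP.IsTerm (scmpFailed k) :=
  duo_isTerm (by omega) (by omega) simple_nil simple_nil .done nil_typed nil_typed

lemma scmpChooser_par_isTerm : SCMP.IsTerm (par (scmpChooser 0) (scmpChooser 1)) :=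
  duo_duo_isTerm (by decide) (by decide) (by decide) (by decide) (by decide) (by decide)
    simple_sender (simple_receiver _ _) simple_sender (simple_receiver _ _) .active sender_typed
    (chooser_typed 0) sender_typed (chooser_typed 1)

lemma scmpChooser_maySucceed (k : Fin 2) : SCMP.MaySucceed (scmpChooser k) :=
  ⟨_, .single (.inr (duo_step k rfl 0 rfl)), .inr trivial⟩

lemma scmpChooser_steps (k : Fin 2) : SCMP.Steps (scmpChooser k) (scmpFailed k) :=
  .single (.inr (duo_step k rfl 1 rfl))

lemma scmpFailed_fails (k : Fin 2) : ¬ SCMP.MaySucceed (scmpFailed k) :=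
  not_maySucceed_of_okFree ⟨trivial, trivial⟩

/-- The receiver of the ring: it succeeds if `good` is true and it hears from `0`. -/
def ringReceiver (good : Bool) : Tm := receiver (n := 2) id ![good, false]

lemma ringReceiver_typed (good : Bool) :
    ProcTy (fun _ => none) (fun _ => none) (ringReceiver good) rcvTy :=
  receiver_typed Function.surjective_id

/-- One half of the ring: when it is on its own, its receiver can only hear from `0`, and it
succeeds. -/
def ringLeft : Tm := duo 0 2 sender (ringReceiver true)

/-- The other half of the ring, which competes with the first one for its messages. -/
def ringRight : Tm := duo 1 3 sender (ringReceiver false)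

/-- The ring after the receivers have heard from the senders of the other halves. -/
def ringFailed : Tm := par (duo 0 3 nil nil) (duo 1 2 nil nil)

lemma ringLeft_isTerm : SCMP.IsTerm ringLeft :=
  duo_isTerm (by decide) (by decide) simple_sender (simple_receiver _ _) .active sender_typed
    (ringReceiver_typed _)

lemma ringRight_isTerm : SCMP.IsTerm ringRight :=
  duo_isTerm (by decide) (by decide) simple_sender (simple_receiver _ _) .active sender_typed
    (ringReceiver_typed _)

lemma ring_isTerm : SCMP.IsTerm (par ringLeft ringRight) :=
  duo_duo_isTerm (by decide) (by decide) (by decide) (by decide) (by decide) (by decide)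
    simple_sender (simple_receiver _ _) simple_sender (simple_receiver _ _) .active sender_typed
    (ringReceiver_typed _) sender_typed (ringReceiver_typed _)

lemma ringFailed_isTerm : SCMP.IsTerm ringFailed :=
  duo_duo_isTerm (by decide) (by decide) (by decide) (by decide) (by decide) (by decide)
    simple_nil simple_nil simple_nil simple_nil .done nil_typed nil_typed nil_typed nil_typed

lemma ringFailed_fails : ¬ SCMP.MaySucceed ringFailed :=
  not_maySucceed_of_okFree ⟨⟨trivial, trivial⟩, trivial, trivial⟩

lemma ring_steps : SCMP.Steps (par ringLeft ringRight) ringFailed := by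
  -- the other way of grouping senders and receivers
  have hc : par ringLeft ringRight ≈ₛ
      par (duo 0 3 sender (ringReceiver false)) (duo 1 2 sender (ringReceiver true)) :=
    (Cong.assoc _ _ _).trans ((Cong.par (.refl _) ((Cong.par (.refl _) (.comm _ _)).trans
      ((Cong.left_comm _ _ _).trans (.par (.refl _) (.comm _ _))))).trans (.symm (.assoc _ _ _)))
  have h₁ : Step (duo 0 3 sender (ringReceiver false)) (duo 0 3 nil nil) := duo_step 1 rfl 0 rfl
  have h₂ : Step (duo 1 2 sender (ringReceiver true)) (duo 1 2 nil nil) := duo_step 0 rfl 1 rfl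
  exact .head (.inl hc) (.head (.inr (Step.par h₁ _))
    (.single (.inr (.cong (.comm _ _) (Step.par h₂ _) (.comm _ _)))))

lemma sender_eq {n : ℕ} {π : Fin n → Pre} {P : Fin n → Tm} (h : sender ≈ₛ sum n π P) (i : Fin n) :
    (π i).IsOut := by
  cases Active.atomEq (.sum _ _ _) (.sum _ _ _) h with
  | sum e h₁ h₂ => rw [h₁]; trivial

lemma ringReceiver_eq {n q ℓ : ℕ} {π : Fin n → Pre} {P : Fin n → Tm} {good : Bool}
    (h : ringReceiver good ≈ₛ sum n π P) (i : Fin n) (hi : π i = .inp q ℓ) (hq : q = 0)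
    (hg : good = true) : (P i).HasSuccess := by
  cases Active.atomEq (.sum _ _ _) (.sum _ _ _) h with
  | sum e h₁ h₂ =>
    rw [h₁] at hi
    have he : e i = 0 := by
      simp only [id_eq, Pre.inp.injEq] at hi
      omega
    refine (h₂ i).hasSuccess_iff.1 ?_
    rw [he, hg]
    trivial

lemma ringLeft_step {M : Tm} (h : Step ringLeft M) : M.HasSuccess := by
  cases h.red with
  | com p q ℓ v π P π' Q i j Y hi hj h h' =>
    rcases par_decomp (.sum _ _ _) h with ⟨M', h₁, h₂⟩ | ⟨N', h₁, h₂⟩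
    · obtain ⟨-, h₃, -⟩ := loc_decomp (.sum _ _ _) h₁
      have := sender_eq h₃ i
      rw [hi] at this
      exact this.elim
    · obtain ⟨-, h₃, h₄⟩ := loc_decomp (.sum _ _ _) h₁
      have hq : q = 0 := by
        rcases par_decomp (.sum _ _ _) h₂.symm with ⟨M', h₅, -⟩ | ⟨N', h₅, -⟩
        · exact (loc_decomp (.sum _ _ _) h₅).1.symm
        · exact (unit_decomp (.sum _ _ _) (h₄.symm.trans h₅)).elim
      exact h'.hasSuccess_iff.2 (.inl (hasSuccess_vsub.2 (ringReceiver_eq h₃ i hi hq rfl)))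
  | cnd p v P Q R Y hR h h' =>
    rcases par_decomp (.cnd _ _ _) h with ⟨M', h₁, -⟩ | ⟨N', h₁, -⟩
    · cases Active.atomEq (.sum _ _ _) (.cnd _ _ _) (loc_decomp (.cnd _ _ _) h₁).2.1
    · cases Active.atomEq (.sum _ _ _) (.cnd _ _ _) (loc_decomp (.cnd _ _ _) h₁).2.1

lemma ringLeft_reliable : SCMP.Reliable ringLeft := by
  intro M hM
  have h : M ≈ₛ ringLeft ∨ M.HasSuccess := by
    induction hM with
    | refl => exact .inl (.refl _)
    | tail _ h ih =>
      rcases ih with ih | ih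
      · rcases h with h | h
        · exact .inl ((Cong.symm h).trans ih)
        · exact .inr (ringLeft_step (.cong ih.symm h (.refl _)))
      · rcases h with h | h
        · exact .inr ((Cong.hasSuccess_iff h).1 ih)
        · exact .inr (Step.hasSuccess h ih)
  rcases h with h | h
  · refine ⟨_, .head (.inl h) (.single (.inr (duo_step 0 rfl 0 rfl))), .inr trivial⟩
  · exact ⟨M, .refl, h⟩

/-! ### Multiparty sessions as targets -/

namespace Tm

lemma AllSums.mono {s s' : (n : ℕ) → (Fin n → Pre) → Prop} (hs : ∀ n π, s n π → s' n π) {M : Tm}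
    (h : M.AllSums s) : M.AllSums s' := by
  induction M with
  | nil | ok | pvar X => trivial
  | mu P ih | loc p P ih => exact ih h
  | sum n π P ih => exact ⟨hs n π h.1, fun i => ih i (h.2 i)⟩
  | cnd v P Q hP hQ | par P Q hP hQ => exact ⟨hP h.1, hQ h.2⟩

/-- There are no located processes and no parallel compositions. -/
def IsProc : Tm → Prop
  | mu P => IsProc P
  | sum _ _ P => ∀ i, IsProc (P i)
  | cnd _ P Q => IsProc P ∧ IsProc Q
  | loc _ _ => False
  | par _ _ => False
  | _ => True

lemma isProc_vsub {σ : Sub} {P : Tm} : (P.vsub σ).IsProc ↔ P.IsProc := by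
  induction P generalizing σ <;> simp_all [vsub, IsProc]

lemma isProc_pren {ρ : Var → Var} {P : Tm} : (P.pren ρ).IsProc ↔ P.IsProc := by
  induction P generalizing ρ <;> simp_all [pren, IsProc]

end Tm

lemma ProcTy.isProc {Γ : Ctxt Base} {Θ : Ctxt LTy} {P : Tm} {T : LTy} (h : ProcTy Γ Θ P T) :
    P.IsProc := by
  induction h with
  | nil | ok | pvar => trivial
  | cnd _ _ _ ih₁ ih₂ => exact ⟨ih₁, ih₂⟩
  | sum _ _ _ _ _ _ _ ih => exact ih
  | mu _ _ ih => exact ih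
  | sub _ _ _ ih => exact ih

lemma LocTy.mem_locs {M : Tm} {Δ : LCtx} (h : LocTy M Δ) {p : ℕ} (hp : p ∈ M.locs) :
    Δ p ≠ none := by
  induction h with
  | loc _ => simp only [locs, Set.mem_singleton_iff] at hp; simp [hp]
  | par _ _ _ ih₁ ih₂ =>
    rw [Ne, Option.or_eq_none_iff, not_and_or]
    exact hp.imp ih₁ ih₂

lemma LocTy.not_isProc {M : Tm} {Δ : LCtx} (h : LocTy M Δ) : ¬ M.IsProc := by
  cases h <;> exact id

lemma LocTy.exists_loc {M : Tm} {Δ : LCtx} (h : LocTy M Δ) : ∃ p, p ∈ M.locs := by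
  induction h with
  | @loc p P T _ => exact ⟨p, rfl⟩
  | par _ _ _ ih _ => exact ih.imp fun _ => .inl

lemma Op.isProc_args {o : Op} {P : Fin o.arity → Tm} (h : (o.build P).IsProc) :
    ∀ i, (P i).IsProc := by
  cases o with
  | nil | ok | pvar X => exact nofun
  | mu X =>
    intro i
    obtain rfl : i = (0 : Fin 1) := Subsingleton.elim (α := Fin 1) _ _
    exact isProc_pren.1 h
  | sum n π =>
    intro i
    have h := h i
    revert h
    show (NPre.close (π i) (P i)).IsProc → _
    cases π i
    · exact id
    · exact isProc_vsub.1
  | cnd v =>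
    intro i
    obtain ⟨h₁, h₂⟩ := h
    match i with
    | (0 : Fin 2) => exact h₁
    | (1 : Fin 2) => exact h₂
  | loc p => exact h.elim
  | par => exact h.elim

section Fill

variable {frag : Tm → Prop} {n : ℕ} {Ms : Fin n → Tm}

/-- Sessions do not occur inside processes. -/
lemma count_eq_zero_of_isProc (hM : ∀ i, ¬ (Ms i).IsProc) (C : (calculus frag).Cxt n)
    (h : (C.fill Ms : Tm).IsProc) (i : Fin n) : C.count i = 0 := by
  induction C with
  | hole j => exact (hM j h).elim
  | node o args ih =>
    exact Finset.sum_eq_zero fun k _ => ih k (Op.isProc_args h k)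

/-- If all `Ms i` have the participant `p`, then a typed context that is filled with them has at
most one hole, because different components of a session have different participants. -/
lemma count_le_one {p : ℕ} (hM : ∀ i, ¬ (Ms i).IsProc) (hp : ∀ i, p ∈ (Ms i).locs)
    (C : (calculus frag).Cxt n) {Δ : LCtx} (h : LocTy (C.fill Ms) Δ) :
    ∑ i, C.count i ≤ 1 ∧ (∑ i, C.count i ≠ 0 → p ∈ (C.fill Ms : Tm).locs) := by
  induction C generalizing Δ with
  | hole j =>
    refine ⟨?_, fun _ => hp j⟩
    simp [Calculus.Cxt.count]
  | node o args ih =>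
    simp only [Calculus.Cxt.count]
    rw [Finset.sum_comm]
    have h : LocTy (o.build fun k => (args k).fill Ms) Δ := h
    cases o with
    | loc q =>
      have h0 : ∀ k i, (args k).count i = 0 := by
        intro k
        obtain rfl : k = (0 : Fin 1) := Subsingleton.elim (α := Fin 1) _ _
        cases h with
        | loc h' => exact count_eq_zero_of_isProc hM _ (ProcTy.isProc h')
      simp [h0]
    | par =>
      cases h with
      | @par _ _ Δ₁ Δ₂ h₁ h₂ hd =>
        obtain ⟨h₃, h₄⟩ := ih (0 : Fin 2) h₁
        obtain ⟨h₅, h₆⟩ := ih (1 : Fin 2) h₂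
        have hs : ∑ k, ∑ i, (args k).count i =
            ∑ i, (args (0 : Fin 2)).count i + ∑ i, (args (1 : Fin 2)).count i :=
          Fin.sum_univ_two fun k => ∑ i, (args k).count i
        rw [hs]
        refine ⟨?_, fun h => ?_⟩
        · by_contra hc
          exact (hd p).elim (h₁.mem_locs (h₄ (by omega))) (h₂.mem_locs (h₆ (by omega)))
        · by_cases h0 : ∑ i, (args (0 : Fin 2)).count i = 0
          · exact .inr (h₆ (by omega))
          · exact .inl (h₄ h0)
    | _ => cases h

/-- A context of multiparty sessions cannot hold two copies of the same session, whereas a calculus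
with a binary operator that may be applied to two copies of a term needs such a context. -/
theorem not_duplicable {S : Calculus} {enc : S.Term → Tm} {eqv : Tm → Tm → Prop}
    {φ : S.Name → List (ℕ ⊕ ℕ)} (h : IsGoodEncodingWith S (calculus frag) enc eqv φ) (o : S.Op)
    (ho : 2 ≤ S.arity o) (M : S.Term) (hM : S.IsTerm M) (hM' : S.IsPhrase M)
    (hb : S.IsTerm (S.build o fun _ => M)) (hb' : S.IsPhrase (S.build o fun _ => M)) : False := by
  obtain ⟨C, hl, hC⟩ := h.compositional o (⋃ _ : Fin (S.arity o), S.names M)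
  have hC := hC (fun _ => M) (fun _ => hM') hb' rfl
  obtain ⟨-, -, Δ, ⟨hΔ, -⟩, -⟩ := h.maps M hM
  obtain ⟨-, -, Δ', ⟨hΔ', -⟩, -⟩ := h.maps _ hb
  obtain ⟨p, hp⟩ := hΔ.exists_loc
  rw [hC] at hΔ'
  have := (count_le_one (fun _ => hΔ.not_isProc) (fun _ => hp) C hΔ').1
  rw [Finset.sum_congr rfl fun i _ => hl i] at this
  simp at this
  omega

end Fill

lemma allDirected_of_twoParty {p q : ℕ} {M : Tm} {Δ : LCtx} (h : LocTy M Δ)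
    (h2 : M.TwoParty p q) : M.AllDirected := by
  induction h with
  | loc _ =>
    rcases h2 with ⟨-, h2⟩ | ⟨-, h2⟩
    · exact AllSums.mono (fun _ _ h i j => (h i).trans (h j).symm) h2
    · exact AllSums.mono (fun _ _ h i j => (h i).trans (h j).symm) h2
  | par _ _ _ ih₁ ih₂ => exact ⟨ih₁ h2.1, ih₂ h2.2⟩

lemma allDirected_of_classic {M : Tm} (h : M.AllSums Classic) : M.AllDirected := by
  refine AllSums.mono ?_ h
  rintro n π (⟨h, -⟩ | ⟨rfl, -⟩)
  · exact h
  · exact fun i j => by rw [Subsingleton.elim i j]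

/-- Sessions with directed choices cannot encode the ring: the component that represents `ringLeft`
would be reliable, and with it the whole encoding, although the ring may fail. -/
theorem not_scmp_encoding {frag : Tm → Prop}
    (hfrag : ∀ M Δ, frag M → LocTy M Δ → M.AllDirected) {enc : Tm → Tm} {eqv : Tm → Tm → Prop}
    {φ : ℕ ⊕ ℕ → List (ℕ ⊕ ℕ)} (h : IsGoodEncodingWith SCMP (calculus frag) enc eqv φ) : False := by
  obtain ⟨N₁, N₂, hc, he, -⟩ := h.exists_par (M₁ := ringLeft) (M₂ := ringRight) ring_isTerm
    ringLeft_isTerm ringRight_isTerm (Cong.refl _)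
  have hc : enc (par ringLeft ringRight) ≈ₛ par N₁ N₂ := Cong.of_false hc
  obtain ⟨hf, -, Δ, ⟨hΔ, -⟩, -⟩ := h.maps _ ring_isTerm
  have hr : (calculus frag).Reliable N₁ := h.bisimulation.reliable (h.equivalence.symm he)
    (h.reliable_enc ringLeft_isTerm ringLeft_reliable)
  refine h.not_reliable_enc ring_isTerm ringFailed_isTerm ring_steps ringFailed_fails ?_
  exact (reliable_par (hΔ.noClash.1.congr hc) (hc.allDirected_iff.1 (hfrag _ _ hf hΔ)) hr).of_steps
    (Steps.of_cong hc.symm)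

end MC
end SessionCalculi

/-! ### The separation result -/

namespace SessionCalculi

/-- A target with at most one restriction cannot encode two independent choosers, as one of the two
components of their encoding is deterministic. -/
lemma no_encoding_linear {S : Calculus} {frag : MS.Tm → Prop} {A : MS.Ty → Prop}
    (hfrag : ∀ P, frag P → P.resCount ≤ 1) (hS : S = SCMP ∨ S = CMV ∨ S = CMVplus)
    {enc : S.Term → MS.Tm} {eqv : MS.Tm → MS.Tm → Prop} {φ : S.Name → List ℕ}
    (h : IsGoodEncodingWith S (MS.calculus frag A) enc eqv φ) : False := by
  have hT : ∀ N N₁ N₂, (MS.calculus frag A).IsTerm N → MS.Cong N (MS.Tm.par N₁ N₂) →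
      ((MS.calculus frag A).MaySucceed N₁ → (MS.calculus frag A).Reliable N₁) ∨
        ((MS.calculus frag A).MaySucceed N₂ → (MS.calculus frag A).Reliable N₂) :=
    fun N N₁ N₂ hN hc => MS.reliable_component (hfrag N hN.1) hc
  rcases hS with rfl | rfl | rfl
  · exact h.not_two_choosers hT MC.scmpChooser_par_isTerm (MC.scmpChooser_isTerm 0)
      (MC.scmpChooser_isTerm 1) (MC.Cong.refl _) (MC.scmpFailed_isTerm 0) (MC.scmpFailed_isTerm 1)
      (MC.scmpChooser_maySucceed 0) (MC.scmpChooser_maySucceed 1) (MC.scmpChooser_steps 0)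
      (MC.scmpChooser_steps 1) (MC.scmpFailed_fails 0) (MC.scmpFailed_fails 1)
  · have hf : ¬ CMV.MaySucceed MS.cmvFailed :=
      MS.not_maySucceed_of_okFree ⟨trivial, trivial, trivial⟩
    exact h.not_two_choosers hT MS.cmvChooser_par_isTerm MS.cmvChooser_isTerm MS.cmvChooser_isTerm
      (MS.Cong.refl _) MS.cmvFailed_isTerm MS.cmvFailed_isTerm MS.cmvChooser_maySucceed
      MS.cmvChooser_maySucceed MS.cmvChooser_steps MS.cmvChooser_steps hf hf
  · have hf : ¬ CMVplus.MaySucceed MS.cmvplusFailed :=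
      MS.not_maySucceed_of_okFree ⟨trivial, trivial, trivial⟩
    exact h.not_two_choosers hT MS.cmvplusChooser_par_isTerm MS.cmvplusChooser_isTerm
      MS.cmvplusChooser_isTerm (MS.Cong.refl _) MS.cmvplusFailed_isTerm MS.cmvplusFailed_isTerm
      MS.cmvplusChooser_maySucceed MS.cmvplusChooser_maySucceed MS.cmvplusChooser_steps
      MS.cmvplusChooser_steps hf hf

/-- Multiparty sessions with directed choices cannot encode the ring of `SCMP`, and they cannot
encode the parallel composition of two copies of a term of mixed sessions. -/
lemma no_encoding_directed {S : Calculus} {frag : MC.Tm → Prop}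
    (hfrag : ∀ M Δ, frag M → MC.LocTy M Δ → M.AllDirected)
    (hS : S = SCMP ∨ S = CMV ∨ S = CMVplus) {enc : S.Term → MC.Tm}
    {eqv : MC.Tm → MC.Tm → Prop} {φ : S.Name → List (ℕ ⊕ ℕ)}
    (h : IsGoodEncodingWith S (MC.calculus frag) enc eqv φ) : False := by
  rcases hS with rfl | rfl | rfl
  · exact MC.not_scmp_encoding hfrag h
  · exact MC.not_duplicable h MS.Op.par le_rfl MS.cmvChooser MS.cmvChooser_isTerm
      MS.cmvChooser_isTerm MS.cmvChooser_par_isTerm MS.cmvChooser_par_isTerm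
  · exact MC.not_duplicable h MS.Op.par le_rfl MS.cmvplusChooser MS.cmvplusChooser_isTerm
      MS.cmvplusChooser_isTerm MS.cmvplusChooser_par_isTerm MS.cmvplusChooser_par_isTerm

end SessionCalculi

theorem mainTheorem5 :
    ∀ S ∈ ({SessionCalculi.SCMP, SessionCalculi.CMV, SessionCalculi.CMVplus} :
        Set SessionCalculi.Calculus),
    ∀ T ∈ ({SessionCalculi.LCMV, SessionCalculi.LCMVplus, SessionCalculi.MCBS, SessionCalculi.SCBS,
        SessionCalculi.BS, SessionCalculi.DMP, SessionCalculi.SMP, SessionCalculi.MP} :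
        Set SessionCalculi.Calculus),
      ¬ ∃ enc : S.Term → T.Term, SessionCalculi.IsGoodEncoding S T enc := by
  rintro S hS T hT ⟨enc, eqv, φ, h⟩
  simp only [Set.mem_insert_iff, Set.mem_singleton_iff] at hS hT
  -- the two linear targets, then the six multiparty targets
  rcases hT with rfl | rfl | hT
  · exact SessionCalculi.no_encoding_linear (fun _ h => h.2) hS h
  · exact SessionCalculi.no_encoding_linear (fun _ h => h.2) hS h
  · rcases hT with rfl | rfl | rfl | rfl | rfl | rfl
    · exact SessionCalculi.no_encoding_directed
        (fun _ _ ⟨_, _, _, h⟩ hΔ => SessionCalculi.MC.allDirected_of_twoParty hΔ h) hS h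
    · exact SessionCalculi.no_encoding_directed
        (fun _ _ ⟨⟨_, _, _, h⟩, _⟩ hΔ => SessionCalculi.MC.allDirected_of_twoParty hΔ h) hS h
    · exact SessionCalculi.no_encoding_directed
        (fun _ _ ⟨⟨_, _, _, h⟩, _⟩ hΔ => SessionCalculi.MC.allDirected_of_twoParty hΔ h) hS h
    · exact SessionCalculi.no_encoding_directed (fun _ _ h _ => h) hS h
    · exact SessionCalculi.no_encoding_directed
        (fun _ _ h _ => SessionCalculi.MC.Tm.AllSums.mono (fun _ _ h => h.2) h) hS h
    · exact SessionCalculi.no_encoding_directed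
        (fun _ _ h _ => SessionCalculi.MC.allDirected_of_classic h) hS h
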